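/- Let $d\ge 2$ and $k\ge d+2$ be integers with $\frac1{d+1}+\frac1{k-d-1}>\frac12$ (the cases in which the Cox ring of $X_{k,d}$, the blow-up of $\mathbb P^d_{\mathbb C}$ at $k$ generic points, is finitely generated). **Mukai edge graph.** On $\operatorname{Pic}(X_{k,d})=\mathbb Z H\oplus\bigoplus_i\mathbb Z E_i$ let $(H,H)=d-1$, $(H,E_i)=0$, $(E_i,E_j)=-\delta_{ij}$, and let $K=-(d+1)H+(d-1)\sum_iE_i$. The anticanonical degree of $D$ is $\frac1{d-1}(-K,D)$. Consider the graph whose vertices are the classes $D$ of effective divisors ($h^0(D)>0$) of anticanonical degree one, two distinct classes being adjacent if their Mukai product is $0$. The $(k,d)$-Mukai edge graph $M_{k,d}$ is the connected component of $E_1$. **KD polytopes.** Let the columns of a $(d+1)\times k$ matrix $P$ over $\mathbb C(t)$ be points $p_1,\dots,p_k$ of $\mathbb P^d(\mathbb C(t))$. For $D=m_0H-\sum m_iE_i$ let $L_P(D)$ be the space of forms of degree $m_0$ with multiplicity at least $m_i$ at $p_i$ for all $i$, and for $f\in L_P(D)$ put $S_D(f)=f\left(P\cdot\frac yx\right)\prod_i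 x_i^{m_0-m_i}\in\mathbb C(t)[x_1,\dots,x_k,y_1,\dots,y_k]$. The points are in general position if, for every effective $D$ of anticanonical degree one with $m_0>0$, $\dim L_P(D)=h^0(D)$ and $S_D(f)\neq0$ for all $0\ne f\in L_P(D)$. Let $R_P$ be the $\mathbb C(t)$-algebra generated by all $S_D(f)$ with $D$ effective of anticanonical degree one and $f\in L_P(D)$ (for $D=E_i$ these are the multiples of $x_i$); this is the model of $\operatorname{Cox}(X_{k,d})$. The multidegree of an exponent vector $(a,b)$ of $x^ay^b$ is $m_0H-\sum m_iE_i$ with $m_0=\sum_j b_j$ and $m_0-m_i=a_i+b_i$; extend it, and the anticanonical degree, linearly to $\mathbb R^{2k}$. A Khovanskii basis of $R_P$ is a set of generators $\mathcal F$ such that every initial form $\mathrm{in}_0(f)=(t^{-\mathrm{ord} f}f)|_{t=0}$, $f\in\mathcal F$, is a monomial (up to a nonzero scalar) and these monomials generate the initial algebra $\mathrm{in}_0(R_P)$. A $(k,d)$-KD (Khovanskii degeneration) polytope is the slice of anticanonical degree one of the cone spanned by the exponents of $\mathrm{in}_0(f)$, $f\in\mathcal F$, where $\mathcal F$ is a finite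 Khovanskii basis of $R_P$ for some points $P$ in general position, such that the projective toric variety $\operatorname{Proj}(\mathrm{in}_0(R_P))$ (graded by anticanonical degree) is normal. **Theorem 6.3.** $M_{k,d}$ is a subgraph of the vertex-edge graph $G(Q)$ of every $(k,d)$-KD polytope $Q$: for each vertex $D$ of $M_{k,d}$ there is exactly one point $P_D$ of $Q$ of multidegree $D$; it is a vertex of $Q$, and $P_D$, $P_E$ span an edge of $Q$ whenever $D$, $E$ are adjacent in $M_{k,d}$. Consequently: 1. Every $(k,d)$-KD polytope $Q$ has at least as many edges as $M_{k,d}$, and if it has exactly that minimal number, then $D\mapsto P_D$ is an isomorphism of $M_{k,d}$ onto $G(Q)$. 2. A $(k,d)$-KD polytope whose graph is isomorphic to $M_{k,d}$ has the minimal number of edges among all $(k,d)$-KD polytopes. 3. If some $(k,d)$-KD polytope has as many edges as $M_{k,d}$, then every $(k,d)$-KD polytope $Q$ with the minimal number of edges among all $(k,d)$-KD polytopes has the Mukai edge graph as its graph, through $D\mapsto P_D$. -/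

import Mathlib

open MvPolynomial

noncomputable section

namespace MukaiKD

/-! ### Divisor classes and the Mukai form -/

/-- The Picard group of the blow-up of `ℙ^d` at `k` points, with coefficients in `A`.
The pair `(m₀, m)` stands for the class `m₀ H - ∑ i, mᵢ Eᵢ`. -/
abbrev Cls (A : Type*) (k : ℕ) : Type _ := A × (Fin k → A)

/-- Extension of scalars of divisor classes from `ℤ` to `A`. -/
def Cls.cast (A : Type*) [Ring A] {k : ℕ} (D : Cls ℤ k) : Cls A k :=
  ((D.1 : A), fun i => (D.2 i : A))

/-- The Mukai form: `(H, H) = d - 1`, `(H, Eᵢ) = 0`, `(Eᵢ, Eⱼ) = -δᵢⱼ`. -/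
def mukaiForm {A : Type*} [CommRing A] {k : ℕ} (d : ℕ) (D D' : Cls A k) : A :=
  ((d : A) - 1) * D.1 * D'.1 - ∑ i, D.2 i * D'.2 i

/-- The canonical class `-(d + 1) H + (d - 1) ∑ i, Eᵢ`. -/
def canonicalClass (A : Type*) [CommRing A] (k d : ℕ) : Cls A k :=
  (-((d : A) + 1), fun _ => -((d : A) - 1))

/-- The anticanonical degree `(-K, D) / (d - 1)`. -/
def anticanonicalDegree {A : Type*} [Field A] {k : ℕ} (d : ℕ) (D : Cls A k) : A :=
  mukaiForm d (-canonicalClass A k d) D / ((d : A) - 1)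

/-- The class of the exceptional divisor over the `i`-th point. -/
def exceptional {k : ℕ} (i : Fin k) : Cls ℤ k := (0, fun j => if j = i then -1 else 0)

/-! ### Linear systems of hypersurfaces through multiple points -/

/-- The polynomials that vanish to order at least `m` at the point `p` of affine space: the Taylor
expansion at `p` has no term of degree less than `m`. -/
def vanishing {K : Type*} [Field K] {n : ℕ} (p : Fin n → K) (m : ℕ) :
    Submodule K (MvPolynomial (Fin n) K) where
  carrier := {f | ∀ e : Fin n →₀ ℕ, e.degree < m → coeff e (aeval (fun j => X j + C (p j)) f) = 0}
  add_mem' := by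
    intro f g hf hg e he
    rw [map_add, coeff_add, hf e he, hg e he, add_zero]
  zero_mem' := by
    intro e _
    simp
  smul_mem' := by
    intro c f hf e he
    rw [map_smul, coeff_smul, hf e he, smul_zero]

open Classical in
/-- The linear system of `D = m₀ H - ∑ i, mᵢ Eᵢ` for the points of `ℙ^d` given by the columns of
`P`: forms of degree `m₀` with multiplicity at least `mᵢ` at the `i`-th point. (A negative `mᵢ`
imposes no condition; there are no sections if `m₀ < 0`.) For a form, the multiplicity at a point
of projective space is the order of vanishing at any nonzero representative. -/
def linearSystem {K : Type*} [Field K] {k d : ℕ} (P : Matrix (Fin (d + 1)) (Fin k) K)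
    (D : Cls ℤ k) : Submodule K (MvPolynomial (Fin (d + 1)) K) :=
  if 0 ≤ D.1 then
    homogeneousSubmodule (Fin (d + 1)) K D.1.toNat ⊓
      ⨅ i, vanishing (fun j => P j i) (D.2 i).toNat
  else ⊥

/-- `h⁰(X_{k,d}, D)`, where `X_{k,d}` is the blow-up of `ℙ^d` over `ℂ` at `k` generic points. By
semicontinuity, the dimension of the linear system at generic points is its minimum over all
`k`-tuples of points. -/
def h0 (k d : ℕ) (D : Cls ℤ k) : ℕ :=
  sInf {n | ∃ P : Matrix (Fin (d + 1)) (Fin k) ℂ,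
    (∀ i, (fun j => P j i) ≠ 0) ∧ n = Module.finrank ℂ (linearSystem P D)}

/-- `D` is (the class of) an effective divisor on `X_{k,d}` of anticanonical degree one. -/
def IsDegreeOne (k d : ℕ) (D : Cls ℤ k) : Prop :=
  anticanonicalDegree d (D.cast ℚ) = 1 ∧ 0 < h0 k d D

/-! ### The Mukai edge graph -/

/-- Two divisors of anticanonical degree one are adjacent if their Mukai product is zero. (Classes
that are not divisors of anticanonical degree one are isolated here.) -/
def degreeOneGraph (k d : ℕ) : SimpleGraph (Cls ℤ k) where
  Adj D D' := D ≠ D' ∧ IsDegreeOne k d D ∧ IsDegreeOne k d D' ∧ mukaiForm d D D' = 0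
  symm := ⟨by
    rintro D D' ⟨h, h1, h2, h3⟩
    refine ⟨h.symm, h2, h1, ?_⟩
    rw [← h3]
    unfold mukaiForm
    congr 1
    · ring
    · exact Finset.sum_congr rfl fun i _ => mul_comm _ _⟩
  loopless := ⟨fun _ h => h.1 rfl⟩

/-- The connected component of `E₁` among the divisors of anticanonical degree one. -/
def mukaiVertices (k d : ℕ) : Set (Cls ℤ k) :=
  {D | ∃ i : Fin k, (i : ℕ) = 0 ∧ (degreeOneGraph k d).Reachable (exceptional i) D}

/-- The `(k,d)`-Mukai edge graph. -/
def mukaiEdgeGraph (k d : ℕ) : SimpleGraph (mukaiVertices k d) :=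
  (degreeOneGraph k d).induce (mukaiVertices k d)

/-! ### The Cox ring over `ℂ(t)` as a subalgebra of a polynomial ring -/

/-- Indices of the variables `x₁, …, x_k` (`Sum.inl`) and `y₁, …, y_k` (`Sum.inr`). -/
abbrev XY (k : ℕ) : Type := Fin k ⊕ Fin k

/-- `f (P · y/x) · ∏ i, xᵢ ^ (m₀ - mᵢ)`, as an element of the field of rational functions in the
variables `x`, `y`. -/
def coxSection {K : Type*} [Field K] {k d : ℕ} (P : Matrix (Fin (d + 1)) (Fin k) K)
    (D : Cls ℤ k) (f : MvPolynomial (Fin (d + 1)) K) : FractionRing (MvPolynomial (XY k) K) :=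
  aeval (fun j => ∑ i, algebraMap (MvPolynomial (XY k) K) _ (C (P j i)) *
      (algebraMap (MvPolynomial (XY k) K) _ (X (Sum.inr i)) /
        algebraMap (MvPolynomial (XY k) K) _ (X (Sum.inl i)))) f *
    ∏ i, algebraMap (MvPolynomial (XY k) K) (FractionRing (MvPolynomial (XY k) K))
      (X (Sum.inl i)) ^ (D.1 - D.2 i)

/-- The columns of `P` are points of `ℙ^d` in general position: for every divisor `D` of
anticanonical degree one with `m₀ > 0`, the linear system of `D` has a basis with `h⁰(D)` elements,
and no nonzero element of it is sent to zero. -/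
def GeneralPosition {K : Type*} [Field K] {k d : ℕ} (P : Matrix (Fin (d + 1)) (Fin k) K) : Prop :=
  (∀ i, (fun j => P j i) ≠ 0) ∧
  ∀ D : Cls ℤ k, IsDegreeOne k d D → 0 < D.1 →
    Module.finrank K (linearSystem P D) = h0 k d D ∧
    ∀ f ∈ linearSystem P D, f ≠ 0 → coxSection P D f ≠ 0

/-- The image of the Cox ring presentation: the subalgebra of the polynomial ring in `x`, `y`
generated by the images of the sections of all divisors `D` of anticanonical degree one. By
linearity of `coxSection P D`, these sections and those in a basis for each `D` generate the same
subalgebra. For `D = Eᵢ` the sections are the multiples of `xᵢ`. -/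
def coxImage {K : Type*} [Field K] {k d : ℕ} (P : Matrix (Fin (d + 1)) (Fin k) K) :
    Subalgebra K (MvPolynomial (XY k) K) :=
  Algebra.adjoin K {g | ∃ D : Cls ℤ k, IsDegreeOne k d D ∧ ∃ f ∈ linearSystem P D,
    algebraMap (MvPolynomial (XY k) K) (FractionRing (MvPolynomial (XY k) K)) g =
      coxSection P D f}

/-! ### Initial forms and Khovanskii bases -/

/-- The order in `t` of a polynomial over `ℂ(t)`: the minimum of the orders at `t = 0` of its
nonzero coefficients, computed on Laurent expansions (`0` for the zero polynomial). -/
def tOrder {σ : Type*} (f : MvPolynomial σ (RatFunc ℂ)) : ℤ :=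
  open Classical in
  if h : f.support.Nonempty then
    f.support.inf' h fun e => ((coeff e f : RatFunc ℂ) : LaurentSeries ℂ).order
  else 0

/-- The initial form `(t ^ (-ord f) f)|_{t = 0}`: the coefficient at `e` is the coefficient of
`t ^ (ord f)` in the Laurent expansion of the coefficient of `f` at `e`. -/
def initialForm {σ : Type*} (f : MvPolynomial σ (RatFunc ℂ)) : MvPolynomial σ ℂ :=
  ∑ e ∈ f.support, monomial e (((coeff e f : RatFunc ℂ) : LaurentSeries ℂ).coeff (tOrder f))

/-- The initial algebra of `R`, generated over `ℂ` by the initial forms of its elements. -/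
def initialAlgebra {σ : Type*} (R : Subalgebra (RatFunc ℂ) (MvPolynomial σ (RatFunc ℂ))) :
    Subalgebra ℂ (MvPolynomial σ ℂ) :=
  Algebra.adjoin ℂ (initialForm '' (R : Set (MvPolynomial σ (RatFunc ℂ))))

/-- Khovanskii (sagbi) bases; a monomial is allowed to have a nonzero coefficient. -/
def IsKhovanskiiBasis {σ : Type*} (R : Subalgebra (RatFunc ℂ) (MvPolynomial σ (RatFunc ℂ)))
    (F : Set (MvPolynomial σ (RatFunc ℂ))) : Prop :=
  Algebra.adjoin (RatFunc ℂ) F = R ∧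
  (∀ f ∈ F, ∃ (e : σ →₀ ℕ) (c : ℂ), c ≠ 0 ∧ initialForm f = monomial e c) ∧
  Algebra.adjoin ℂ (initialForm '' F) = initialAlgebra R

/-! ### The polytope of a normal toric degeneration -/

/-- The exponents of the monomials that occur in the initial forms of `F`, as integer vectors. -/
def exponents {σ : Type*} (F : Set (MvPolynomial σ (RatFunc ℂ))) : Set (σ → ℤ) :=
  {v | ∃ f ∈ F, ∃ e ∈ (initialForm f).support, v = fun s => (e s : ℤ)}

/-- The class `m₀ H - ∑ i, mᵢ Eᵢ` of an exponent vector of `x`, `y`: the degree in `y` is `m₀`, and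
the degree in `xᵢ, yᵢ` is `m₀ - mᵢ`. -/
def multidegree {A : Type*} [CommRing A] {k : ℕ} (v : XY k → A) : Cls A k :=
  (∑ i, v (Sum.inr i), fun i => (∑ j, v (Sum.inr j)) - (v (Sum.inl i) + v (Sum.inr i)))

/-- The projective toric variety `Proj ℂ[S]`, graded by anticanonical degree, is normal, where `S`
is the semigroup generated by `V`. In each chart given by a nonzero `s ∈ S`, the semigroup of all
`u` of degree zero in the lattice of `S` with `u + j s ∈ S` for some `j` is saturated. This holds
in particular if `S` itself is saturated. -/
def NormalToric {k : ℕ} (d : ℕ) (V : Set (XY k → ℤ)) : Prop :=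
  ∀ s ∈ AddSubmonoid.closure V, s ≠ 0 →
    ∀ u ∈ AddSubgroup.closure V, anticanonicalDegree d ((multidegree u).cast ℚ) = 0 →
      ∀ n : ℕ, 0 < n → (∃ j : ℕ, n • u + j • s ∈ AddSubmonoid.closure V) →
        ∃ j : ℕ, u + j • s ∈ AddSubmonoid.closure V

/-- The slice of anticanonical degree one of the cone spanned by `V`. If all elements of `V` have
degree one, this is the convex hull of `V`. -/
def slicePolytope {k : ℕ} (d : ℕ) (V : Set (XY k → ℤ)) : Set (XY k → ℝ) :=
  {v | v ∈ PointedCone.hull ℝ ((fun (w : XY k → ℤ) (s : XY k) => (w s : ℝ)) '' V) ∧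
    anticanonicalDegree d (multidegree v) = 1}

/-- `(k,d)`-Khovanskii degeneration polytopes: the polytopes of the normal toric degenerations,
given by a finite Khovanskii basis, of the Cox ring for `k` points in general position in `ℙ^d`
over `ℂ(t)`. -/
def IsKDPolytope (k d : ℕ) (Q : Set (XY k → ℝ)) : Prop :=
  ∃ P : Matrix (Fin (d + 1)) (Fin k) (RatFunc ℂ), GeneralPosition P ∧
    ∃ F : Set (MvPolynomial (XY k) (RatFunc ℂ)), F.Finite ∧ IsKhovanskiiBasis (coxImage P) F ∧
      NormalToric d (exponents F) ∧ Q = slicePolytope d (exponents F)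

/-- The vertex-edge graph of a polytope. Faces are the exposed subsets; vertices are the faces that
are points, and edges are the faces that are segments. -/
def vertexEdgeGraph {E : Type*} [AddCommGroup E] [Module ℝ E] [TopologicalSpace E] (Q : Set E) :
    SimpleGraph (Q.exposedPoints ℝ) where
  Adj v w := v ≠ w ∧ IsExposed ℝ Q (segment ℝ (v : E) (w : E))
  symm := ⟨by
    rintro v w ⟨h, h1⟩
    exact ⟨h.symm, by rw [segment_symm]; exact h1⟩⟩
  loopless := ⟨fun _ h => h.1 rfl⟩

end MukaiKD

end

open MukaiKD

noncomputable section

namespace MukaiKD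

/-! ### Cremona reflections of divisor classes -/

/-! Every vertex D of the Mukai edge graph behaves like an exceptional divisor: h⁰(D) = 1, (D, D) =
-1, and (D, F) ≥ 0 for every other effective class F of anticanonical degree one (`IsExtremal`).
Hence the linear form (D, ·) + deg is nonnegative on the classes of the generators of the Cox ring
and vanishes only at D; for orthogonal D ≠ E the form (D + E, ·) + deg vanishes only at D and E
(`faceForm_faceClass`). In a multidegree where such a form vanishes, the Cox ring is therefore
spanned by one product g_D^a g_E^b of the sections of D and E (`component_eq_of_faceForm_eq_zero`).
Since initial forms are multiplicative, the same forms support Q, and they cut out the point P_D or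
the segment from P_D to P_E (`exists_vertexExponent`, `IsKDPolytope.exists_hom`).

The vertices are extremal because they lie in the orbit of the exceptional classes under Cremona
reflections. The assumption on k and d amounts to k (d - 1) < (d + 1)². By an averaging argument, an
effective class whose m₀ is not lowered by the reflection at its d + 1 largest multiplicities is
zero or has positive degree (`CremonaStable.eq_zero_or_intDegree_pos`). The same descent, restricted
to points other than i, shows that an effective class of degree one orthogonal to Eᵢ is in the orbit
(`CremonaStable.orbit_of_apply_eq_zero`); so orbit membership spreads along the edges of the graph.

That reflections preserve effectivity is proved on special configurations: points with ℤ-independent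
parameters on a cuspidal curve of degree d + 1. A Cremona transformation based at d + 1 of them
yields another such configuration, with parameters changed by an invertible linear map
(`finrank_cuspidal_cremona_le`). As `h0` is a minimum over configurations, generically effective
classes are effective here, and dimensions computed here bound `h0` from above.

In the case of equality, Q has finitely many vertices, each on an edge (`exists_exposed_segment`),
so an injective homomorphism onto a graph with equally many edges is an isomorphism. -/

/-- The anticanonical degree of an integral class, as an integer. -/
def intDegree {k : ℕ} (d : ℕ) (D : Cls ℤ k) : ℤ := ((d : ℤ) + 1) * D.1 - ∑ i, D.2 i

theorem anticanonicalDegree_eq {A : Type*} [Field A] {k d : ℕ} (hd : (d : A) - 1 ≠ 0)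
    (D : Cls A k) :
    anticanonicalDegree d D = ((d : A) + 1) * D.1 - ∑ i, D.2 i := by
  unfold anticanonicalDegree mukaiForm canonicalClass
  rw [div_eq_iff hd]
  simp only [Prod.fst_neg, Prod.snd_neg, Pi.neg_apply, neg_neg, ← Finset.mul_sum]
  ring

theorem anticanonicalDegree_cast {A : Type*} [Field A] {k d : ℕ} (hd : (d : A) - 1 ≠ 0)
    (D : Cls ℤ k) : anticanonicalDegree d (D.cast A) = (intDegree d D : A) := by
  rw [anticanonicalDegree_eq hd]
  simp [Cls.cast, intDegree]

/-- The pairing of `D` with the root `H - ∑ i ∈ I, Eᵢ`. -/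
def rootPairing {k : ℕ} (d : ℕ) (I : Finset (Fin k)) (D : Cls ℤ k) : ℤ :=
  ((d : ℤ) - 1) * D.1 - ∑ i ∈ I, D.2 i

/-- The action on divisor classes of the Cremona transformation based at the points in `I`. -/
def cremona {k : ℕ} (d : ℕ) (I : Finset (Fin k)) (D : Cls ℤ k) : Cls ℤ k :=
  (D.1 + rootPairing d I D, fun i => D.2 i + if i ∈ I then rootPairing d I D else 0)

/-- The root α = H - ∑ i ∈ I, Eᵢ has (α, α) = (d - 1) - (d + 1) = -2 when |I| = d + 1, so D ↦ D +
(D, α) α is the reflection in α. -/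
theorem rootPairing_cremona {k d : ℕ} {I : Finset (Fin k)} (hI : I.card = d + 1)
    (D : Cls ℤ k) : rootPairing d I (cremona d I D) = -rootPairing d I D := by
  have h : ∑ i ∈ I, (cremona d I D).2 i = ∑ i ∈ I, D.2 i + (d + 1) * rootPairing d I D := by
    simp only [cremona, Finset.sum_add_distrib]
    rw [Finset.sum_congr rfl (g := fun _ => rootPairing d I D) fun i hi => if_pos hi]
    simp [hI]
  rw [rootPairing, h]
  simp only [cremona]
  simp only [rootPairing]
  ring

theorem cremona_cremona {k d : ℕ} {I : Finset (Fin k)} (hI : I.card = d + 1) (D : Cls ℤ k) :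
    cremona d I (cremona d I D) = D := by
  have h := rootPairing_cremona hI D
  refine Prod.ext ?_ (funext fun i => ?_)
  · change (cremona d I D).1 + _ = _
    rw [h]
    simp [cremona]
  · change (cremona d I D).2 i + _ = _
    rw [h]
    by_cases hi : i ∈ I <;> simp [cremona, hi]

theorem mukaiForm_comm {k d : ℕ} (D D' : Cls ℤ k) : mukaiForm d D D' = mukaiForm d D' D := by
  unfold mukaiForm
  congr 1
  · ring
  · exact Finset.sum_congr rfl fun i _ => mul_comm _ _

theorem mukaiForm_cremona_left {k d : ℕ} (I : Finset (Fin k)) (D F : Cls ℤ k) :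
    mukaiForm d (cremona d I D) F = mukaiForm d D F + rootPairing d I D * rootPairing d I F := by
  have h : ∑ i, (cremona d I D).2 i * F.2 i =
      ∑ i, D.2 i * F.2 i + rootPairing d I D * ∑ i ∈ I, F.2 i := by
    simp only [cremona, add_mul, ite_mul, zero_mul, Finset.sum_add_distrib, Finset.sum_ite_mem,
      Finset.univ_inter, Finset.mul_sum]
  rw [mukaiForm, h, mukaiForm]
  simp only [cremona]
  simp only [rootPairing]
  ring

/-- The correction term (D, α)(F, α) is symmetric in D and F, for I of any size. In inductions along
an orbit this shifts reflections to the other argument. -/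
theorem mukaiForm_cremona {k d : ℕ} (I : Finset (Fin k)) (D F : Cls ℤ k) :
    mukaiForm d (cremona d I D) F = mukaiForm d D (cremona d I F) := by
  rw [mukaiForm_cremona_left, mukaiForm_comm D (cremona d I F), mukaiForm_cremona_left,
    mukaiForm_comm F]
  ring

/-- The root is orthogonal to K: both terms of the degree grow by (d + 1)(D, α). -/
theorem intDegree_cremona {k d : ℕ} {I : Finset (Fin k)} (hI : I.card = d + 1) (D : Cls ℤ k) :
    intDegree d (cremona d I D) = intDegree d D := by
  simp only [intDegree, cremona, Finset.sum_add_distrib, Finset.sum_ite_mem, Finset.univ_inter,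
    Finset.sum_const, hI, nsmul_eq_mul]
  push_cast
  ring

theorem cremona_zero {k d : ℕ} (I : Finset (Fin k)) : cremona d I (0 : Cls ℤ k) = 0 := by
  refine Prod.ext ?_ (funext fun i => ?_) <;> simp [cremona, rootPairing]

theorem mukaiForm_exceptional {k d : ℕ} (i : Fin k) (F : Cls ℤ k) :
    mukaiForm d (exceptional i) F = F.2 i := by
  simp [mukaiForm, exceptional]

theorem intDegree_exceptional {k d : ℕ} (i : Fin k) : intDegree d (exceptional i) = 1 := by
  simp [intDegree, exceptional]

/-! ### Lowering the degree of effective classes by reflections. -/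

/-- A subset of the given size that collects the largest values of a function. -/
theorem exists_top_subset {α : Type*} [DecidableEq α] (s : Finset α) (m : α → ℤ) {n : ℕ}
    (hn : n ≤ s.card) :
    ∃ I ⊆ s, I.card = n ∧ ∀ i ∈ I, ∀ j ∈ s, j ∉ I → m j ≤ m i := by
  obtain ⟨I, hI, hmax⟩ := Finset.exists_max_image (s.powersetCard n) (fun I => ∑ i ∈ I, m i)
    (Finset.powersetCard_nonempty.2 hn)
  rw [Finset.mem_powersetCard] at hI
  refine ⟨I, hI.1, hI.2, fun i hi j hj hjI => ?_⟩
  have h1 : j ∉ I.erase i := fun h => hjI (Finset.mem_of_mem_erase h)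
  -- The set I has the largest sum of its size, so exchanging i for j cannot increase the sum.
  have h := hmax (insert j (I.erase i)) (by
    rw [Finset.mem_powersetCard]
    refine ⟨Finset.insert_subset hj ((Finset.erase_subset _ _).trans hI.1), ?_⟩
    rw [Finset.card_insert_of_notMem h1, Finset.card_erase_of_mem hi, ← hI.2]
    have := Finset.card_pos.2 ⟨i, hi⟩
    omega)
  rw [Finset.sum_insert h1] at h
  have := Finset.add_sum_erase I m hi
  linarith

/-- The average of the largest values is at least the average of all values. -/
theorem card_mul_sum_le_of_top {α : Type*} [DecidableEq α] {s I : Finset α} {m : α → ℤ}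
    (hI : I ⊆ s) (h : ∀ i ∈ I, ∀ j ∈ s, j ∉ I → m j ≤ m i) :
    (I.card : ℤ) * ∑ j ∈ s, m j ≤ s.card * ∑ i ∈ I, m i := by
  have h1 : ∑ i ∈ I, ∑ j ∈ s \ I, m j ≤ ∑ i ∈ I, ∑ _j ∈ s \ I, m i :=
    Finset.sum_le_sum fun i hi => Finset.sum_le_sum fun j hj =>
      h i hi j (Finset.mem_sdiff.1 hj).1 (Finset.mem_sdiff.1 hj).2
  simp only [Finset.sum_const, nsmul_eq_mul, ← Finset.mul_sum] at h1
  rw [← Finset.sum_sdiff hI]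
  have h2 : ((s \ I).card : ℤ) = s.card - I.card := by
    rw [Finset.card_sdiff_of_subset hI, Nat.cast_sub (Finset.card_le_card hI)]
  rw [h2] at h1
  linarith

/-- The formal properties of effectivity on which the combinatorics of the Weyl group orbit of the
exceptional divisors depends. -/
structure CremonaStable {k : ℕ} (d : ℕ) (Eff : Cls ℤ k → Prop) : Prop where
  nonneg : ∀ D, Eff D → 0 ≤ D.1
  posPart : ∀ D, Eff D → Eff (D.1, fun i => max (D.2 i) 0)
  reflect : ∀ (I : Finset (Fin k)), I.card = d + 1 → ∀ D, Eff D → Eff (cremona d I D)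

/-- Nonzero effective divisors have positive anticanonical degree. -/
theorem CremonaStable.eq_zero_or_intDegree_pos {k d : ℕ} (hk : d + 1 ≤ k)
    (hfin : (k : ℤ) * ((d : ℤ) - 1) < ((d : ℤ) + 1) ^ 2) {Eff : Cls ℤ k → Prop}
    (hE : CremonaStable d Eff) (D : Cls ℤ k) (hD : Eff D) : D = 0 ∨ 0 < intDegree d D := by
  induction hn : D.1.toNat using Nat.strong_induction_on generalizing D with
  | _ n ih =>
  -- Replacing negative multiplicities by 0 keeps m₀ and effectivity, and lowers the anticanonical
  -- degree by the total cut off.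
  wlog hpos : ∀ i, 0 ≤ D.2 i generalizing D with H
  · have h1 := H (D.1, fun i => max (D.2 i) 0) (hE.posPart D hD) hn fun i => le_max_right _ _
    have h2 : intDegree d (D.1, fun i => max (D.2 i) 0) =
        intDegree d D - ∑ i, (max (D.2 i) 0 - D.2 i) := by
      simp only [intDegree, Finset.sum_sub_distrib]
      ring
    have h3 : ∀ i, 0 ≤ max (D.2 i) 0 - D.2 i := fun i => by
      have := le_max_left (D.2 i) 0
      linarith
    right
    push Not at hpos
    obtain ⟨i, hi⟩ := hpos
    have h4 : 0 < ∑ i, (max (D.2 i) 0 - D.2 i) :=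
      Finset.sum_pos' (fun i _ => h3 i) ⟨i, Finset.mem_univ _, by
        have := le_max_right (D.2 i) 0
        linarith⟩
    have h5 : 0 ≤ intDegree d (D.1, fun i => max (D.2 i) 0) := by
      rcases h1 with h1 | h1
      · rw [h1]; simp [intDegree]
      · exact h1.le
    linarith
  have h0 := hE.nonneg D hD
  obtain ⟨I, -, hIc, hI⟩ := exists_top_subset (Finset.univ : Finset (Fin k)) D.2
    (n := d + 1) (by simpa using hk)
  -- A negative pairing means that the reflection lowers m₀, which drives the induction.
  by_cases hr : rootPairing d I D < 0
  · have hE' := hE.reflect I hIc D hD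
    have h0' := hE.nonneg _ hE'
    have h1 : (cremona d I D).1 = D.1 + rootPairing d I D := rfl
    rcases ih _ (by rw [← hn]; omega) _ hE' rfl with h | h
    · left
      rw [← cremona_cremona hIc D, h, cremona_zero]
    · right
      rwa [intDegree_cremona hIc] at h
  · push Not at hr
    -- Otherwise (d + 1) ∑ mᵢ ≤ k ∑_I mᵢ ≤ k (d - 1) m₀, which is less than (d + 1)² m₀ as soon as
    -- m₀ > 0.
    have havg := card_mul_sum_le_of_top (Finset.subset_univ I) hI
    rw [hIc, Finset.card_univ, Fintype.card_fin] at havg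
    push_cast at havg
    have hr' : ∑ i ∈ I, D.2 i ≤ ((d : ℤ) - 1) * D.1 := by
      unfold rootPairing at hr; linarith
    have hk0 : (0 : ℤ) ≤ k := by positivity
    have h1 : ((d : ℤ) + 1) * ∑ i, D.2 i ≤ k * (((d : ℤ) - 1) * D.1) :=
      havg.trans (mul_le_mul_of_nonneg_left hr' hk0)
    rcases h0.eq_or_lt with h0 | h0
    · left
      have h2 : ∑ i, D.2 i ≤ 0 := by
        rw [← h0] at h1
        by_contra! h
        have : 0 < ((d : ℤ) + 1) * ∑ i, D.2 i := by positivity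
        linarith
      have h3 := (Finset.sum_eq_zero_iff_of_nonneg fun i _ => hpos i).1
        (le_antisymm h2 (Finset.sum_nonneg fun i _ => hpos i))
      exact Prod.ext h0.symm (funext fun i => h3 i (Finset.mem_univ i))
    · right
      have h2 : 0 < ((d : ℤ) + 1) * intDegree d D := by
        unfold intDegree
        nlinarith
      exact pos_of_mul_pos_right h2 (by positivity)

/-- Cutting off the negative multiplicities lowers the degree from 1 to at most 0, so what remains
is the class 0. Hence F is a sum of exceptional classes with total coefficient one. -/
theorem CremonaStable.eq_exceptional {k d : ℕ} (hk : d + 1 ≤ k)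
    (hfin : (k : ℤ) * ((d : ℤ) - 1) < ((d : ℤ) + 1) ^ 2) {Eff : Cls ℤ k → Prop}
    (hE : CremonaStable d Eff) {F : Cls ℤ k} (hF : Eff F) (hdeg : intDegree d F = 1) {i : Fin k}
    (hi : F.2 i < 0) : F = exceptional i := by
  have h1 := hE.eq_zero_or_intDegree_pos hk hfin _ (hE.posPart F hF)
  have h2 : intDegree d (F.1, fun i => max (F.2 i) 0) =
      intDegree d F - ∑ i, (max (F.2 i) 0 - F.2 i) := by
    simp only [intDegree, Finset.sum_sub_distrib]
    ring
  have h3 : ∀ i, 0 ≤ max (F.2 i) 0 - F.2 i := fun i => by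
    have := le_max_left (F.2 i) 0
    linarith
  have h4 : max (F.2 i) 0 - F.2 i ≤ ∑ i, (max (F.2 i) 0 - F.2 i) :=
    Finset.single_le_sum (f := fun i => max (F.2 i) 0 - F.2 i) (fun i _ => h3 i)
      (Finset.mem_univ i)
  rw [max_eq_right hi.le] at h4
  have h5 : (F.1, fun i => max (F.2 i) 0) = (0 : Cls ℤ k) := by
    rcases h1 with h1 | h1
    · exact h1
    · omega
  have h6 : F.1 = 0 := congrArg Prod.fst h5
  have h7 : ∀ j, max (F.2 j) 0 = 0 := fun j => congrFun (congrArg Prod.snd h5) j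
  have h8 : ∑ j, -F.2 j = 1 := by
    rw [← hdeg, intDegree, h6, Finset.sum_neg_distrib]
    ring
  have h9 : ∀ j, 0 ≤ -F.2 j := fun j => by
    have := le_max_left (F.2 j) 0
    rw [h7] at this
    omega
  have h10 := Finset.add_sum_erase Finset.univ (fun j => -F.2 j) (Finset.mem_univ i)
  have h11 : 0 ≤ ∑ j ∈ Finset.univ.erase i, -F.2 j := Finset.sum_nonneg fun j _ => h9 j
  have h12 : ∑ j ∈ Finset.univ.erase i, -F.2 j = 0 := by
    omega
  refine Prod.ext h6 (funext fun j => ?_)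
  by_cases hj : j = i
  · subst hj
    simp only [exceptional, if_true]
    omega
  · have := (Finset.sum_eq_zero_iff_of_nonneg fun j _ => h9 j).1 h12 j
      (Finset.mem_erase.2 ⟨hj, Finset.mem_univ j⟩)
    simp only [exceptional, if_neg hj]
    omega

/-! ### The Cremona orbit of the exceptional classes. -/

/-- The classes obtained from exceptional divisors by Cremona transformations. -/
inductive CremonaOrbit (k d : ℕ) : Cls ℤ k → Prop
  | exceptional (i : Fin k) : CremonaOrbit k d (exceptional i)
  | cremona (I : Finset (Fin k)) (hI : I.card = d + 1) (D : Cls ℤ k) :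
      CremonaOrbit k d D → CremonaOrbit k d (cremona d I D)

theorem CremonaOrbit.mukaiForm_self {k d : ℕ} {D : Cls ℤ k} (hD : CremonaOrbit k d D) :
    mukaiForm d D D = -1 := by
  induction hD with
  | exceptional i => rw [mukaiForm_exceptional]; simp [MukaiKD.exceptional]
  | cremona I hI D _ ih => rw [mukaiForm_cremona, cremona_cremona hI, ih]

/-- The product of Eᵢ with F is mᵢ, which is negative only for F = Eᵢ; self-adjointness of the
reflections carries this along the orbit. -/
theorem CremonaOrbit.mukaiForm_nonneg {k d : ℕ} (hk : d + 1 ≤ k)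
    (hfin : (k : ℤ) * ((d : ℤ) - 1) < ((d : ℤ) + 1) ^ 2) {Eff : Cls ℤ k → Prop}
    (hE : CremonaStable d Eff) {D : Cls ℤ k} (hD : CremonaOrbit k d D) :
    ∀ F, Eff F → intDegree d F = 1 → F ≠ D → 0 ≤ mukaiForm d D F := by
  induction hD with
  | exceptional i =>
    intro F hF hdeg hne
    rw [mukaiForm_exceptional]
    by_contra! h
    exact hne (hE.eq_exceptional hk hfin hF hdeg h)
  | cremona I hI D _ ih =>
    intro F hF hdeg hne
    rw [mukaiForm_cremona]
    refine ih _ (hE.reflect I hI F hF) (by rw [intDegree_cremona hI, hdeg]) fun h => hne ?_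
    rw [← h, cremona_cremona hI]

/-- Reflections at points other than i keep mᵢ = 0. Without negative multiplicities, the d + 1
largest ones away from i always have negative root pairing, so m₀ can be lowered until F becomes
exceptional. -/
theorem CremonaStable.orbit_of_apply_eq_zero {k d : ℕ} (hd : 2 ≤ d) (hk : d + 2 ≤ k)
    (hfin : (k : ℤ) * ((d : ℤ) - 1) < ((d : ℤ) + 1) ^ 2) {Eff : Cls ℤ k → Prop}
    (hE : CremonaStable d Eff) (i : Fin k) (F : Cls ℤ k) (hF : Eff F)
    (hdeg : intDegree d F = 1) (hi : F.2 i = 0) : CremonaOrbit k d F := by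
  induction hn : F.1.toNat using Nat.strong_induction_on generalizing F with
  | _ n ih =>
  by_cases hpos : ∀ j, 0 ≤ F.2 j
  swap
  · push Not at hpos
    obtain ⟨j, hj⟩ := hpos
    rw [hE.eq_exceptional (by omega) hfin hF hdeg hj]
    exact .exceptional j
  have h0 := hE.nonneg F hF
  have hcard : ((Finset.univ : Finset (Fin k)).erase i).card = k - 1 := by
    rw [Finset.card_erase_of_mem (Finset.mem_univ i), Finset.card_univ, Fintype.card_fin]
  obtain ⟨I, hIs, hIc, hI⟩ := exists_top_subset ((Finset.univ : Finset (Fin k)).erase i) F.2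
    (n := d + 1) (by omega)
  have hiI : i ∉ I := fun h => Finset.notMem_erase i _ (hIs h)
  by_cases hr : rootPairing d I F < 0
  · have hE' := hE.reflect I hIc F hF
    have h0' := hE.nonneg _ hE'
    have h1 : (cremona d I F).1 = F.1 + rootPairing d I F := rfl
    have := ih _ (by rw [← hn]; omega) _ hE' (by rw [intDegree_cremona hIc, hdeg])
      (by simp [MukaiKD.cremona, hiI, hi]) rfl
    rw [← cremona_cremona hIc F]
    exact .cremona I hIc _ this
  · exfalso
    push Not at hr
    have havg := card_mul_sum_le_of_top hIs hI
    rw [hIc, hcard, Nat.cast_sub (by omega)] at havg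
    have hsum : ∑ j ∈ Finset.univ.erase i, F.2 j = ∑ j, F.2 j := by
      rw [← Finset.add_sum_erase Finset.univ F.2 (Finset.mem_univ i), hi, zero_add]
    rw [hsum] at havg
    push_cast at havg
    have hr' : ∑ i ∈ I, F.2 i ≤ ((d : ℤ) - 1) * F.1 := by
      unfold rootPairing at hr; linarith
    have hk0 : (0 : ℤ) ≤ k - 1 := by
      have : (1 : ℤ) ≤ k := by exact_mod_cast (by omega : 1 ≤ k)
      linarith
    have h1 := havg.trans (mul_le_mul_of_nonneg_left hr' hk0)
    have hs : ∑ j, F.2 j = ((d : ℤ) + 1) * F.1 - 1 := by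
      rw [intDegree] at hdeg; linarith
    have hd' : (2 : ℤ) ≤ d := by exact_mod_cast hd
    -- As k (d - 1) ≤ (d + 1)² - 1, the average inequality becomes d m₀ ≤ d + 1.
    have h2 : F.1 ≤ 1 := by
      by_contra! h
      rw [hs] at h1
      nlinarith
    -- If all d + 1 multiplicities in I were positive, their sum would exceed (d - 1) m₀ ≤ d - 1. So
    -- one is not positive, those outside I vanish, and (d + 1) m₀ - 1 ≤ (d - 1) m₀.
    have hz : ∃ i₀ ∈ I, F.2 i₀ ≤ 0 := by
      by_contra! h
      have h3 : ∑ _i ∈ I, (1 : ℤ) ≤ ∑ i ∈ I, F.2 i :=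
        Finset.sum_le_sum fun j hj => by have := h j hj; omega
      rw [Finset.sum_const, hIc, nsmul_eq_mul] at h3
      push_cast at h3
      nlinarith
    obtain ⟨i₀, hi₀, hz⟩ := hz
    have h4 : ∑ j, F.2 j = ∑ j ∈ I, F.2 j := by
      rw [← hsum]
      symm
      refine Finset.sum_subset hIs fun j hj hjI => ?_
      exact le_antisymm ((hI i₀ hi₀ j hj hjI).trans hz) (hpos j)
    rw [h4] at hs
    have h5 : 0 ≤ ∑ j ∈ I, F.2 j := Finset.sum_nonneg fun j _ => hpos j
    have h6 : 2 * F.1 ≤ 1 := by linarith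
    have h7 : F.1 = 0 := by omega
    rw [h7] at hs
    linarith

/-- Reflections turn D into some Eᵢ, and orthogonality to Eᵢ means mᵢ = 0. -/
theorem CremonaOrbit.of_mukaiForm_eq_zero {k d : ℕ} (hd : 2 ≤ d) (hk : d + 2 ≤ k)
    (hfin : (k : ℤ) * ((d : ℤ) - 1) < ((d : ℤ) + 1) ^ 2) {Eff : Cls ℤ k → Prop}
    (hE : CremonaStable d Eff) {D : Cls ℤ k} (hD : CremonaOrbit k d D) :
    ∀ F, Eff F → intDegree d F = 1 → mukaiForm d D F = 0 → CremonaOrbit k d F := by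
  induction hD with
  | exceptional i =>
    intro F hF hdeg h
    rw [mukaiForm_exceptional] at h
    exact hE.orbit_of_apply_eq_zero hd hk hfin i F hF hdeg h
  | cremona I hI D _ ih =>
    intro F hF hdeg h
    rw [mukaiForm_cremona] at h
    have := ih _ (hE.reflect I hI F hF) (by rw [intDegree_cremona hI, hdeg]) h
    rw [← cremona_cremona hI F]
    exact .cremona I hI _ this

/-! ### Orders of vanishing -/

section Order

variable {K : Type*} [Field K] {n : ℕ}

/-- All terms of `g` have degree at least `m`. -/
def OrderGE (g : MvPolynomial (Fin n) K) (m : ℕ) : Prop :=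
  ∀ e : Fin n →₀ ℕ, e.degree < m → coeff e g = 0

/-- The Taylor expansion at `p`. -/
def taylorAt (p : Fin n → K) : MvPolynomial (Fin n) K →ₐ[K] MvPolynomial (Fin n) K :=
  aeval fun j => X j + C (p j)

theorem mem_vanishing {p : Fin n → K} {m : ℕ} {f : MvPolynomial (Fin n) K} :
    f ∈ vanishing p m ↔ OrderGE (taylorAt p f) m := Iff.rfl

theorem OrderGE.mono {g : MvPolynomial (Fin n) K} {m m' : ℕ} (h : OrderGE g m) (hm : m' ≤ m) :
    OrderGE g m' := fun e he => h e (he.trans_le hm)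

theorem OrderGE.mul {g h : MvPolynomial (Fin n) K} {a b : ℕ} (hg : OrderGE g a)
    (hh : OrderGE h b) : OrderGE (g * h) (a + b) := by
  classical
  intro e he
  rw [coeff_mul]
  refine Finset.sum_eq_zero fun x hx => ?_
  rw [Finset.HasAntidiagonal.mem_antidiagonal] at hx
  rw [← hx, map_add] at he
  by_cases h1 : x.1.degree < a
  · rw [hg _ h1, zero_mul]
  · rw [hh _ (by omega), mul_zero]

theorem orderGE_zero (g : MvPolynomial (Fin n) K) : OrderGE g 0 :=
  fun _ he => absurd he (Nat.not_lt_zero _)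

theorem OrderGE.mul_left {g : MvPolynomial (Fin n) K} {a : ℕ} (hg : OrderGE g a)
    (h : MvPolynomial (Fin n) K) : OrderGE (h * g) a := by
  simpa using (orderGE_zero h).mul hg

theorem OrderGE.mul_right {g : MvPolynomial (Fin n) K} {a : ℕ} (hg : OrderGE g a)
    (h : MvPolynomial (Fin n) K) : OrderGE (g * h) a := by
  simpa using hg.mul (orderGE_zero h)

theorem OrderGE.pderiv {g : MvPolynomial (Fin n) K} {m : ℕ} (hg : OrderGE g (m + 1))
    (i : Fin n) : OrderGE (MvPolynomial.pderiv i g) m := by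
  intro e he
  rw [coeff_pderiv, hg, zero_mul]
  rw [map_add, Finsupp.degree_single]
  omega

/-- The factor has nonzero constant term, so it is a unit among power series and does not raise the
order. -/
theorem OrderGE.of_X_add_C_mul {g : MvPolynomial (Fin n) K} {m : ℕ} {i : Fin n} {c : K}
    (hc : c ≠ 0) (hg : OrderGE ((X i + C c) * g) m) : OrderGE g m := by
  classical
  intro e
  induction h : e.degree using Nat.strong_induction_on generalizing e with
  | _ N ih =>
  intro he
  have h1 := hg e (h ▸ he)
  rw [add_mul, coeff_add, coeff_C_mul, coeff_X_mul'] at h1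
  have h2 : (if i ∈ e.support then coeff (e - Finsupp.single i 1) g else 0) = 0 := by
    split_ifs with hi
    · have h3 : e - Finsupp.single i 1 + Finsupp.single i 1 = e :=
        tsub_add_cancel_of_le (by
          rw [Finsupp.single_le_iff]
          exact Nat.one_le_iff_ne_zero.2 (Finsupp.mem_support_iff.1 hi))
      have h4 := congrArg Finsupp.degree h3
      rw [map_add, Finsupp.degree_single] at h4
      exact ih _ (by omega) _ rfl (by omega)
    · rfl
  rw [h2, zero_add] at h1
  exact (mul_eq_zero.1 h1).resolve_left hc

theorem pderiv_taylorAt (p : Fin n → K) (i : Fin n) (f : MvPolynomial (Fin n) K) :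
    MvPolynomial.pderiv i (taylorAt p f) = taylorAt p (MvPolynomial.pderiv i f) := by
  induction f using MvPolynomial.induction_on with
  | C a => simp [taylorAt]
  | add f g hf hg => rw [map_add, map_add, hf, hg, map_add, map_add]
  | mul_X f j hf =>
    rw [map_mul, Derivation.leibniz, Derivation.leibniz, hf]
    simp only [smul_eq_mul, map_add, map_mul]
    congr 2
    by_cases h : i = j
    · subst h; simp [taylorAt]
    · simp [taylorAt, pderiv_X_of_ne (Ne.symm h)]

theorem constantCoeff_taylorAt (p : Fin n → K) (f : MvPolynomial (Fin n) K) :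
    constantCoeff (taylorAt p f) = eval p f := by
  induction f using MvPolynomial.induction_on with
  | C a => simp [taylorAt]
  | add f g hf hg => rw [map_add, map_add, map_add, hf, hg]
  | mul_X f j hf => rw [map_mul, map_mul, hf]; simp [taylorAt]

/-- Orders of vanishing at a point of the torus in terms of Euler operators. -/
theorem mem_vanishing_succ [CharZero K] {p : Fin n → K} (hp : ∀ j, p j ≠ 0) {m : ℕ}
    {f : MvPolynomial (Fin n) K} :
    f ∈ vanishing p (m + 1) ↔
      eval p f = 0 ∧ ∀ j, X j * MvPolynomial.pderiv j f ∈ vanishing p m := by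
  -- Translated to p, the Euler operator is (X_j + p_j) ∂_j, whose first factor does not affect
  -- orders because p_j ≠ 0.
  have key : ∀ j, taylorAt p (X j * MvPolynomial.pderiv j f) =
      (X j + C (p j)) * MvPolynomial.pderiv j (taylorAt p f) := fun j => by
    rw [map_mul, pderiv_taylorAt]
    simp [taylorAt]
  constructor
  · intro h
    rw [mem_vanishing] at h
    refine ⟨?_, fun j => ?_⟩
    · rw [← constantCoeff_taylorAt, constantCoeff_eq]
      exact h 0 (by simp)
    · rw [mem_vanishing, key]
      exact (h.pderiv j).mul_left _
  · rintro ⟨h0, h⟩ e he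
    by_cases he0 : e = 0
    · rw [he0, ← constantCoeff_eq]
      exact (constantCoeff_taylorAt p f).trans h0
    · obtain ⟨j, hj⟩ := Finsupp.ne_iff.1 he0
      have h1 := h j
      rw [mem_vanishing, key] at h1
      have h2 := h1.of_X_add_C_mul (hp j)
      have h3 : e - Finsupp.single j 1 + Finsupp.single j 1 = e :=
        tsub_add_cancel_of_le (by
          rw [Finsupp.single_le_iff]
          exact Nat.one_le_iff_ne_zero.2 hj)
      have h4 := congrArg Finsupp.degree h3
      rw [map_add, Finsupp.degree_single] at h4
      have h5 := h2 (e - Finsupp.single j 1) (by omega)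
      -- Differentiation multiplies the coefficient at e by e_j, which is nonzero in characteristic
      -- zero.
      rw [coeff_pderiv, h3] at h5
      exact (mul_eq_zero.1 h5).resolve_right (Nat.cast_add_one_ne_zero _)

theorem orderGE_of_isHomogeneous {g : MvPolynomial (Fin n) K} {m M : ℕ} (hg : g.IsHomogeneous M)
    (hm : m ≤ M) : OrderGE g m := fun e he => hg.coeff_eq_zero (by omega)

theorem OrderGE.aeval {g : MvPolynomial (Fin n) K} {m : ℕ} (hg : OrderGE g m)
    (l : Fin n → MvPolynomial (Fin n) K) (hl : ∀ i, (l i).IsHomogeneous 1) :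
    OrderGE (MvPolynomial.aeval l g) m := by
  rw [g.as_sum, map_sum]
  intro e he
  rw [coeff_sum]
  refine Finset.sum_eq_zero fun a ha => ?_
  have h1 : m ≤ a.degree := by
    by_contra! h
    exact (mem_support_iff.1 ha) (hg a h)
  have h2 := (isHomogeneous_monomial (coeff a g) (rfl : a.degree = a.degree)).aeval l hl
  rw [one_mul] at h2
  exact h2.coeff_eq_zero (by omega)

/-! ### Linear changes of coordinates -/

/-- The polynomial `f (B z)`. -/
def linearSubst (B : Matrix (Fin n) (Fin n) K) :
    MvPolynomial (Fin n) K →ₐ[K] MvPolynomial (Fin n) K :=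
  aeval fun j => ∑ l, C (B j l) * X l

theorem isHomogeneous_linearForm (b : Fin n → K) :
    (∑ l, C (b l) * X l : MvPolynomial (Fin n) K).IsHomogeneous 1 :=
  IsHomogeneous.sum _ _ _ fun l _ => by
    simpa using (isHomogeneous_C (Fin n) (b l)).mul (isHomogeneous_X K l)

theorem IsHomogeneous.linearSubst {f : MvPolynomial (Fin n) K} {M : ℕ} (hf : f.IsHomogeneous M)
    (B : Matrix (Fin n) (Fin n) K) : (linearSubst B f).IsHomogeneous M := by
  simpa [MukaiKD.linearSubst] using hf.aeval _ fun j => isHomogeneous_linearForm (B j)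

/-- f (B (z + p)) = f (B z + B p), and a homogeneous linear substitution preserves the degree of
every term. -/
theorem linearSubst_mem_vanishing {f : MvPolynomial (Fin n) K} {p : Fin n → K} {m : ℕ}
    (B : Matrix (Fin n) (Fin n) K) (hf : f ∈ vanishing (B.mulVec p) m) :
    linearSubst B f ∈ vanishing p m := by
  have h : (taylorAt p).comp (linearSubst B) = (linearSubst B).comp (taylorAt (B.mulVec p)) := by
    refine algHom_ext fun j => ?_
    simp [taylorAt, linearSubst, Matrix.mulVec, dotProduct, mul_add, Finset.sum_add_distrib,
      algebraMap_eq]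
  rw [mem_vanishing] at hf ⊢
  have h1 := AlgHom.congr_fun h f
  simp only [AlgHom.comp_apply] at h1
  rw [h1]
  exact hf.aeval _ fun j => isHomogeneous_linearForm (B j)

theorem linearSubst_linearSubst (B B' : Matrix (Fin n) (Fin n) K) (f : MvPolynomial (Fin n) K) :
    linearSubst B (linearSubst B' f) = linearSubst (B' * B) f := by
  have h : (linearSubst B).comp (linearSubst B') = linearSubst (B' * B) := by
    refine algHom_ext fun j => ?_
    simp only [linearSubst, AlgHom.comp_apply, aeval_X, map_sum, map_mul, Matrix.mul_apply,
      Finset.mul_sum, Finset.sum_mul, algHom_C, algebraMap_eq]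
    rw [Finset.sum_comm]
    simp only [mul_assoc]
  exact AlgHom.congr_fun h f

theorem linearSubst_one (f : MvPolynomial (Fin n) K) : linearSubst 1 f = f := by
  have h : linearSubst (1 : Matrix (Fin n) (Fin n) K) = AlgHom.id K _ := by
    refine algHom_ext fun j => ?_
    simp [linearSubst, Matrix.one_apply]
  rw [h, AlgHom.id_apply]

theorem linearSubst_smul_one {f : MvPolynomial (Fin n) K} {M : ℕ} (hf : f.IsHomogeneous M)
    (c : K) : linearSubst (c • 1) f = c ^ M • f := by
  have h : ∀ a : Fin n →₀ ℕ, ∀ r : K, linearSubst (c • (1 : Matrix (Fin n) (Fin n) K))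
      (monomial a r) = c ^ a.degree • monomial a r := fun a r => by
    rw [linearSubst, aeval_monomial, monomial_eq]
    simp only [Matrix.smul_apply, Matrix.one_apply, smul_eq_mul, mul_ite, mul_one, mul_zero,
      apply_ite C, C_0, ite_mul, zero_mul, Finset.sum_ite_eq, Finset.mem_univ, if_true,
      algebraMap_eq, Finsupp.prod, mul_pow, Finset.prod_mul_distrib, Finset.prod_pow_eq_pow_sum,
      smul_eq_C_mul, C_pow]
    change C r * (C c ^ a.degree * _) = _
    ring
  conv_lhs => rw [f.as_sum, map_sum]
  conv_rhs => rw [f.as_sum, Finset.smul_sum]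
  refine Finset.sum_congr rfl fun a ha => ?_
  rw [h, show a.degree = M from ?_]
  by_contra hne
  exact mem_support_iff.1 ha (hf.coeff_eq_zero hne)

/-- For a form, f (c z) = c ^ M f (z): the representative of a projective point does not matter. -/
theorem mem_vanishing_of_smul {f : MvPolynomial (Fin n) K} {M m : ℕ} (hf : f.IsHomogeneous M)
    {p : Fin n → K} {c : K} (hc : c ≠ 0) (h : f ∈ vanishing (c • p) m) : f ∈ vanishing p m := by
  have h1 := linearSubst_mem_vanishing (c • (1 : Matrix (Fin n) (Fin n) K)) (p := p) (m := m)
    (f := f) (by rwa [Matrix.smul_mulVec, Matrix.one_mulVec])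
  rw [linearSubst_smul_one hf] at h1
  exact (Submodule.smul_mem_iff _ (pow_ne_zero _ hc)).1 h1

end Order

/-! ### Linear systems -/

section LinearSystem

variable {K : Type*} [Field K] {k d : ℕ}

theorem mem_linearSystem {P : Matrix (Fin (d + 1)) (Fin k) K} {D : Cls ℤ k}
    {f : MvPolynomial (Fin (d + 1)) K} (hD : 0 ≤ D.1) :
    f ∈ linearSystem P D ↔ f.IsHomogeneous D.1.toNat ∧
      ∀ i, f ∈ vanishing (fun j => P j i) (D.2 i).toNat := by
  rw [linearSystem, if_pos hD, Submodule.mem_inf, mem_homogeneousSubmodule, Submodule.mem_iInf]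

theorem linearSystem_of_neg {P : Matrix (Fin (d + 1)) (Fin k) K} {D : Cls ℤ k} (hD : D.1 < 0) :
    linearSystem P D = ⊥ := by
  rw [linearSystem, if_neg (not_le.2 hD)]

instance finiteDimensional_linearSystem (P : Matrix (Fin (d + 1)) (Fin k) K) (D : Cls ℤ k) :
    FiniteDimensional K (linearSystem P D) := by
  rcases lt_or_ge D.1 0 with h | h
  · rw [linearSystem_of_neg h]; infer_instance
  · have : FiniteDimensional K (homogeneousSubmodule (Fin (d + 1)) K D.1.toNat) :=
      Module.Finite.iff_fg.2 (homogeneousSubmodule_fg _ _ _)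
    refine Submodule.finiteDimensional_of_le (S₂ := homogeneousSubmodule (Fin (d + 1)) K D.1.toNat)
      fun f hf => ?_
    exact ((mem_linearSystem h).1 hf).1

theorem finrank_linearSystem_le {d' k' : ℕ} {P : Matrix (Fin (d + 1)) (Fin k) K} {D : Cls ℤ k}
    {P' : Matrix (Fin (d' + 1)) (Fin k') K} {D' : Cls ℤ k'}
    (φ : MvPolynomial (Fin (d + 1)) K →ₗ[K] MvPolynomial (Fin (d' + 1)) K)
    (h : ∀ f ∈ linearSystem P D, φ f ∈ linearSystem P' D')
    (h0 : ∀ f ∈ linearSystem P D, φ f = 0 → f = 0) :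
    Module.finrank K (linearSystem P D) ≤ Module.finrank K (linearSystem P' D') := by
  refine LinearMap.finrank_le_finrank_of_injective (f := φ.restrict h) ?_
  rw [← LinearMap.ker_eq_bot, LinearMap.ker_eq_bot']
  rintro ⟨f, hf⟩ hf0
  exact Subtype.ext (h0 f hf (congrArg Subtype.val hf0))

/-- Projective equivalence of point configurations. -/
theorem finrank_linearSystem_le_of_projective {P Q : Matrix (Fin (d + 1)) (Fin k) K}
    {B B' : Matrix (Fin (d + 1)) (Fin (d + 1)) K} (hB : B * B' = 1) {c : Fin k → K}
    (hc : ∀ i, c i ≠ 0)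
    (h : ∀ i, B.mulVec (fun j => P j i) = c i • fun j => Q j i) (D : Cls ℤ k) :
    Module.finrank K (linearSystem Q D) ≤ Module.finrank K (linearSystem P D) := by
  rcases lt_or_ge D.1 0 with hD | hD
  · rw [linearSystem_of_neg hD, linearSystem_of_neg hD]
  refine finrank_linearSystem_le (linearSubst B).toLinearMap (fun f hf => ?_) fun f _ hf0 => ?_
  · rw [mem_linearSystem hD] at hf ⊢
    refine ⟨IsHomogeneous.linearSubst hf.1 B, fun i => linearSubst_mem_vanishing B ?_⟩
    rw [h]
    refine mem_vanishing_of_smul hf.1 (inv_ne_zero (hc i)) ?_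
    rw [smul_smul, inv_mul_cancel₀ (hc i), one_smul]
    exact hf.2 i
  · have h1 := congrArg (linearSubst B') hf0
    rw [AlgHom.toLinearMap_apply, linearSubst_linearSubst, hB, linearSubst_one, map_zero] at h1
    exact h1

end LinearSystem

/-! ### The standard Cremona transformation -/

section Reverse

variable {K : Type*} [Field K] {n : ℕ}

/-- The exponents of `f` are bounded by `b`. -/
def Boxed (b : Fin n →₀ ℕ) (f : MvPolynomial (Fin n) K) : Prop := ∀ a ∈ f.support, a ≤ b

theorem Boxed.induction {b : Fin n →₀ ℕ} {f : MvPolynomial (Fin n) K} (hf : Boxed b f)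
    {motive : MvPolynomial (Fin n) K → Prop} (zero : motive 0)
    (add : ∀ f g, motive f → motive g → motive (f + g))
    (monomial : ∀ a ≤ b, ∀ c : K, motive (monomial a c)) : motive f := by
  rw [f.as_sum]
  exact Finset.sum_induction _ motive add zero fun a ha => monomial a (hf a ha) _

/-- The linear map sending `z ^ a` to `z ^ (b - a)`; on polynomials with exponents bounded by `b`
this is `f ↦ z ^ b f (1 / z)`. -/
def reverse (b : Fin n →₀ ℕ) : MvPolynomial (Fin n) K →ₗ[K] MvPolynomial (Fin n) K :=
  (basisMonomials (Fin n) K).constr K fun a => monomial (b - a) 1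

theorem reverse_monomial (b a : Fin n →₀ ℕ) (c : K) :
    reverse b (monomial a c) = monomial (b - a) c := by
  have h : (monomial a c : MvPolynomial (Fin n) K) = c • basisMonomials (Fin n) K a := by
    simp [smul_monomial]
  rw [h, map_smul, reverse, Module.Basis.constr_basis, smul_monomial, smul_eq_mul, mul_one]

theorem reverse_reverse {b : Fin n →₀ ℕ} {f : MvPolynomial (Fin n) K} (hf : Boxed b f) :
    reverse b (reverse b f) = f := by
  refine hf.induction (motive := fun f => reverse b (reverse b f) = f) (by simp)
    (fun f g hf hg => by rw [map_add, map_add, hf, hg])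
    fun a ha c => ?_
  rw [reverse_monomial, reverse_monomial, tsub_tsub_cancel_of_le ha]

theorem exists_of_mem_support_reverse {b : Fin n →₀ ℕ} {f : MvPolynomial (Fin n) K}
    {e : Fin n →₀ ℕ} (he : e ∈ (reverse b f).support) : ∃ a ∈ f.support, e = b - a := by
  classical
  by_contra! h
  rw [f.as_sum, map_sum] at he
  refine mem_support_iff.1 he ?_
  rw [coeff_sum]
  refine Finset.sum_eq_zero fun a ha => ?_
  rw [reverse_monomial, coeff_monomial, if_neg (h a ha).symm]

theorem boxed_reverse (b : Fin n →₀ ℕ) (f : MvPolynomial (Fin n) K) : Boxed b (reverse b f) := by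
  intro e he
  obtain ⟨a, -, rfl⟩ := exists_of_mem_support_reverse he
  exact tsub_le_self

theorem IsHomogeneous.reverse {b : Fin n →₀ ℕ} {f : MvPolynomial (Fin n) K} (hf : Boxed b f)
    {M : ℕ} (hM : f.IsHomogeneous M) : (reverse b f).IsHomogeneous (b.degree - M) := by
  intro e he
  obtain ⟨a, ha, rfl⟩ := exists_of_mem_support_reverse (mem_support_iff.2 he)
  have h1 : a.degree = M := by
    by_contra h
    exact mem_support_iff.1 ha (hM.coeff_eq_zero h)
  have h2 := congrArg Finsupp.degree (tsub_add_cancel_of_le (hf a ha))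
  rw [map_add, h1] at h2
  have h3 : Finsupp.weight 1 (b - a) = (b - a).degree := by
    rw [Finsupp.degree_eq_weight_one]; rfl
  rw [h3]
  omega

theorem X_mul_pderiv_monomial (j : Fin n) (a : Fin n →₀ ℕ) (c : K) :
    X j * pderiv j (monomial a c) = (a j : K) • monomial a c := by
  rw [pderiv_monomial]
  by_cases h : a j = 0
  · simp [h]
  · rw [X, monomial_mul, one_mul, smul_monomial, smul_eq_mul, mul_comm c]
    have h1 : Finsupp.single j 1 ≤ a := by
      rw [Finsupp.single_le_iff]; exact Nat.one_le_iff_ne_zero.2 h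
    rw [add_tsub_cancel_of_le h1]

theorem Boxed.X_mul_pderiv {b : Fin n →₀ ℕ} {f : MvPolynomial (Fin n) K} (hf : Boxed b f)
    (j : Fin n) : Boxed b (X j * pderiv j f) := by
  classical
  intro e he
  by_contra h
  refine mem_support_iff.1 he ?_
  rw [f.as_sum, map_sum, Finset.mul_sum, coeff_sum]
  refine Finset.sum_eq_zero fun a ha => ?_
  rw [X_mul_pderiv_monomial, coeff_smul, coeff_monomial, if_neg, smul_zero]
  rintro rfl
  exact h (hf a ha)

/-- Euler operators are diagonal on monomials, and reversal changes the eigenvalue a_j into b_j -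
a_j. -/
theorem X_mul_pderiv_reverse {b : Fin n →₀ ℕ} {f : MvPolynomial (Fin n) K} (hf : Boxed b f)
    (j : Fin n) : X j * pderiv j (reverse b f) =
      (b j : K) • reverse b f - reverse b (X j * pderiv j f) := by
  refine hf.induction (motive := fun f => X j * pderiv j (reverse b f) =
    (b j : K) • reverse b f - reverse b (X j * pderiv j f)) (by simp)
    (fun f g hf hg => ?_) fun a ha c => ?_
  · simp only [map_add, mul_add, smul_add, hf, hg]
    abel
  · rw [X_mul_pderiv_monomial, map_smul, reverse_monomial, X_mul_pderiv_monomial, ← sub_smul,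
      Finsupp.tsub_apply, Nat.cast_sub (ha j)]

theorem eval_inv_reverse {b : Fin n →₀ ℕ} {p : Fin n → K} (hp : ∀ j, p j ≠ 0)
    {f : MvPolynomial (Fin n) K} (hf : Boxed b f) :
    eval (fun j => (p j)⁻¹) (reverse b f) = (∏ j, (p j)⁻¹ ^ b j) * eval p f := by
  refine hf.induction (motive := fun f => eval (fun j => (p j)⁻¹) (reverse b f) =
    (∏ j, (p j)⁻¹ ^ b j) * eval p f) (by simp) (fun f g hf hg => ?_) fun a ha c => ?_
  · simp only [map_add, mul_add, hf, hg]
  · rw [reverse_monomial, eval_monomial, eval_monomial, Finsupp.prod_fintype _ _ (by simp),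
      Finsupp.prod_fintype _ _ (by simp), mul_left_comm, ← Finset.prod_mul_distrib]
    congr 1
    refine Finset.prod_congr rfl fun j _ => ?_
    have h := ha j
    rw [Finsupp.tsub_apply, ← Nat.sub_add_cancel h, pow_add, Nat.add_sub_cancel, mul_assoc,
      ← mul_pow, inv_mul_cancel₀ (hp j), one_pow, mul_one]

/-- Inverting coordinates is an isomorphism of the torus and so preserves multiplicities. The
criterion by Euler operators makes this an induction on m among polynomials with exponents bounded
by b. -/
theorem reverse_mem_vanishing [CharZero K] {b : Fin n →₀ ℕ} {p : Fin n → K}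
    (hp : ∀ j, p j ≠ 0) {m : ℕ} {f : MvPolynomial (Fin n) K} (hf : Boxed b f)
    (h : f ∈ vanishing p m) : reverse b f ∈ vanishing (fun j => (p j)⁻¹) m := by
  induction m generalizing f with
  | zero => exact orderGE_zero _
  | succ m ih =>
    have h' := (mem_vanishing_succ hp).1 h
    refine (mem_vanishing_succ fun j => inv_ne_zero (hp j)).2 ⟨?_, fun j => ?_⟩
    · rw [eval_inv_reverse hp hf, h'.1, mul_zero]
    · rw [X_mul_pderiv_reverse hf]
      exact Submodule.sub_mem _
        (Submodule.smul_mem _ _ (ih hf ((mem_vanishing.1 h).mono (Nat.le_succ m))))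
        (ih (hf.X_mul_pderiv j) (h'.2 j))

/-- Multiplicities of forms at a coordinate point. -/
theorem mem_vanishing_single {M m : ℕ} {r : Fin n} {f : MvPolynomial (Fin n) K}
    (hM : f.IsHomogeneous M) :
    f ∈ vanishing (Pi.single r 1) m ↔ ∀ a ∈ f.support, a r + m ≤ M := by
  classical
  have hdeg : ∀ a ∈ f.support, a.degree = M := fun a ha => by
    by_contra h
    exact mem_support_iff.1 ha (hM.coeff_eq_zero h)
  have herase : ∀ a : Fin n →₀ ℕ, (a.erase r).degree + a r = a.degree := fun a => by
    conv_rhs => rw [← Finsupp.erase_add_single r a, map_add, Finsupp.degree_single]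
  constructor
  · intro h a ha
    -- Setting the r-th variable to 0 after the expansion amounts to dehomogenizing: z ^ a becomes
    -- the monomial of `a.erase r`, and different exponents of degree M stay different.
    let ψ : MvPolynomial (Fin n) K →ₐ[K] MvPolynomial (Fin n) K :=
      aeval fun j => if j = r then 0 else X j
    have hψ : ∀ (g : MvPolynomial (Fin n) K) (e : Fin n →₀ ℕ), e r = 0 →
        coeff e (ψ g) = coeff e g := by
      intro g e he
      induction g using MvPolynomial.induction_on' with
      | add g g' hg hg' => rw [map_add, coeff_add, coeff_add, hg, hg']
      | monomial b c =>
        by_cases hb : b r = 0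
        · congr 1
          rw [aeval_monomial, monomial_eq, algebraMap_eq]
          congr 1
          refine Finset.prod_congr rfl fun j hj => ?_
          beta_reduce
          rw [if_neg]
          rintro rfl
          exact Finsupp.mem_support_iff.1 hj hb
        · have : ψ (monomial b c) = 0 := by
            rw [aeval_monomial, Finsupp.prod, Finset.prod_eq_zero (Finsupp.mem_support_iff.2 hb),
              mul_zero]
            rw [if_pos rfl, zero_pow hb]
          rw [this, coeff_zero, coeff_monomial, if_neg]
          rintro rfl
          exact hb he
    have hψT : ∀ (b : Fin n →₀ ℕ) (c : K),
        ψ (taylorAt (Pi.single r 1) (monomial b c)) = monomial (b.erase r) c := by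
      intro b c
      have : ψ.comp (taylorAt (Pi.single r 1)) = aeval fun j => if j = r then 1 else X j := by
        refine algHom_ext fun j => ?_
        by_cases hj : j = r
        · subst hj; simp [ψ, taylorAt]
        · simp [ψ, taylorAt, hj]
      rw [← AlgHom.comp_apply, this, aeval_monomial, monomial_eq, algebraMap_eq,
        Finsupp.prod_fintype _ _ (by simp), Finsupp.prod_fintype _ _ (by simp)]
      congr 1
      refine Finset.prod_congr rfl fun j _ => ?_
      by_cases hj : j = r
      · subst hj; simp
      · simp [hj]
    have h1 : coeff (a.erase r) (ψ (taylorAt (Pi.single r 1) f)) = coeff a f := by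
      conv_lhs => rw [f.as_sum, map_sum, map_sum, coeff_sum]
      rw [Finset.sum_eq_single a]
      · rw [hψT, coeff_monomial, if_pos rfl]
      · intro b hb hba
        rw [hψT, coeff_monomial, if_neg]
        intro hab
        apply hba
        have h2 := herase a
        have h3 := herase b
        rw [hdeg a ha, ← hab] at h2
        rw [hdeg b hb] at h3
        rw [← Finsupp.erase_add_single r a, ← Finsupp.erase_add_single r b, hab,
          show a r = b r by omega]
      · exact fun h => absurd ha h
    rw [hψ _ _ (by simp)] at h1
    by_contra! hlt
    have h2 := herase a
    rw [hdeg a ha] at h2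
    exact mem_support_iff.1 ha (h1 ▸ h _ (by omega))
  · intro h
    rw [f.as_sum]
    refine Submodule.sum_mem _ fun a ha => ?_
    have h1 : (monomial a (coeff a f) : MvPolynomial (Fin n) K) =
        monomial (a.erase r) (coeff a f) * X r ^ a r := by
      rw [X_pow_eq_monomial, monomial_mul, mul_one, Finsupp.erase_add_single]
    have h2 : taylorAt (Pi.single r 1) (monomial (a.erase r) (coeff a f)) =
        monomial (a.erase r) (coeff a f) := by
      rw [taylorAt, aeval_monomial, monomial_eq, algebraMap_eq]
      congr 1
      refine Finset.prod_congr rfl fun j hj => ?_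
      have : j ≠ r := by
        rintro rfl
        simp at hj
      simp [this]
    rw [mem_vanishing, h1, map_mul, h2]
    refine OrderGE.mul_right (orderGE_of_isHomogeneous
      (isHomogeneous_monomial _ (rfl : (a.erase r).degree = _)) ?_) _
    have h3 := herase a
    rw [hdeg a ha] at h3
    have h4 := h a ha
    omega

end Reverse

/-- A configuration of points that contains the coordinate points, and its image under the standard
Cremona transformation. -/
theorem finrank_linearSystem_cremona_le {K : Type*} [Field K] [CharZero K] {k d : ℕ}
    (s : Fin (d + 1) ↪ Fin k) {N N' : Matrix (Fin (d + 1)) (Fin k) K}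
    (hN : ∀ r, (fun j => N j (s r)) = Pi.single r 1)
    (hN' : ∀ r, (fun j => N' j (s r)) = Pi.single r 1)
    (hne : ∀ i ∉ Set.range s, ∀ j, N j i ≠ 0)
    (hinv : ∀ i ∉ Set.range s, ∀ j, N' j i = (N j i)⁻¹) (D : Cls ℤ k) :
    Module.finrank K (linearSystem N D) ≤
      Module.finrank K (linearSystem N' (cremona d (Finset.univ.map s) D)) := by
  rcases lt_or_ge D.1 0 with hD | hD
  · rw [linearSystem_of_neg hD, finrank_bot]
    exact Nat.zero_le _
  -- Multiplicity mᵢ at a coordinate point bounds the exponent of its variable by m₀ - mᵢ. With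
  -- these bounds, z ^ b f (1 / z) has degree |b| - m₀, the degree of the reflected class.
  let b : Fin (d + 1) →₀ ℕ := Finsupp.equivFunOnFinite.symm fun r => (D.1 - D.2 (s r)).toNat
  have hsum : (cremona d (Finset.univ.map s) D).1 = ∑ r, (D.1 - D.2 (s r)) - D.1 := by
    simp [cremona, rootPairing]
    ring
  have hexp : ∀ f ∈ linearSystem N D, ∀ a ∈ f.support, a.degree = D.1.toNat ∧
      ∀ r, (a r : ℤ) ≤ D.1 - D.2 (s r) := by
    intro f hf a ha
    obtain ⟨h1, h2⟩ := (mem_linearSystem hD).1 hf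
    have ha' : a.degree = D.1.toNat := by
      by_contra h
      exact mem_support_iff.1 ha (h1.coeff_eq_zero h)
    refine ⟨ha', fun r => ?_⟩
    have h3 := h2 (s r)
    rw [hN, mem_vanishing_single h1] at h3
    have h4 := h3 a ha
    omega
  have hbox : ∀ f ∈ linearSystem N D, Boxed b f := by
    intro f hf a ha r
    have := (hexp f hf a ha).2 r
    simp only [b, Finsupp.equivFunOnFinite_symm_apply_apply]
    omega
  have hdegb : ∀ f ∈ linearSystem N D, f ≠ 0 → (∀ r, 0 ≤ D.1 - D.2 (s r)) ∧
      (cremona d (Finset.univ.map s) D).1 = b.degree - D.1 ∧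
      0 ≤ (cremona d (Finset.univ.map s) D).1 := by
    intro f hf h0
    obtain ⟨a, ha⟩ := support_nonempty.2 h0
    obtain ⟨h1, h2⟩ := hexp f hf a ha
    have h3 : ∀ r, 0 ≤ D.1 - D.2 (s r) := fun r => (Int.natCast_nonneg _).trans (h2 r)
    have h4 : (b.degree : ℤ) = ∑ r, (D.1 - D.2 (s r)) := by
      rw [Finsupp.degree_eq_sum]
      push_cast
      refine Finset.sum_congr rfl fun r _ => ?_
      simp only [b, Finsupp.equivFunOnFinite_symm_apply_apply]
      exact Int.toNat_of_nonneg (h3 r)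
    refine ⟨h3, by rw [hsum, h4], ?_⟩
    rw [hsum]
    have h5 : (a.degree : ℤ) ≤ ∑ r, (D.1 - D.2 (s r)) := by
      rw [Finsupp.degree_eq_sum]
      push_cast
      exact Finset.sum_le_sum fun r _ => h2 r
    omega
  refine finrank_linearSystem_le (reverse b) (fun f hf => ?_) fun f hf h0 => ?_
  · by_cases hf0 : f = 0
    · rw [hf0, map_zero]; exact Submodule.zero_mem _
    obtain ⟨h3, h4, h5⟩ := hdegb f hf hf0
    obtain ⟨h1, h2⟩ := (mem_linearSystem hD).1 hf
    have hM := IsHomogeneous.reverse (hbox f hf) h1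
    have hM' : b.degree - D.1.toNat = (cremona d (Finset.univ.map s) D).1.toNat := by omega
    rw [hM'] at hM
    refine (mem_linearSystem h5).2 ⟨hM, fun i => ?_⟩
    by_cases hi : i ∈ Set.range s
    · obtain ⟨r, rfl⟩ := hi
      rw [hN', mem_vanishing_single hM]
      intro e he
      have h6 := boxed_reverse b f e he r
      simp only [b, Finsupp.equivFunOnFinite_symm_apply_apply] at h6
      -- The reflection fixes m₀ - mᵢ for i ∈ I, so the bound b on exponents is again the
      -- multiplicity condition.
      have h7 : (cremona d (Finset.univ.map s) D).1 - (cremona d (Finset.univ.map s) D).2 (s r) =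
          D.1 - D.2 (s r) := by
        simp [cremona]
      have h8 : e r ≤ (cremona d (Finset.univ.map s) D).1.toNat := by
        by_contra! h
        refine mem_support_iff.1 he (hM.coeff_eq_zero ?_)
        have := Finsupp.le_degree r e
        omega
      have := h3 r
      omega
    · have h6 := reverse_mem_vanishing (fun j => hne i hi j) (hbox f hf) (h2 i)
      have h7 : (cremona d (Finset.univ.map s) D).2 i = D.2 i := by
        simp only [cremona]
        rw [if_neg, add_zero]
        simpa using hi
      rw [h7]
      have h8 : (fun j => N' j i) = fun j => (N j i)⁻¹ := funext fun j => hinv i hi j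
      rw [h8]
      exact h6
  · rw [← reverse_reverse (hbox f hf), h0, map_zero]

/-! ### Points on a cuspidal curve -/

/-- The points of a cuspidal curve of degree `d + 1` in `ℙ^d` with the given parameters. -/
def cuspidalPoints {K : Type*} [Field K] {k : ℕ} (d : ℕ) (t : Fin k → K) :
    Matrix (Fin (d + 1)) (Fin k) K :=
  fun r i => if (r : ℕ) < d then t i ^ (r : ℕ) else t i ^ (d + 1)

/-- The action of a Cremona transformation on the parameters of points of the cuspidal curve. -/
def cuspidalMove {K : Type*} [Field K] {k : ℕ} (d : ℕ) (I : Finset (Fin k)) (t : Fin k → K) :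
    Fin k → K :=
  fun i => t i + (if i ∈ I then -2 else (d : K) - 1) * ((∑ j ∈ I, t j) / ((d : K) + 1))

section Cuspidal

variable {K : Type*} [Field K] {k d : ℕ}

/-- Each of the d + 1 parameters in I moves by -2 / (d + 1) times their sum. The change of sign
makes the move an involution. -/
theorem sum_cuspidalMove [CharZero K] {I : Finset (Fin k)} (hI : I.card = d + 1) (t : Fin k → K) :
    ∑ j ∈ I, cuspidalMove d I t j = -∑ j ∈ I, t j := by
  have hd : (d : K) + 1 ≠ 0 := Nat.cast_add_one_ne_zero d
  simp only [cuspidalMove, Finset.sum_add_distrib, ← Finset.sum_mul]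
  rw [Finset.sum_congr rfl (g := fun _ => (-2 : K)) fun i hi => if_pos hi, Finset.sum_const, hI,
    nsmul_eq_mul]
  push_cast
  field_simp
  ring

theorem cuspidalMove_cuspidalMove [CharZero K] {I : Finset (Fin k)} (hI : I.card = d + 1)
    (t : Fin k → K) : cuspidalMove d I (cuspidalMove d I t) = t := by
  funext i
  rw [cuspidalMove, sum_cuspidalMove hI, cuspidalMove]
  ring

/-- Multiplied by d + 1, a relation among the moved parameters becomes an integral relation among
the old ones. -/
theorem linearIndependent_cuspidalMove [CharZero K] {I : Finset (Fin k)} (hI : I.card = d + 1)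
    {t : Fin k → K} (ht : LinearIndependent ℤ t) :
    LinearIndependent ℤ (cuspidalMove d I t) := by
  have hd : (d : K) + 1 ≠ 0 := Nat.cast_add_one_ne_zero d
  rw [Fintype.linearIndependent_iff] at ht ⊢
  intro g hg
  -- The total weight with which the common shift (∑_I t) / (d + 1) enters the relation.
  let c : ℤ := ∑ i, g i * (if i ∈ I then -2 else (d : ℤ) - 1)
  have h1 : ∑ i, (((d : ℤ) + 1) * g i + if i ∈ I then c else 0) • t i = 0 := by
    have h2 : ∑ i, (if i ∈ I then (c : K) else 0) * t i = c * ∑ i ∈ I, t i := by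
      simp only [ite_mul, zero_mul, Finset.sum_ite_mem, Finset.univ_inter, Finset.mul_sum]
    have h3 : (c : K) = ∑ i, (g i : K) * (if i ∈ I then -2 else (d : K) - 1) := by
      simp only [c]
      push_cast
      rfl
    have h4 : ∑ i, (g i : K) * t i + c * ((∑ j ∈ I, t j) / ((d : K) + 1)) = 0 := by
      rw [← hg, h3, Finset.sum_mul, ← Finset.sum_add_distrib]
      refine Finset.sum_congr rfl fun i _ => ?_
      rw [zsmul_eq_mul, cuspidalMove]
      ring
    simp only [zsmul_eq_mul]
    push_cast
    simp only [add_mul, Finset.sum_add_distrib, h2]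
    have h5 : ∑ i, ((d : K) * g i * t i + 1 * g i * t i) =
        ((d : K) + 1) * ∑ i, (g i : K) * t i := by
      rw [Finset.mul_sum]
      exact Finset.sum_congr rfl fun i _ => by ring
    rw [← Finset.sum_add_distrib, h5]
    field_simp at h4
    linear_combination h4
  have h2 := ht _ h1
  have hd' : (d : ℤ) + 1 ≠ 0 := by positivity
  have h3 : ∀ i ∉ I, g i = 0 := fun i hi => by
    have := h2 i
    rw [if_neg hi, add_zero] at this
    exact (mul_eq_zero.1 this).resolve_left hd'
  have h4 : c = -2 * ∑ i ∈ I, g i := by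
    have : c = ∑ i ∈ I, g i * (if i ∈ I then -2 else (d : ℤ) - 1) :=
      (Finset.sum_subset (Finset.subset_univ I) fun i _ hi => by rw [h3 i hi, zero_mul]).symm
    rw [this, Finset.mul_sum]
    refine Finset.sum_congr rfl fun i hi => ?_
    rw [if_pos hi]
    ring
  have h5 : ∀ i ∈ I, ((d : ℤ) + 1) * g i = -c := fun i hi => by
    have := h2 i
    rw [if_pos hi] at this
    linarith
  have h6 : ((d : ℤ) + 1) * ∑ i ∈ I, g i = ((d : ℤ) + 1) * -c := by
    rw [Finset.mul_sum, Finset.sum_congr rfl h5, Finset.sum_const, hI, nsmul_eq_mul]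
    push_cast
    ring
  -- Now ∑_I g = -c, while c = -2 ∑_I g; hence c = 2c and c = 0.
  have h7 := mul_left_cancel₀ hd' h6
  intro i
  by_cases hi : i ∈ I
  · have h8 := h5 i hi
    rw [show c = 0 by omega, neg_zero] at h8
    exact (mul_eq_zero.1 h8).resolve_left hd'
  · exact h3 i hi

/-- The value at the point with parameter `u` of the linear form that vanishes at the points with
parameters `t j`, `j ∈ s`. -/
def hyperplaneValue (t : Fin k → K) (s : Finset (Fin k)) (u : K) : K :=
  (∏ j ∈ s, (u - t j)) * (u + ∑ j ∈ s, t j)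

-- In (∏ (u - t j)) (u + ∑ t j) the coefficient of u ^ d cancels, which leaves the monomials 1, …, u
-- ^ (d - 1), u ^ (d + 1) that parametrize the curve.
open Polynomial in
theorem exists_hyperplane (t : Fin k → K) {s : Finset (Fin k)} (hs : s.card = d) :
    ∃ a : Fin (d + 1) → K, ∀ u : K,
      ∑ r, a r * (if (r : ℕ) < d then u ^ (r : ℕ) else u ^ (d + 1)) = hyperplaneValue t s u := by
  let p : K[X] := ∏ j ∈ s, (Polynomial.X - Polynomial.C (t j))
  let q : K[X] := p * (Polynomial.X + Polynomial.C (∑ j ∈ s, t j))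
  have hp : p.natDegree = d := by rw [Polynomial.natDegree_prod_of_monic _ _
    fun j _ => Polynomial.monic_X_sub_C _]; simp [hs]
  have hpm : p.Monic := Polynomial.monic_prod_of_monic _ _ fun j _ => Polynomial.monic_X_sub_C _
  have hq : q.natDegree < d + 2 := by
    refine Nat.lt_succ_of_le (Polynomial.natDegree_mul_le.trans ?_)
    rw [hp, Polynomial.natDegree_X_add_C]
  have hqd : q.coeff d = 0 := by
    have h1 : p.coeff d = 1 := by rw [← hp]; exact hpm.coeff_natDegree
    rcases Nat.eq_zero_or_pos d with h0 | h0
    · have h2 : s = ∅ := Finset.card_eq_zero.1 (hs.trans h0)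
      subst h0 h2
      simp [q, p]
    · obtain ⟨e, rfl⟩ : ∃ e, d = e + 1 := ⟨d - 1, by omega⟩
      have h2 : p.coeff e = -∑ j ∈ s, t j := by
        have h3 := Polynomial.prod_X_sub_C_coeff_card_pred s t (by omega)
        rwa [hs] at h3
      simp only [q]
      rw [mul_add, Polynomial.coeff_add, Polynomial.coeff_mul_X, Polynomial.coeff_mul_C, h1, h2]
      ring
  refine ⟨fun r => if (r : ℕ) < d then q.coeff r else q.coeff (d + 1), fun u => ?_⟩
  have h1 : hyperplaneValue t s u = q.eval u := by
    simp only [q, p, hyperplaneValue, Polynomial.eval_mul, Polynomial.eval_prod,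
      Polynomial.eval_add, Polynomial.eval_sub, Polynomial.eval_X, Polynomial.eval_C]
  rw [h1, Polynomial.eval_eq_sum_range' hq, Finset.sum_range_succ, Finset.sum_range_succ, hqd,
    zero_mul, add_zero, Fin.sum_univ_castSucc, ← Fin.sum_univ_eq_sum_range]
  simp

theorem hyperplaneValue_self {t : Fin k → K} {s : Finset (Fin k)} {i : Fin k} (hi : i ∈ s) :
    hyperplaneValue t s (t i) = 0 := by
  rw [hyperplaneValue, Finset.prod_eq_zero hi (sub_self _), zero_mul]

/-- A zero would be an integral relation t i = t j or t i + ∑ t j = 0. Independence thus puts the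
points in linearly general position. -/
theorem hyperplaneValue_ne_zero {t : Fin k → K} (ht : LinearIndependent ℤ t)
    {s : Finset (Fin k)} {i : Fin k} (hi : i ∉ s) : hyperplaneValue t s (t i) ≠ 0 := by
  refine mul_ne_zero (Finset.prod_ne_zero_iff.2 fun j hj h => ?_) fun h => ?_
  · have := ht.injective (sub_eq_zero.1 h)
    exact hi (this ▸ hj)
  · rw [Fintype.linearIndependent_iff] at ht
    rw [← Finset.sum_insert hi] at h
    have h1 := ht (fun j => if j ∈ insert i s then 1 else 0) (by
      simpa only [ite_smul, one_smul, zero_smul, Finset.sum_ite_mem, Finset.univ_inter] using h) i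
    rw [if_pos (Finset.mem_insert_self i s)] at h1
    exact one_ne_zero h1

/-- The configuration with the points in `I` moved to the coordinate points. -/
def normalForm (t : Fin k → K) (s : Fin (d + 1) ↪ Fin k) : Matrix (Fin (d + 1)) (Fin k) K :=
  open Classical in
  fun r i => if i ∈ Set.range s then if s r = i then 1 else 0
    else hyperplaneValue t ((Finset.univ.map s).erase (s r)) (t i)

/-- The rows of A are the equations of the hyperplanes through d of the d + 1 chosen points, so A
takes these points to multiples of the coordinate points. The columns of B are the chosen points
themselves, rescaled. -/
theorem exists_normalForm {t : Fin k → K} (ht : LinearIndependent ℤ t)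
    (s : Fin (d + 1) ↪ Fin k) :
    ∃ A B : Matrix (Fin (d + 1)) (Fin (d + 1)) K, A * B = 1 ∧ B * A = 1 ∧
      ∃ c : Fin k → K, (∀ i, c i ≠ 0) ∧
        ∀ i, A.mulVec (fun j => cuspidalPoints d t j i) = c i • fun j => normalForm t s j i := by
  classical
  have hcard : ∀ r, ((Finset.univ.map s).erase (s r)).card = d := fun r => by
    rw [Finset.card_erase_of_mem (by simp)]
    simp
  choose A hA using fun r => exists_hyperplane t (hcard r)
  have hA' : ∀ i r, (Matrix.of A).mulVec (fun j => cuspidalPoints d t j i) r =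
      hyperplaneValue t ((Finset.univ.map s).erase (s r)) (t i) := fun i r => hA r (t i)
  let c : Fin k → K := fun i => if i ∈ Set.range s then
    hyperplaneValue t ((Finset.univ.map s).erase i) (t i) else 1
  have hc : ∀ i, c i ≠ 0 := fun i => by
    simp only [c]
    split_ifs
    · exact hyperplaneValue_ne_zero ht (Finset.notMem_erase _ _)
    · exact one_ne_zero
  have hAc : ∀ i, (Matrix.of A).mulVec (fun j => cuspidalPoints d t j i) =
      c i • fun j => normalForm t s j i := by
    intro i
    funext r
    rw [hA', Pi.smul_apply, smul_eq_mul]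
    by_cases hi : i ∈ Set.range s
    · simp only [normalForm, c, if_pos hi]
      by_cases hr : s r = i
      · rw [if_pos hr, mul_one, hr]
      · rw [if_neg hr, mul_zero, hyperplaneValue_self]
        obtain ⟨r', rfl⟩ := hi
        exact Finset.mem_erase.2 ⟨fun h => hr h.symm, by simp⟩
    · simp only [normalForm, c, if_neg hi, one_mul]
  let B : Matrix (Fin (d + 1)) (Fin (d + 1)) K :=
    fun j r => (c (s r))⁻¹ * cuspidalPoints d t j (s r)
  have hAB : Matrix.of A * B = 1 := by
    ext r r'
    have h1 : (Matrix.of A * B) r r' =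
        (c (s r'))⁻¹ * (Matrix.of A).mulVec (fun j => cuspidalPoints d t j (s r')) r := by
      simp only [Matrix.mulVec, dotProduct, Finset.mul_sum]
      rw [Matrix.mul_apply]
      exact Finset.sum_congr rfl fun j _ => mul_left_comm _ _ _
    rw [h1, hAc, Pi.smul_apply, smul_eq_mul, inv_mul_cancel_left₀ (hc _), normalForm,
      if_pos ⟨r', rfl⟩, Matrix.one_apply]
    simp
  exact ⟨Matrix.of A, B, hAB, mul_eq_one_comm.1 hAB, c, hc, hAc⟩

/-- The right-hand side does not depend on i. So the normal forms of the point j before and after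
the move have inverse coordinates up to a common factor, which is why `cuspidalMove` describes the
Cremona transformation. -/
theorem hyperplaneValue_mul_cuspidalMove [CharZero K] (t : Fin k → K) {I : Finset (Fin k)}
    (hI : I.card = d + 1) {i j : Fin k} (hi : i ∈ I) (hj : j ∉ I) :
    hyperplaneValue t (I.erase i) (t j) *
        hyperplaneValue (cuspidalMove d I t) (I.erase i) (cuspidalMove d I t j) =
      ∏ l ∈ I, ((t j - t l) * (t j - t l + ∑ l ∈ I, t l)) := by
  have hd : (d : K) + 1 ≠ 0 := Nat.cast_add_one_ne_zero d
  have h1 : ∑ l ∈ I.erase i, t l = ∑ l ∈ I, t l - t i := by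
    rw [← Finset.add_sum_erase I t hi]; ring
  have h2 : ∑ l ∈ I.erase i, cuspidalMove d I t l =
      -∑ l ∈ I, t l - cuspidalMove d I t i := by
    rw [← sum_cuspidalMove hI, ← Finset.add_sum_erase I _ hi]; ring
  have h3 : ∏ l ∈ I.erase i, (cuspidalMove d I t j - cuspidalMove d I t l) =
      ∏ l ∈ I.erase i, (t j - t l + ∑ l ∈ I, t l) := by
    refine Finset.prod_congr rfl fun l hl => ?_
    rw [cuspidalMove, cuspidalMove, if_neg hj, if_pos (Finset.mem_of_mem_erase hl)]
    field_simp
    ring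
  rw [hyperplaneValue, hyperplaneValue, h1, h2, h3, Finset.prod_mul_distrib,
    ← Finset.mul_prod_erase I (fun l => t j - t l) hi,
    ← Finset.mul_prod_erase I (fun l => t j - t l + ∑ l ∈ I, t l) hi]
  have h4 : cuspidalMove d I t j + (-∑ l ∈ I, t l - cuspidalMove d I t i) = t j - t i := by
    rw [cuspidalMove, cuspidalMove, if_neg hj, if_pos hi]
    field_simp
    ring
  rw [h4]
  ring

/-- The points of I are taken to the coordinate points and the coordinates are inverted; by the
product formula the result is, up to scaling of points, the normal form of the moved parameters.
Since moves and reflections are involutions, one inequality suffices. -/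
theorem finrank_cuspidal_cremona_le [CharZero K] {t : Fin k → K} (ht : LinearIndependent ℤ t)
    {I : Finset (Fin k)} (hI : I.card = d + 1) (D : Cls ℤ k) :
    Module.finrank K (linearSystem (cuspidalPoints d t) D) ≤
      Module.finrank K (linearSystem (cuspidalPoints d (cuspidalMove d I t)) (cremona d I D)) := by
  classical
  obtain ⟨s, rfl⟩ : ∃ s : Fin (d + 1) ↪ Fin k, I = Finset.univ.map s :=
    ⟨(I.orderEmbOfFin hI).toEmbedding, (Finset.map_orderEmbOfFin_univ I hI).symm⟩
  have ht' := linearIndependent_cuspidalMove hI ht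
  set t' := cuspidalMove d (Finset.univ.map s) t with ht'_def
  have hmem : ∀ i, i ∉ Set.range s ↔ i ∉ Finset.univ.map s := fun i => by simp
  have hne : ∀ {t : Fin k → K}, LinearIndependent ℤ t → ∀ i ∉ Set.range s, ∀ j,
      normalForm t s j i ≠ 0 := fun ht i hi j => by
    rw [normalForm, if_neg hi]
    exact hyperplaneValue_ne_zero ht fun h => (hmem i).1 hi (Finset.mem_of_mem_erase h)
  have hsingle : ∀ (t : Fin k → K) (r), (fun j => normalForm t s j (s r)) = Pi.single r 1 := by
    intro t r
    funext j
    rw [normalForm, if_pos ⟨r, rfl⟩, Pi.single_apply]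
    simp
  let N' : Matrix (Fin (d + 1)) (Fin k) K := fun j i =>
    if i ∈ Set.range s then normalForm t s j i else (normalForm t s j i)⁻¹
  have hle_normalForm : Module.finrank K (linearSystem (cuspidalPoints d t) D) ≤
      Module.finrank K (linearSystem (normalForm t s) D) := by
    obtain ⟨A, B, hAB, hBA, c, hc, h⟩ := exists_normalForm ht s
    refine finrank_linearSystem_le_of_projective hBA (fun i => inv_ne_zero (hc i)) (fun i => ?_) D
    have h1 := congrArg B.mulVec (h i)
    rw [Matrix.mulVec_mulVec, hBA, Matrix.one_mulVec, Matrix.mulVec_smul] at h1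
    rw [h1, smul_smul, inv_mul_cancel₀ (hc i), one_smul]
  have hnormalForm_le : Module.finrank K (linearSystem (normalForm t s) D) ≤
      Module.finrank K (linearSystem N' (cremona d (Finset.univ.map s) D)) := by
    refine finrank_linearSystem_cremona_le s (hsingle t) (fun r => ?_) (hne ht)
      (fun i hi j => if_neg hi) D
    rw [← hsingle t r]
    funext j
    exact if_pos ⟨r, rfl⟩
  have hle_reflected : ∀ D, Module.finrank K (linearSystem N' D) ≤
      Module.finrank K (linearSystem (normalForm t' s) D) := by
    intro D
    let c : Fin k → K := fun i => if i ∈ Set.range s then 1 else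
      ∏ l ∈ Finset.univ.map s, ((t i - t l) * (t i - t l + ∑ l ∈ Finset.univ.map s, t l))
    have hcN : ∀ i ∉ Set.range s, ∀ j, normalForm t s j i * normalForm t' s j i = c i := by
      intro i hi j
      simp only [normalForm, if_neg hi, c]
      exact hyperplaneValue_mul_cuspidalMove t hI (by simp) ((hmem i).1 hi)
    have hc : ∀ i, c i ≠ 0 := fun i => by
      by_cases hi : i ∈ Set.range s
      · simp only [c, if_pos hi]; exact one_ne_zero
      · rw [← hcN i hi 0]
        exact mul_ne_zero (hne ht i hi 0) (hne ht' i hi 0)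
    refine finrank_linearSystem_le_of_projective (one_mul 1) hc (fun i => ?_) D
    rw [Matrix.one_mulVec]
    funext j
    rw [Pi.smul_apply, smul_eq_mul]
    by_cases hi : i ∈ Set.range s
    · simp only [c, N', if_pos hi, one_mul, normalForm]
    · simp only [N', if_neg hi]
      rw [← hcN i hi j, mul_right_comm, mul_inv_cancel₀ (hne ht i hi j), one_mul]
  have hreflected_le : ∀ D, Module.finrank K (linearSystem (normalForm t' s) D) ≤
      Module.finrank K (linearSystem (cuspidalPoints d t') D) := by
    intro D
    obtain ⟨A, B, hAB, hBA, c, hc, h⟩ := exists_normalForm ht' s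
    exact finrank_linearSystem_le_of_projective hAB hc h D
  exact hle_normalForm.trans (hnormalForm_le.trans ((hle_reflected _).trans (hreflected_le _)))

end Cuspidal

/-! ### Effective divisors of anticanonical degree one -/

/-- The linear system of `D` is nonempty for all independent points of the cuspidal curve. -/
def CuspidalEffective {k : ℕ} (d : ℕ) (D : Cls ℤ k) : Prop :=
  ∀ t : Fin k → ℂ, LinearIndependent ℤ t →
    0 < Module.finrank ℂ (linearSystem (cuspidalPoints d t) D)

theorem linearSystem_posPart {K : Type*} [Field K] {k d : ℕ}
    (P : Matrix (Fin (d + 1)) (Fin k) K) (D : Cls ℤ k) :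
    linearSystem P (D.1, fun i => max (D.2 i) 0) = linearSystem P D := by
  have : ∀ i, (max (D.2 i) 0).toNat = (D.2 i).toNat := fun i => by omega
  simp only [linearSystem, this]

/-- The moves permute the independent parameter vectors, so effectivity for all of them, unlike
effectivity for a single one, is visibly stable under reflections. -/
theorem cremonaStable_cuspidalEffective {k d : ℕ} (hex : ∃ t : Fin k → ℂ, LinearIndependent ℤ t) :
    CremonaStable (k := k) d (CuspidalEffective d) where
  nonneg D hD := by
    obtain ⟨t, ht⟩ := hex
    by_contra! h
    have := hD t ht
    rw [linearSystem_of_neg h, finrank_bot] at this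
    exact lt_irrefl _ this
  posPart D hD t ht := by
    rw [linearSystem_posPart]
    exact hD t ht
  reflect I hI D hD t ht := by
    have h := finrank_cuspidal_cremona_le (linearIndependent_cuspidalMove hI ht) hI D
    rw [cuspidalMove_cuspidalMove hI] at h
    exact (hD _ (linearIndependent_cuspidalMove hI ht)).trans_le h

/-- Powers of a transcendental number are independent. -/
theorem exists_linearIndependent_int (k : ℕ) : ∃ t : Fin k → ℂ, LinearIndependent ℤ t := by
  have hx := transcendental_iff.1 (transcendental_liouvilleNumber (m := 2) le_rfl)
  refine ⟨fun i => ((liouvilleNumber 2 : ℝ) : ℂ) ^ (i : ℕ),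
    Fintype.linearIndependent_iff.2 fun g hg i => ?_⟩
  have h1 := hx (∑ i : Fin k, Polynomial.monomial (i : ℕ) (g i)) (by
    simp only [zsmul_eq_mul] at hg
    simp only [map_sum, Polynomial.aeval_monomial, algebraMap_int_eq, eq_intCast]
    exact_mod_cast hg)
  have h2 := congrArg (fun p => Polynomial.coeff p (i : ℕ)) h1
  simpa [Polynomial.finsetSum_coeff, Polynomial.coeff_monomial, Fin.val_inj] using h2

theorem cuspidalPoints_ne_zero {K : Type*} [Field K] {k d : ℕ} (hd : 2 ≤ d) (t : Fin k → K)
    (i : Fin k) : (fun j => cuspidalPoints d t j i) ≠ 0 := by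
  intro h
  have := congrFun h 0
  simp [cuspidalPoints, show 0 < d by omega] at this

theorem h0_le_finrank {k d : ℕ} {P : Matrix (Fin (d + 1)) (Fin k) ℂ}
    (hP : ∀ i, (fun j => P j i) ≠ 0) (D : Cls ℤ k) :
    h0 k d D ≤ Module.finrank ℂ (linearSystem P D) := Nat.sInf_le ⟨P, hP, rfl⟩

/-- As `h0` is a minimum over configurations, effectivity at generic points passes to every special
one. -/
theorem IsDegreeOne.cuspidalEffective {k d : ℕ} (hd : 2 ≤ d) {D : Cls ℤ k}
    (hD : IsDegreeOne k d D) : CuspidalEffective d D := fun t _ =>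
  hD.2.trans_le (h0_le_finrank (cuspidalPoints_ne_zero hd t) D)

theorem linearSystem_exceptional {K : Type*} [Field K] {k d : ℕ}
    (P : Matrix (Fin (d + 1)) (Fin k) K) (i : Fin k) :
    linearSystem P (exceptional i) = Submodule.span K {1} := by
  have h1 : ∀ j, ((exceptional i : Cls ℤ k).2 j).toNat = 0 := fun j => by
    simp only [exceptional]; split_ifs <;> rfl
  ext f
  rw [mem_linearSystem (by simp [exceptional]), Submodule.mem_span_singleton]
  simp only [h1]
  constructor
  · rintro ⟨h, -⟩
    refine ⟨coeff 0 f, ?_⟩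
    have h2 := totalDegree_eq_zero_iff_eq_C.1 (Nat.le_zero.1 h.totalDegree_le)
    rw [smul_eq_C_mul, mul_one, ← h2]
  · rintro ⟨a, rfl⟩
    refine ⟨?_, fun j => orderGE_zero _⟩
    rw [smul_eq_C_mul, mul_one]
    exact isHomogeneous_C _ a

theorem finrank_linearSystem_exceptional {K : Type*} [Field K] {k d : ℕ}
    (P : Matrix (Fin (d + 1)) (Fin k) K) (i : Fin k) :
    Module.finrank K (linearSystem P (exceptional i)) = 1 := by
  rw [linearSystem_exceptional]
  exact finrank_span_singleton one_ne_zero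

/-- On cuspidal configurations the dimension does not drop when the class is reflected back to an
exceptional one, where it is 1. -/
theorem CremonaOrbit.h0_le_one {k d : ℕ} (hd : 2 ≤ d) {D : Cls ℤ k}
    (hD : CremonaOrbit k d D) : h0 k d D ≤ 1 := by
  have h : ∀ t : Fin k → ℂ, LinearIndependent ℤ t →
      Module.finrank ℂ (linearSystem (cuspidalPoints d t) D) ≤ 1 := by
    induction hD with
    | exceptional i => intro t _; rw [finrank_linearSystem_exceptional]
    | cremona I hI D _ ih =>
      intro t ht
      have h1 := finrank_cuspidal_cremona_le ht hI (MukaiKD.cremona d I D)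
      rw [cremona_cremona hI] at h1
      exact h1.trans (ih _ (linearIndependent_cuspidalMove hI ht))
  obtain ⟨t, ht⟩ := exists_linearIndependent_int k
  exact (h0_le_finrank (cuspidalPoints_ne_zero hd t) D).trans (h t ht)

/-! ### Initial forms -/

section Initial

variable {σ : Type*}

/-- Laurent expansion at `0`. -/
def laurentExpansion : RatFunc ℂ →+* LaurentSeries ℂ :=
  letI := RatFunc.liftAlgebra ℂ (LaurentSeries ℂ)
  algebraMap _ _

/-- The coefficient of `t ^ n` in the Laurent expansion of a rational function. -/
def laurentCoeff (n : ℤ) (x : RatFunc ℂ) : ℂ :=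
  (laurentExpansion x).coeff n

theorem laurentCoeff_zero (n : ℤ) : laurentCoeff n 0 = 0 := by simp [laurentCoeff]

theorem laurentCoeff_sum {ι : Type*} (s : Finset ι) (f : ι → RatFunc ℂ) (n : ℤ) :
    laurentCoeff n (∑ i ∈ s, f i) = ∑ i ∈ s, laurentCoeff n (f i) := by
  simp [laurentCoeff, map_sum]

theorem exists_laurentCoeff_ne_zero {x : RatFunc ℂ} (hx : x ≠ 0) :
    laurentCoeff (laurentExpansion x).order x ≠ 0 := by
  rw [laurentCoeff, Ne, HahnSeries.coeff_order_eq_zero]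
  exact (map_ne_zero _).2 hx

/-- Below order a + b nothing contributes, and in order a + b only the pair (a, b) does. -/
theorem laurentCoeff_mul {x y : RatFunc ℂ} {a b n : ℤ}
    (hx : ∀ i < a, laurentCoeff i x = 0) (hy : ∀ i < b, laurentCoeff i y = 0) (hn : n ≤ a + b) :
    laurentCoeff n (x * y) = if n = a + b then laurentCoeff a x * laurentCoeff b y else 0 := by
  classical
  rw [laurentCoeff, map_mul, HahnSeries.coeff_mul]
  split_ifs with h
  · rw [Finset.sum_eq_single (a, b)]
    · rfl
    · rintro ⟨i, j⟩ hij hne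
      obtain ⟨h1, h2, h3⟩ := (Finset.mem_antidiagonal ..).1 hij
      rw [HahnSeries.mem_support] at h1 h2
      have h4 : a ≤ i := by by_contra! hlt; exact h1 (hx i hlt)
      have h5 : b ≤ j := by by_contra! hlt; exact h2 (hy j hlt)
      simp only at h3 h4 h5
      exact absurd (Prod.ext (by simp only; omega) (by simp only; omega)) hne
    · intro h1
      rw [Finset.mem_antidiagonal] at h1
      by_contra! h2
      refine h1 ⟨?_, ?_, h.symm⟩
      · exact fun h3 => h2 (by simp only at h3 ⊢; rw [h3, zero_mul])
      · exact fun h3 => h2 (by simp only at h3 ⊢; rw [h3, mul_zero])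
  · refine Finset.sum_eq_zero ?_
    rintro ⟨i, j⟩ hij
    obtain ⟨h1, h2, h3⟩ := (Finset.mem_antidiagonal ..).1 hij
    rw [HahnSeries.mem_support] at h1 h2
    have h4 : a ≤ i := by by_contra! hlt; exact h1 (hx i hlt)
    have h5 : b ≤ j := by by_contra! hlt; exact h2 (hy j hlt)
    simp only at h3
    omega

/-- The order in `t` of `f` is `n`. -/
def HasTOrder (f : MvPolynomial σ (RatFunc ℂ)) (n : ℤ) : Prop :=
  (∀ e, ∀ m < n, laurentCoeff m (coeff e f) = 0) ∧ ∃ e, laurentCoeff n (coeff e f) ≠ 0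

theorem coeff_initialForm (f : MvPolynomial σ (RatFunc ℂ)) (e : σ →₀ ℕ) :
    coeff e (initialForm f) = laurentCoeff (tOrder f) (coeff e f) := by
  classical
  rw [initialForm, coeff_sum]
  simp only [coeff_monomial]
  rw [Finset.sum_ite_eq' f.support e]
  split_ifs with h
  · rfl
  · rw [notMem_support_iff.1 h, laurentCoeff_zero]

theorem hasTOrder_tOrder {f : MvPolynomial σ (RatFunc ℂ)} (hf : f ≠ 0) :
    HasTOrder f (tOrder f) := by
  have h := support_nonempty.2 hf
  rw [tOrder, dif_pos h]
  constructor
  · intro e m hm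
    by_cases he : e ∈ f.support
    · exact HahnSeries.coeff_eq_zero_of_lt_order (hm.trans_le (Finset.inf'_le _ he))
    · rw [notMem_support_iff.1 he, laurentCoeff_zero]
  · obtain ⟨e, he, heq⟩ := Finset.exists_mem_eq_inf' h fun e =>
      (laurentExpansion (coeff e f)).order
    change f.support.inf' h (fun e => ((coeff e f : RatFunc ℂ) : LaurentSeries ℂ).order) = _ at heq
    rw [heq]
    exact ⟨e, exists_laurentCoeff_ne_zero (mem_support_iff.1 he)⟩

theorem HasTOrder.tOrder_eq {f : MvPolynomial σ (RatFunc ℂ)} {n : ℤ} (h : HasTOrder f n) :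
    tOrder f = n := by
  have hf : f ≠ 0 := by
    rintro rfl
    obtain ⟨e, he⟩ := h.2
    exact he (by rw [coeff_zero, laurentCoeff_zero])
  have h' := hasTOrder_tOrder hf
  obtain ⟨e, he⟩ := h.2
  obtain ⟨e', he'⟩ := h'.2
  refine le_antisymm ?_ ?_
  · by_contra! hlt
    exact he (h'.1 e n hlt)
  · by_contra! hlt
    exact he' (h.1 e' _ hlt)

theorem initialForm_ne_zero {f : MvPolynomial σ (RatFunc ℂ)} (hf : f ≠ 0) :
    initialForm f ≠ 0 := by
  obtain ⟨e, he⟩ := (hasTOrder_tOrder hf).2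
  rw [← coeff_initialForm] at he
  exact ne_zero_iff.2 ⟨e, he⟩

/-- In order ord f + ord g the coefficients of f g form the product of the two initial forms. It is
nonzero because polynomials over ℂ form a domain, so the orders add. -/
theorem initialForm_mul {f g : MvPolynomial σ (RatFunc ℂ)} (hf : f ≠ 0) (hg : g ≠ 0) :
    initialForm (f * g) = initialForm f * initialForm g := by
  classical
  have hf' := hasTOrder_tOrder hf
  have hg' := hasTOrder_tOrder hg
  have key : ∀ e, ∀ n ≤ tOrder f + tOrder g, laurentCoeff n (coeff e (f * g)) =
      if n = tOrder f + tOrder g then coeff e (initialForm f * initialForm g) else 0 := by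
    intro e n hn
    have h1 : ∀ x : (σ →₀ ℕ) × (σ →₀ ℕ), laurentCoeff n (coeff x.1 f * coeff x.2 g) =
        if n = tOrder f + tOrder g then
          coeff x.1 (initialForm f) * coeff x.2 (initialForm g) else 0 := fun x => by
      rw [laurentCoeff_mul (hf'.1 x.1) (hg'.1 x.2) hn, coeff_initialForm, coeff_initialForm]
    rw [coeff_mul, laurentCoeff_sum, Finset.sum_congr rfl fun x _ => h1 x]
    split_ifs with h
    · rw [coeff_mul]
    · exact Finset.sum_const_zero
  obtain ⟨e, he⟩ := ne_zero_iff.1 (mul_ne_zero (initialForm_ne_zero hf) (initialForm_ne_zero hg))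
  have ht : HasTOrder (f * g) (tOrder f + tOrder g) := by
    refine ⟨fun e m hm => ?_, e, ?_⟩
    · rw [key e m hm.le, if_neg hm.ne]
    · rw [key e _ le_rfl, if_pos rfl]
      exact he
  ext e
  rw [coeff_initialForm, ht.tOrder_eq, key e _ le_rfl, if_pos rfl]

theorem initialForm_C {c : RatFunc ℂ} (hc : c ≠ 0) :
    ∃ c' : ℂ, c' ≠ 0 ∧ initialForm (C c : MvPolynomial σ (RatFunc ℂ)) = C c' := by
  classical
  have h : initialForm (C c : MvPolynomial σ (RatFunc ℂ)) =
      C (laurentCoeff (tOrder (C c : MvPolynomial σ (RatFunc ℂ))) c) := by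
    ext e
    rw [coeff_initialForm, coeff_C, coeff_C]
    split_ifs
    · rfl
    · exact laurentCoeff_zero _
  refine ⟨_, fun h0 => ?_, h⟩
  have := initialForm_ne_zero (σ := σ) (C_ne_zero.2 hc)
  rw [h, h0, C_0] at this
  exact this rfl

theorem initialForm_smul {c : RatFunc ℂ} (hc : c ≠ 0) {f : MvPolynomial σ (RatFunc ℂ)}
    (hf : f ≠ 0) : ∃ c' : ℂ, c' ≠ 0 ∧ initialForm (c • f) = c' • initialForm f := by
  obtain ⟨c', h1, h2⟩ := initialForm_C (σ := σ) hc
  refine ⟨c', h1, ?_⟩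
  rw [smul_eq_C_mul, smul_eq_C_mul, initialForm_mul (C_ne_zero.2 hc) hf, h2]

theorem initialForm_pow {f : MvPolynomial σ (RatFunc ℂ)} (hf : f ≠ 0) (n : ℕ) :
    ∃ c : ℂ, c ≠ 0 ∧ initialForm (f ^ n) = c • initialForm f ^ n := by
  induction n with
  | zero =>
    obtain ⟨c, h1, h2⟩ := initialForm_C (σ := σ) (one_ne_zero (α := RatFunc ℂ))
    exact ⟨c, h1, by rw [pow_zero, pow_zero, ← C_1, h2, smul_eq_C_mul, mul_one]⟩
  | succ n ih =>
    obtain ⟨c, h1, h2⟩ := ih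
    exact ⟨c, h1, by rw [pow_succ, initialForm_mul (pow_ne_zero n hf) hf, h2, smul_mul_assoc,
      pow_succ]⟩

/-- Omitting terms other than the leading one does not change an initial form that is a
monomial. -/
theorem initialForm_eq_of_coeff {f g : MvPolynomial σ (RatFunc ℂ)} {e : σ →₀ ℕ} {c : ℂ}
    (hc : c ≠ 0) (hf : initialForm f = monomial e c) (he : coeff e g = coeff e f)
    (h : ∀ a, coeff a g = coeff a f ∨ coeff a g = 0) : initialForm g = monomial e c := by
  classical
  have hf0 : f ≠ 0 := by
    rintro rfl
    have : initialForm (0 : MvPolynomial σ (RatFunc ℂ)) = 0 := by simp [initialForm]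
    rw [this] at hf
    exact hc (monomial_eq_zero.1 hf.symm)
  have hf' := hasTOrder_tOrder hf0
  have h1 : ∀ a, laurentCoeff (tOrder f) (coeff a f) = coeff a (monomial e c) := fun a => by
    rw [← coeff_initialForm, hf]
  have ht : HasTOrder g (tOrder f) := by
    refine ⟨fun a m hm => ?_, e, ?_⟩
    · rcases h a with h2 | h2
      · rw [h2, hf'.1 a m hm]
      · rw [h2, laurentCoeff_zero]
    · rw [he, h1, coeff_monomial, if_pos rfl]
      exact hc
  ext a
  rw [coeff_initialForm, ht.tOrder_eq]
  by_cases ha : a = e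
  · rw [ha, he, h1]
  · rcases h a with h2 | h2
    · rw [h2, h1]
    · rw [h2, laurentCoeff_zero, coeff_monomial, if_neg (Ne.symm ha)]

end Initial

/-! ### Sections as polynomials -/

section Cox

variable {k d : ℕ}

/-- The divisor classes of the variables. -/
def varClass (k : ℕ) : XY k → Cls ℤ k :=
  Sum.elim (fun i => exceptional i) fun i => (1, fun j => if j = i then 0 else 1)

/-- Treats the multigrading as a weighted grading of the polynomial ring. -/
theorem weight_varClass (e : XY k →₀ ℕ) :
    Finsupp.weight (varClass k) e = multidegree fun s => (e s : ℤ) := by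
  classical
  rw [Finsupp.weight_apply, Finsupp.sum_fintype _ _ (by simp), Fintype.sum_sum_type]
  refine Prod.ext ?_ (funext fun j => ?_)
  · simp [varClass, exceptional, multidegree, Prod.fst_sum]
  · have hs : ∀ (n : ℕ) (D : Cls ℤ k), (n • D).2 j = n * D.2 j := fun n D => by
      change n • D.2 j = _
      rw [nsmul_eq_mul]
    have h1 : ∑ i, (if j = i then (0 : ℤ) else (e (Sum.inr i) : ℤ)) =
        ∑ i, (e (Sum.inr i) : ℤ) - e (Sum.inr j) := by
      rw [eq_sub_iff_add_eq, ← Finset.sum_erase_add _ _ (Finset.mem_univ j),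
        ← Finset.sum_erase_add _ _ (Finset.mem_univ j), if_pos rfl, add_zero]
      congr 1
      exact Finset.sum_congr rfl fun i hi => if_neg (Finset.ne_of_mem_erase hi).symm
    simp only [varClass, Sum.elim_inl, Sum.elim_inr, exceptional, multidegree, Prod.snd_add,
      Prod.snd_sum, Pi.add_apply, Finset.sum_apply, hs, mul_ite, mul_zero, mul_one, mul_neg,
      Finset.sum_ite_eq, Finset.mem_univ, if_true, h1]
    ring

theorem weight_eq_zero_iff (e : XY k →₀ ℕ) : Finsupp.weight (varClass k) e = 0 ↔ e = 0 := by
  refine ⟨fun h => ?_, fun h => by rw [h, map_zero]⟩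
  rw [weight_varClass] at h
  have h1 : ∑ i, (e (Sum.inr i) : ℤ) = 0 := congrArg Prod.fst h
  have h2 : ∀ i, (e (Sum.inl i) : ℤ) + e (Sum.inr i) = 0 := fun i => by
    have := congrFun (congrArg Prod.snd h) i
    simp only [multidegree, h1, Prod.snd_zero, Pi.zero_apply] at this
    omega
  ext s
  rcases s with i | i
  · have := h2 i; simp only [Finsupp.coe_zero, Pi.zero_apply]; omega
  · have := h2 i; simp only [Finsupp.coe_zero, Pi.zero_apply]; omega

variable {K : Type*} [Field K]

theorem IsHomogeneous.aeval_const_mul {n : ℕ} {A : Type*} [CommRing A] [Algebra K A]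
    {f : MvPolynomial (Fin n) K} {M : ℕ} (hf : f.IsHomogeneous M) (c : A) (v : Fin n → A) :
    aeval (fun j => c * v j) f = c ^ M * aeval v f := by
  conv_lhs => rw [f.as_sum, map_sum]
  conv_rhs => rw [f.as_sum, map_sum, Finset.mul_sum]
  refine Finset.sum_congr rfl fun a ha => ?_
  have h1 : a.degree = M := by
    by_contra h
    exact mem_support_iff.1 ha (hf.coeff_eq_zero h)
  rw [aeval_monomial, aeval_monomial, Finsupp.prod_fintype _ _ (by simp),
    Finsupp.prod_fintype _ _ (by simp)]
  simp only [mul_pow, Finset.prod_mul_distrib, Finset.prod_pow_eq_pow_sum]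
  rw [← Finsupp.degree_eq_sum, h1]
  ring

/-- A homogeneous form with a zero of order `m` at `p`, evaluated near `p`. -/
theorem pow_dvd_aeval_of_mem_vanishing {n : ℕ} {A : Type*} [CommRing A] [IsDomain A]
    [Algebra K A] {f : MvPolynomial (Fin n) K} {M m : ℕ} (hf : f.IsHomogeneous M)
    {p : Fin n → K} (hp : f ∈ vanishing p m) {c : A} (hc : c ≠ 0) (x : A) (w : Fin n → A) :
    x ^ m ∣ aeval (fun j => algebraMap K A (p j) * c + x * w j) f := by
  have hdeg : ∀ e ∈ (taylorAt p f).support, e.degree ≤ M := by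
    intro e he
    by_contra! hlt
    have h1 : (taylorAt p f).totalDegree ≤ M := by
      rw [f.as_sum, map_sum]
      refine totalDegree_finsetSum_le fun a ha => ?_
      have h2 : a.degree = M := by
        by_contra h
        exact mem_support_iff.1 ha (hf.coeff_eq_zero h)
      rw [taylorAt, aeval_monomial, Finsupp.prod_fintype _ _ (by simp)]
      refine (totalDegree_mul _ _).trans ?_
      rw [algebraMap_eq, totalDegree_C, zero_add]
      refine (totalDegree_finsetProd _ _).trans ?_
      rw [← h2, Finsupp.degree_eq_sum]
      refine Finset.sum_le_sum fun j _ => (totalDegree_pow _ _).trans ?_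
      refine (Nat.mul_le_mul_left _ ?_).trans (mul_one _).le
      exact (totalDegree_add _ _).trans (by simp [totalDegree_X])
    have h3 : e.degree ≤ M := (le_totalDegree he).trans h1
    omega
  have hlow : ∀ e ∈ (taylorAt p f).support, m ≤ e.degree := fun e he => by
    by_contra! h
    exact mem_support_iff.1 he (hp e h)
  -- Expanding at p and homogenizing with c gives f (p c + x w) = ∑ f_e c ^ (M - |e|) x ^ |e| w ^ e
  -- with m ≤ |e| ≤ M. The identity is checked in the fraction field, where c is invertible.
  refine ⟨∑ e ∈ (taylorAt p f).support, algebraMap K A (coeff e (taylorAt p f)) *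
    c ^ (M - e.degree) * x ^ (e.degree - m) * ∏ j, w j ^ e j, ?_⟩
  have hinj : Function.Injective (algebraMap A (FractionRing A)) :=
    IsFractionRing.injective A (FractionRing A)
  apply hinj
  have hc' : algebraMap A (FractionRing A) c ≠ 0 := fun h => hc (hinj (h.trans (map_zero _).symm))
  have h1 : algebraMap A (FractionRing A) (aeval (fun j => algebraMap K A (p j) * c + x * w j) f) =
      algebraMap A (FractionRing A) c ^ M * aeval (fun j => algebraMap K (FractionRing A) (p j) +
        algebraMap A (FractionRing A) x * algebraMap A (FractionRing A) (w j) /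
          algebraMap A (FractionRing A) c) f := by
    rw [← IsHomogeneous.aeval_const_mul hf, ← aeval_algebraMap_apply]
    congr 2
    funext j
    rw [Function.comp_apply, map_add, map_mul, map_mul, ← IsScalarTower.algebraMap_apply]
    field_simp
  have h2 : aeval (fun j => algebraMap K (FractionRing A) (p j) +
        algebraMap A (FractionRing A) x * algebraMap A (FractionRing A) (w j) /
          algebraMap A (FractionRing A) c) f =
      aeval (fun j => algebraMap A (FractionRing A) x * algebraMap A (FractionRing A) (w j) /
          algebraMap A (FractionRing A) c)
        (taylorAt p f) := by
    rw [← AlgHom.comp_apply]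
    congr 1
    refine algHom_ext fun j => ?_
    simp [taylorAt, add_comm]
  rw [h1, h2]
  conv_lhs => rw [(taylorAt p f).as_sum, map_sum]
  rw [map_mul, map_sum, Finset.mul_sum, Finset.mul_sum]
  refine Finset.sum_congr rfl fun e he => ?_
  rw [aeval_monomial, Finsupp.prod_fintype _ _ (by simp)]
  simp only [map_mul, map_pow, map_prod, div_pow, mul_pow, Finset.prod_div_distrib,
    Finset.prod_mul_distrib, Finset.prod_pow_eq_pow_sum]
  rw [← Finsupp.degree_eq_sum, ← IsScalarTower.algebraMap_apply]
  have h3 : algebraMap A (FractionRing A) c ^ M =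
      algebraMap A (FractionRing A) c ^ (M - e.degree) *
        algebraMap A (FractionRing A) c ^ e.degree := by
    rw [← pow_add, Nat.sub_add_cancel (hdeg e he)]
  have h4 : algebraMap A (FractionRing A) x ^ e.degree =
      algebraMap A (FractionRing A) x ^ m *
        algebraMap A (FractionRing A) x ^ (e.degree - m) := by
    rw [← pow_add, Nat.add_sub_cancel' (hlow e he)]
  rw [h3, h4]
  field_simp

/-- The form `f (P · y/x) · ∏ i, xᵢ ^ m₀` without denominators. -/
def clearedSection (P : Matrix (Fin (d + 1)) (Fin k) K) (f : MvPolynomial (Fin (d + 1)) K) :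
    MvPolynomial (XY k) K :=
  aeval (fun j => ∑ i, C (P j i) * (X (Sum.inr i) * ∏ l ∈ Finset.univ.erase i, X (Sum.inl l))) f

/-- Each yᵢ ∏_{l ≠ i} x_l has class (H - ∑_{l ≠ i} E_l) + ∑_{l ≠ i} E_l = H. -/
theorem isWeightedHomogeneous_clearedSection (P : Matrix (Fin (d + 1)) (Fin k) K)
    {f : MvPolynomial (Fin (d + 1)) K} {M : ℕ} (hf : f.IsHomogeneous M) :
    IsWeightedHomogeneous (varClass k) (clearedSection P f) ((M : ℤ), 0) := by
  have h1 : ∀ i : Fin k, IsWeightedHomogeneous (varClass k)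
      (X (Sum.inr i) * ∏ l ∈ Finset.univ.erase i, X (Sum.inl l) : MvPolynomial (XY k) K)
      (1, 0) := by
    intro i
    have h2 := (isWeightedHomogeneous_X K (varClass k) (Sum.inr i)).mul
      (IsWeightedHomogeneous.prod (Finset.univ.erase i) (fun l => (X (Sum.inl l) :
        MvPolynomial (XY k) K)) (fun l => varClass k (Sum.inl l))
        fun l _ => isWeightedHomogeneous_X K (varClass k) _)
    convert h2 using 1
    refine Prod.ext ?_ (funext fun j => ?_)
    · simp [varClass, exceptional, Prod.fst_sum]
    · simp only [varClass, Sum.elim_inl, Sum.elim_inr, exceptional, Prod.snd_add, Prod.snd_sum,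
        Pi.add_apply, Finset.sum_apply, Finset.sum_ite_eq, Finset.mem_erase, Finset.mem_univ,
        and_true, Pi.zero_apply, ne_eq]
      by_cases hj : j = i <;> simp [hj]
  have h2 : ∀ j, IsWeightedHomogeneous (varClass k) (∑ i, C (P j i) *
      (X (Sum.inr i) * ∏ l ∈ Finset.univ.erase i, X (Sum.inl l)) : MvPolynomial (XY k) K)
      (1, 0) := fun j => IsWeightedHomogeneous.sum _ _ _ fun i _ => (h1 i).C_mul _
  rw [clearedSection, f.as_sum, map_sum]
  refine IsWeightedHomogeneous.sum _ _ _ fun a ha => ?_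
  have h3 : a.degree = M := by
    by_contra h
    exact mem_support_iff.1 ha (hf.coeff_eq_zero h)
  rw [aeval_monomial, algebraMap_eq, Finsupp.prod_fintype _ _ (by simp)]
  refine IsWeightedHomogeneous.C_mul ?_ _
  convert IsWeightedHomogeneous.prod Finset.univ _ _ fun j _ => (h2 j).pow (a j) using 1
  rw [← Finset.sum_smul, ← Finsupp.degree_eq_sum, h3]
  ext <;> simp

/-- `g` is the image in the polynomial ring of a section of `D`. -/
def IsCoxGenerator (P : Matrix (Fin (d + 1)) (Fin k) K) (D : Cls ℤ k)
    (g : MvPolynomial (XY k) K) : Prop :=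
  ∃ f ∈ linearSystem P D,
    algebraMap (MvPolynomial (XY k) K) (FractionRing (MvPolynomial (XY k) K)) g =
      coxSection P D f

/-- Splitting mᵢ into its positive and negative parts clears all denominators, so that lying in the
polynomial ring becomes a question of divisibility. -/
theorem algebraMap_eq_coxSection_iff {P : Matrix (Fin (d + 1)) (Fin k) K} {D : Cls ℤ k}
    {f : MvPolynomial (Fin (d + 1)) K} (hf : f.IsHomogeneous D.1.toNat) (hD : 0 ≤ D.1)
    (g : MvPolynomial (XY k) K) :
    algebraMap (MvPolynomial (XY k) K) (FractionRing (MvPolynomial (XY k) K)) g =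
        coxSection P D f ↔
      g * ∏ i, X (Sum.inl i) ^ (D.2 i).toNat =
        clearedSection P f * ∏ i, X (Sum.inl i) ^ (-D.2 i).toNat := by
  set φ := algebraMap (MvPolynomial (XY k) K) (FractionRing (MvPolynomial (XY k) K)) with hφ
  have hinj : Function.Injective φ := IsFractionRing.injective _ _
  have hx : ∀ s, φ (X s) ≠ 0 := fun s h => X_ne_zero (R := K) s (hinj (h.trans (map_zero φ).symm))
  have h1 : φ (clearedSection P f) = (∏ i, φ (X (Sum.inl i))) ^ D.1.toNat *
      aeval (fun j => ∑ i, φ (C (P j i)) * (φ (X (Sum.inr i)) / φ (X (Sum.inl i)))) f := by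
    rw [← IsHomogeneous.aeval_const_mul hf, clearedSection, hφ, ← aeval_algebraMap_apply, ← hφ]
    congr 2
    funext j
    rw [Function.comp_apply, map_sum, Finset.mul_sum]
    refine Finset.sum_congr rfl fun i _ => ?_
    rw [map_mul, map_mul, map_prod, ← Finset.mul_prod_erase _ _ (Finset.mem_univ i)]
    have := hx (Sum.inl i)
    field_simp
  have hprod : ∀ n : Fin k → ℕ, ∏ i, φ (X (Sum.inl i)) ^ n i ≠ 0 := fun n =>
    Finset.prod_ne_zero_iff.2 fun i _ => pow_ne_zero _ (hx _)
  rw [← hinj.eq_iff, map_mul, map_mul, h1, map_prod, map_prod]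
  simp only [map_pow]
  have h2 : coxSection P D f * ∏ i, φ (X (Sum.inl i)) ^ (D.2 i).toNat =
      (∏ i, φ (X (Sum.inl i))) ^ D.1.toNat *
      aeval (fun j => ∑ i, φ (C (P j i)) * (φ (X (Sum.inr i)) / φ (X (Sum.inl i)))) f *
      ∏ i, φ (X (Sum.inl i)) ^ (-D.2 i).toNat := by
    rw [coxSection, ← hφ, mul_assoc, ← Finset.prod_mul_distrib, mul_comm (_ ^ D.1.toNat), mul_assoc,
      ← Finset.prod_pow, ← Finset.prod_mul_distrib]
    congr 1
    refine Finset.prod_congr rfl fun i _ => ?_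
    rw [← zpow_natCast, ← zpow_natCast, ← zpow_natCast, ← zpow_add₀ (hx _), ← zpow_add₀ (hx _)]
    congr 1
    omega
  rw [← h2]
  constructor
  · intro h; rw [h]
  · intro h; exact mul_right_cancel₀ (hprod _) h

theorem prod_X_pow_eq_monomial (n : Fin k → ℕ) :
    (∏ i, X (Sum.inl i) ^ n i : MvPolynomial (XY k) K) =
      monomial (Finsupp.equivFunOnFinite.symm (Sum.elim n fun _ => 0)) 1 := by
  rw [monomial_eq, C_1, one_mul, Finsupp.prod_fintype _ _ (by simp), Fintype.prod_sum_type]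
  simp

theorem IsCoxGenerator.isWeightedHomogeneous {P : Matrix (Fin (d + 1)) (Fin k) K} {D : Cls ℤ k}
    {g : MvPolynomial (XY k) K} (hg : IsCoxGenerator P D g) :
    IsWeightedHomogeneous (varClass k) g D := by
  obtain ⟨f, hf, h⟩ := hg
  rcases lt_or_ge D.1 0 with hD | hD
  · rw [linearSystem_of_neg hD, Submodule.mem_bot] at hf
    have h1 : coxSection P D f = 0 := by rw [hf, coxSection, map_zero, zero_mul]
    rw [h1] at h
    rw [IsFractionRing.injective (MvPolynomial (XY k) K) (FractionRing (MvPolynomial (XY k) K))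
      (h.trans (map_zero _).symm)]
    exact isWeightedHomogeneous_zero _ _ _
  · have hf' := ((mem_linearSystem hD).1 hf).1
    rw [algebraMap_eq_coxSection_iff hf' hD, prod_X_pow_eq_monomial, prod_X_pow_eq_monomial] at h
    have h1 := (isWeightedHomogeneous_clearedSection P hf').mul
      (isWeightedHomogeneous_monomial (varClass k) (Finsupp.equivFunOnFinite.symm
        (Sum.elim (fun i => (-D.2 i).toNat) fun _ => 0)) (1 : K) rfl)
    rw [← h] at h1
    intro e he
    have h2 := h1 (d := e + Finsupp.equivFunOnFinite.symm
        (Sum.elim (fun i => (D.2 i).toNat) fun _ => 0)) (by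
      rw [coeff_mul_monomial, mul_one]; exact he)
    rw [map_add] at h2
    simp only [weight_varClass] at h2 ⊢
    refine Prod.ext ?_ (funext fun i => ?_)
    · have := congrArg Prod.fst h2
      simp [multidegree] at this ⊢
      omega
    · have := congrFun (congrArg Prod.snd h2) i
      simp [multidegree] at this ⊢
      omega

/-- Modulo xᵢ the substituted vector is the i-th point times yᵢ ∏_{l ≠ i} x_l, so multiplicity mᵢ
there makes the cleared section divisible by xᵢ ^ mᵢ. -/
theorem exists_algebraMap_eq_coxSection {P : Matrix (Fin (d + 1)) (Fin k) K} {D : Cls ℤ k}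
    {f : MvPolynomial (Fin (d + 1)) K} (hf : f ∈ linearSystem P D) :
    ∃ g, algebraMap (MvPolynomial (XY k) K) (FractionRing (MvPolynomial (XY k) K)) g =
      coxSection P D f := by
  rcases lt_or_ge D.1 0 with hD | hD
  · rw [linearSystem_of_neg hD, Submodule.mem_bot] at hf
    exact ⟨0, by rw [map_zero, hf, coxSection, map_zero, zero_mul]⟩
  obtain ⟨hf1, hf2⟩ := (mem_linearSystem hD).1 hf
  have hdvd : ∀ i, X (Sum.inl i) ^ (D.2 i).toNat ∣ clearedSection P f := by
    intro i
    have h1 := pow_dvd_aeval_of_mem_vanishing hf1 (hf2 i)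
      (c := (X (Sum.inr i) * ∏ l ∈ Finset.univ.erase i, X (Sum.inl l) : MvPolynomial (XY k) K))
      (mul_ne_zero (X_ne_zero _) (Finset.prod_ne_zero_iff.2 fun _ _ => X_ne_zero _))
      (X (Sum.inl i)) (fun j => ∑ l ∈ Finset.univ.erase i, C (P j l) * (X (Sum.inr l) *
        ∏ l' ∈ (Finset.univ.erase l).erase i, X (Sum.inl l')))
    convert h1 using 1
    rw [clearedSection]
    congr 2
    funext j
    refine (Finset.add_sum_erase _ _ (Finset.mem_univ i)).symm.trans ?_
    rw [algebraMap_eq, Finset.mul_sum]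
    refine congrArg₂ _ rfl (Finset.sum_congr rfl fun l hl => ?_)
    have h2 : i ∈ Finset.univ.erase l :=
      Finset.mem_erase.2 ⟨(Finset.ne_of_mem_erase hl).symm, Finset.mem_univ _⟩
    have h3 := Finset.mul_prod_erase (Finset.univ.erase l)
      (fun l => (X (Sum.inl l) : MvPolynomial (XY k) K)) h2
    rw [← h3]
    ring
  have hle : ∀ e ∈ (clearedSection P f).support, ∀ i, (D.2 i).toNat ≤ e (Sum.inl i) := by
    intro e he i
    obtain ⟨q, hq⟩ := hdvd i
    by_contra! hlt
    refine mem_support_iff.1 he ?_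
    rw [hq, X_pow_eq_monomial, coeff_monomial_mul', if_neg]
    intro h
    rw [Finsupp.single_le_iff] at h
    omega
  set a : XY k →₀ ℕ := Finsupp.equivFunOnFinite.symm
    (Sum.elim (fun i => (D.2 i).toNat) fun _ => 0) with ha
  have hG : monomial a 1 ∣ clearedSection P f := by
    rw [(clearedSection P f).as_sum]
    refine Finset.dvd_sum fun e he => ?_
    rw [monomial_dvd_monomial]
    refine ⟨Or.inr fun s => ?_, one_dvd _⟩
    rcases s with i | i
    · exact hle e he i
    · exact Nat.zero_le _
  obtain ⟨q, hq⟩ := hG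
  refine ⟨q * ∏ i, X (Sum.inl i) ^ (-D.2 i).toNat, ?_⟩
  rw [algebraMap_eq_coxSection_iff hf1 hD, hq,
    prod_X_pow_eq_monomial (fun i => (D.2 i).toNat), ← ha]
  ring

end Cox

/-! ### Extremal divisors of anticanonical degree one -/

section Extremal

variable {k d : ℕ}

theorem mukaiForm_add_right (C D E : Cls ℤ k) :
    mukaiForm d C (D + E) = mukaiForm d C D + mukaiForm d C E := by
  simp only [mukaiForm, Prod.fst_add, Prod.snd_add, Pi.add_apply, mul_add, Finset.sum_add_distrib]
  ring

theorem mukaiForm_add_left (C D E : Cls ℤ k) :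
    mukaiForm d (C + D) E = mukaiForm d C E + mukaiForm d D E := by
  rw [mukaiForm_comm, mukaiForm_add_right, mukaiForm_comm E, mukaiForm_comm E]

theorem intDegree_add (D E : Cls ℤ k) : intDegree d (D + E) = intDegree d D + intDegree d E := by
  simp only [intDegree, Prod.fst_add, Prod.snd_add, Pi.add_apply, Finset.sum_add_distrib]
  ring

/-- The linear form `(C, ·)` plus the anticanonical degree. -/
def faceForm (d : ℕ) (C : Cls ℤ k) : Cls ℤ k →+ ℤ where
  toFun F := mukaiForm d C F + intDegree d F
  map_zero' := by simp [mukaiForm, intDegree]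
  map_add' D E := by rw [mukaiForm_add_right, intDegree_add]; ring

theorem faceForm_apply (C F : Cls ℤ k) : faceForm d C F = mukaiForm d C F + intDegree d F := rfl

theorem IsDegreeOne.intDegree_eq (hd : 2 ≤ d) {D : Cls ℤ k} (hD : IsDegreeOne k d D) :
    intDegree d D = 1 := by
  have h : (d : ℚ) - 1 ≠ 0 := by
    have : (2 : ℚ) ≤ d := by exact_mod_cast hd
    linarith
  have h1 := hD.1
  rw [anticanonicalDegree_cast h] at h1
  exact_mod_cast h1

/-- The divisors of anticanonical degree one that behave like exceptional divisors. -/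
structure IsExtremal (k d : ℕ) (D : Cls ℤ k) : Prop where
  isDegreeOne : IsDegreeOne k d D
  h0_le : h0 k d D ≤ 1
  eq_exceptional : D.1 ≤ 0 → ∃ i, D = exceptional i
  mukaiForm_self : mukaiForm d D D = -1
  mukaiForm_nonneg : ∀ F, IsDegreeOne k d F → F ≠ D → 0 ≤ mukaiForm d D F

/-- The class that defines the face spanned by `D` and `E`. -/
def faceClass (D E : Cls ℤ k) : Cls ℤ k := open Classical in if D = E then D else D + E

/-- The self-intersection -1 cancels the degree at D and at E; at any other class of degree one the
Mukai products are nonnegative, so the value is at least 1. -/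
theorem faceForm_faceClass (hd : 2 ≤ d) {D E : Cls ℤ k} (hD : IsExtremal k d D)
    (hE : IsExtremal k d E) (hDE : D = E ∨ mukaiForm d D E = 0) :
    faceForm d (faceClass D E) D = 0 ∧ faceForm d (faceClass D E) E = 0 ∧
      ∀ F, IsDegreeOne k d F → F ≠ D → F ≠ E → 0 < faceForm d (faceClass D E) F := by
  have h1 := hD.isDegreeOne.intDegree_eq hd
  have h2 := hE.isDegreeOne.intDegree_eq hd
  have h3 := hD.mukaiForm_self
  have h4 := hE.mukaiForm_self
  simp only [faceForm_apply, faceClass]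
  split_ifs with h
  · subst h
    refine ⟨by omega, by omega, fun F hF hne _ => ?_⟩
    have := hD.mukaiForm_nonneg F hF hne
    have := hF.intDegree_eq hd
    omega
  · have h5 := hDE.resolve_left h
    have h6 : mukaiForm d E D = 0 := by rw [mukaiForm_comm, h5]
    simp only [mukaiForm_add_left]
    refine ⟨by omega, by omega, fun F hF hne hne' => ?_⟩
    have := hD.mukaiForm_nonneg F hF hne
    have := hE.mukaiForm_nonneg F hF hne'
    have := hF.intDegree_eq hd
    omega

theorem mukaiForm_nsmul (C D : Cls ℤ k) (n : ℕ) :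
    mukaiForm d C (n • D) = n * mukaiForm d C D := by
  induction n with
  | zero => simp [mukaiForm]
  | succ n ih => rw [succ_nsmul, mukaiForm_add_right, ih]; push_cast; ring

theorem intDegree_nsmul (D : Cls ℤ k) (n : ℕ) : intDegree d (n • D) = n * intDegree d D := by
  induction n with
  | zero => simp [intDegree]
  | succ n ih => rw [succ_nsmul, intDegree_add, ih]; push_cast; ring

theorem isDegreeOne_exceptional (hd : 2 ≤ d) (i : Fin k) : IsDegreeOne k d (exceptional i) := by
  have h : (d : ℚ) - 1 ≠ 0 := by
    have : (2 : ℚ) ≤ d := by exact_mod_cast hd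
    linarith
  constructor
  · rw [anticanonicalDegree_cast h, intDegree_exceptional, Int.cast_one]
  · have hne : {n | ∃ P : Matrix (Fin (d + 1)) (Fin k) ℂ, (∀ i, (fun j => P j i) ≠ 0) ∧
        n = Module.finrank ℂ (linearSystem P (exceptional i))}.Nonempty :=
      ⟨_, fun _ _ => 1, fun i h => one_ne_zero (congrFun h 0), rfl⟩
    obtain ⟨P, -, hP⟩ := Nat.sInf_mem hne
    rw [finrank_linearSystem_exceptional] at hP
    rw [h0, hP]
    exact one_pos

theorem CremonaOrbit.isExtremal (hd : 2 ≤ d) (hk : d + 2 ≤ k)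
    (hfin : (k : ℤ) * ((d : ℤ) - 1) < ((d : ℤ) + 1) ^ 2) {D : Cls ℤ k}
    (hD : CremonaOrbit k d D) (h1 : IsDegreeOne k d D) : IsExtremal k d D where
  isDegreeOne := h1
  h0_le := hD.h0_le_one hd
  eq_exceptional h := by
    have hE := cremonaStable_cuspidalEffective (d := d) (exists_linearIndependent_int k)
    have h2 := hE.nonneg D (h1.cuspidalEffective hd)
    have h3 := h1.intDegree_eq hd
    have h4 : ∃ i ∈ Finset.univ, D.2 i < 0 := by
      refine Finset.exists_lt_of_sum_lt (g := fun _ => (0 : ℤ)) ?_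
      rw [Finset.sum_const_zero]
      rw [intDegree, le_antisymm h h2, mul_zero] at h3
      omega
    obtain ⟨i, -, hi⟩ := h4
    exact ⟨i, hE.eq_exceptional (by omega) hfin (h1.cuspidalEffective hd) h3 hi⟩
  mukaiForm_self := hD.mukaiForm_self
  mukaiForm_nonneg F hF hne :=
    hD.mukaiForm_nonneg (by omega) hfin
      (cremonaStable_cuspidalEffective (d := d) (exists_linearIndependent_int k)) F
      (hF.cuspidalEffective hd) (hF.intDegree_eq hd) hne

/-- Orbit membership passes along edges, starting from an exceptional class. -/
theorem isExtremal_of_mem_mukaiVertices (hd : 2 ≤ d) (hk : d + 2 ≤ k)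
    (hfin : (k : ℤ) * ((d : ℤ) - 1) < ((d : ℤ) + 1) ^ 2) {D : Cls ℤ k}
    (hD : D ∈ mukaiVertices k d) : IsExtremal k d D := by
  obtain ⟨i, -, hr⟩ := hD
  suffices h : CremonaOrbit k d D ∧ IsDegreeOne k d D from h.1.isExtremal hd hk hfin h.2
  rw [SimpleGraph.reachable_iff_reflTransGen] at hr
  induction hr with
  | refl => exact ⟨.exceptional i, isDegreeOne_exceptional hd i⟩
  | tail _ h ih =>
    obtain ⟨-, -, h2, h3⟩ := h
    exact ⟨ih.1.of_mukaiForm_eq_zero hd hk hfin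
      (cremonaStable_cuspidalEffective (d := d) (exists_linearIndependent_int k)) _
      (h2.cuspidalEffective hd) (h2.intDegree_eq hd) h3, h2⟩

end Extremal

/-! ### The multigraded structure of the Cox ring -/

section Grading

variable {k d : ℕ} {K : Type*} [Field K]

/-- A form that is nonnegative on all factors vanishes on the product only if it vanishes on each of
them. -/
theorem exists_class_of_mem_closure {P : Matrix (Fin (d + 1)) (Fin k) K} (l : Cls ℤ k →+ ℤ)
    (hl : ∀ F, IsDegreeOne k d F → 0 ≤ l F) {m : MvPolynomial (XY k) K}
    (hm : m ∈ Submonoid.closure {g | ∃ D, IsDegreeOne k d D ∧ IsCoxGenerator P D g}) :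
    ∃ W, IsWeightedHomogeneous (varClass k) m W ∧ 0 ≤ l W ∧ (l W = 0 →
      m ∈ Submonoid.closure {g | ∃ D, IsDegreeOne k d D ∧ l D = 0 ∧ IsCoxGenerator P D g}) := by
  induction hm using Submonoid.closure_induction with
  | mem g hg =>
    obtain ⟨D, hD, hg⟩ := hg
    exact ⟨D, hg.isWeightedHomogeneous, hl D hD, fun h => Submonoid.subset_closure ⟨D, hD, h, hg⟩⟩
  | one =>
    exact ⟨0, isWeightedHomogeneous_one _ _, (map_zero l).ge, fun _ => Submonoid.one_mem _⟩
  | mul g h _ _ hg hh =>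
    obtain ⟨W, h1, h2, h3⟩ := hg
    obtain ⟨W', h1', h2', h3'⟩ := hh
    refine ⟨W + W', h1.mul h1', ?_, fun h0 => ?_⟩
    · rw [map_add]; omega
    · rw [map_add] at h0
      exact Submonoid.mul_mem _ (h3 (by omega)) (h3' (by omega))

/-- Products of generators are multihomogeneous, so a component of f is a combination of the
products of its own class. -/
theorem component_mem_span {P : Matrix (Fin (d + 1)) (Fin k) K} (l : Cls ℤ k →+ ℤ)
    (hl : ∀ F, IsDegreeOne k d F → 0 ≤ l F) {f : MvPolynomial (XY k) K} (hf : f ∈ coxImage P)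
    {W : Cls ℤ k} (hW : weightedHomogeneousComponent (varClass k) W f ≠ 0) :
    0 ≤ l W ∧ (l W = 0 → weightedHomogeneousComponent (varClass k) W f ∈ Submodule.span K
      {m | IsWeightedHomogeneous (varClass k) m W ∧ m ∈ Submonoid.closure
        {g | ∃ D, IsDegreeOne k d D ∧ l D = 0 ∧ IsCoxGenerator P D g}}) := by
  classical
  have key : weightedHomogeneousComponent (varClass k) W f ∈ Submodule.span K
      {m | IsWeightedHomogeneous (varClass k) m W ∧ 0 ≤ l W ∧ (l W = 0 → m ∈ Submonoid.closure
        {g | ∃ D, IsDegreeOne k d D ∧ l D = 0 ∧ IsCoxGenerator P D g})} := by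
    have hf' : f ∈ Submodule.span K (Submonoid.closure
        {g | ∃ D, IsDegreeOne k d D ∧ IsCoxGenerator P D g} : Set (MvPolynomial (XY k) K)) := by
      rw [← Algebra.adjoin_eq_span]
      exact hf
    clear hW hf
    induction hf' using Submodule.span_induction with
    | mem m hm =>
      obtain ⟨W', h1, h2, h3⟩ := exists_class_of_mem_closure l hl hm
      rw [weightedHomogeneousComponent_of_mem (m := W)
        ((mem_weightedHomogeneousSubmodule _ _ _ _).2 h1)]
      split_ifs with h
      · subst h
        exact Submodule.subset_span ⟨h1, h2, h3⟩
      · exact Submodule.zero_mem _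
    | zero => rw [map_zero]; exact Submodule.zero_mem _
    | add f g _ _ hf hg => rw [map_add]; exact Submodule.add_mem _ hf hg
    | smul c f _ hf => rw [map_smul]; exact Submodule.smul_mem _ c hf
  constructor
  · by_contra h
    have : {m : MvPolynomial (XY k) K | IsWeightedHomogeneous (varClass k) m W ∧ 0 ≤ l W ∧
        (l W = 0 → m ∈ Submonoid.closure
        {g | ∃ D, IsDegreeOne k d D ∧ l D = 0 ∧ IsCoxGenerator P D g})} = ∅ :=
      Set.eq_empty_of_forall_notMem fun m hm => h hm.2.1
    rw [this, Submodule.span_empty, Submodule.mem_bot] at key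
    exact hW key
  · intro h
    refine Submodule.span_mono ?_ key
    exact fun m hm => ⟨hm.1, hm.2.2 h⟩

theorem exists_ne_zero_of_mem_span {M : Type*} [AddCommGroup M] [Module K M] {s : Set M} {x : M}
    (hx : x ∈ Submodule.span K s) (h0 : x ≠ 0) : ∃ y ∈ s, y ≠ 0 := by
  by_contra! h
  have : Submodule.span K s ≤ ⊥ := Submodule.span_le.2 fun y hy => h y hy
  exact h0 ((Submodule.mem_bot K).1 (this hx))

/-- The Cox ring vanishes in degree zero, except for the constants. -/
theorem eq_zero_of_intDegree_eq_zero (hd : 2 ≤ d) {P : Matrix (Fin (d + 1)) (Fin k) K}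
    {f : MvPolynomial (XY k) K} (hf : f ∈ coxImage P) {W : Cls ℤ k}
    (hW : weightedHomogeneousComponent (varClass k) W f ≠ 0) :
    0 ≤ intDegree d W ∧ (intDegree d W = 0 → W = 0) := by
  have h0 : ∀ F : Cls ℤ k, faceForm d 0 F = intDegree d F := fun F => by
    rw [faceForm_apply]; simp [mukaiForm]
  have h := component_mem_span (faceForm d (0 : Cls ℤ k)) (fun F hF => by
    rw [h0, hF.intDegree_eq hd]; exact zero_le_one) hf hW
  rw [h0] at h
  refine ⟨h.1, fun hz => ?_⟩
  obtain ⟨m, ⟨hm1, hm2⟩, hm0⟩ := exists_ne_zero_of_mem_span (h.2 hz) hW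
  -- Every generator has degree one, so only the empty product has degree zero.
  have hempty : {g : MvPolynomial (XY k) K | ∃ D, IsDegreeOne k d D ∧
      faceForm d (0 : Cls ℤ k) D = 0 ∧ IsCoxGenerator P D g} = ∅ :=
    Set.eq_empty_of_forall_notMem fun g ⟨D, h1, h2, _⟩ => by
      rw [h0, h1.intDegree_eq hd] at h2
      exact one_ne_zero h2
  rw [hempty, Submonoid.closure_empty, Submonoid.mem_bot] at hm2
  rw [hm2] at hm1
  exact hm1.inj_right one_ne_zero (isWeightedHomogeneous_one _ _)

/-- `g` spans the sections of `D`. -/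
def IsSpanningSection (P : Matrix (Fin (d + 1)) (Fin k) K) (D : Cls ℤ k)
    (g : MvPolynomial (XY k) K) : Prop :=
  g ≠ 0 ∧ IsCoxGenerator P D g ∧ ∀ g', IsCoxGenerator P D g' → ∃ c : K, g' = c • g

theorem coxSection_smul (P : Matrix (Fin (d + 1)) (Fin k) K) (D : Cls ℤ k) (c : K)
    (f : MvPolynomial (Fin (d + 1)) K) : coxSection P D (c • f) =
      algebraMap (MvPolynomial (XY k) K) (FractionRing (MvPolynomial (XY k) K)) (C c) *
        coxSection P D f := by
  rw [coxSection, coxSection, map_smul, Algebra.smul_def, ← algebraMap_eq,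
    ← IsScalarTower.algebraMap_apply, mul_assoc]

/-- General position settles m₀ > 0; in the remaining case D = Eᵢ the sections are constants and
give the multiples of xᵢ. -/
theorem IsExtremal.exists_isSpanningSection {P : Matrix (Fin (d + 1)) (Fin k) K}
    (hP : GeneralPosition P) {D : Cls ℤ k} (hD : IsExtremal k d D) :
    ∃ g, IsSpanningSection P D g := by
  have hinj : Function.Injective
      (algebraMap (MvPolynomial (XY k) K) (FractionRing (MvPolynomial (XY k) K))) :=
    IsFractionRing.injective _ _
  have h1 : Module.finrank K (linearSystem P D) = 1 ∧
      ∀ f ∈ linearSystem P D, f ≠ 0 → coxSection P D f ≠ 0 := by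
    rcases le_or_gt D.1 0 with h | h
    · obtain ⟨i, rfl⟩ := hD.eq_exceptional h
      refine ⟨finrank_linearSystem_exceptional P i, fun f hf h0 => ?_⟩
      rw [linearSystem_exceptional, Submodule.mem_span_singleton] at hf
      obtain ⟨c, rfl⟩ := hf
      have hc : c ≠ 0 := by rintro rfl; exact h0 (zero_smul _ _)
      have hne : ∀ q : MvPolynomial (XY k) K, q ≠ 0 → algebraMap (MvPolynomial (XY k) K)
          (FractionRing (MvPolynomial (XY k) K)) q ≠ 0 :=
        fun q hq h => hq (hinj (h.trans (map_zero _).symm))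
      rw [coxSection_smul, coxSection, map_one, one_mul]
      exact mul_ne_zero (hne _ (C_ne_zero.2 hc)) (Finset.prod_ne_zero_iff.2 fun j _ =>
        zpow_ne_zero _ (hne _ (X_ne_zero _)))
    · have h2 := hP.2 D hD.isDegreeOne h
      refine ⟨h2.1.trans (le_antisymm hD.h0_le hD.isDegreeOne.2), h2.2⟩
  obtain ⟨⟨f, hf⟩, hf0, hspan⟩ := finrank_eq_one_iff'.1 h1.1
  have hf0' : f ≠ 0 := fun h => hf0 (Subtype.ext h)
  obtain ⟨g, hg⟩ := exists_algebraMap_eq_coxSection hf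
  refine ⟨g, ?_, ⟨f, hf, hg⟩, ?_⟩
  · rintro rfl
    exact h1.2 f hf hf0' (hg.symm.trans (map_zero _))
  · rintro g' ⟨f', hf', hg'⟩
    obtain ⟨c, hc⟩ := hspan ⟨f', hf'⟩
    have hc' : c • f = f' := congrArg Subtype.val hc
    refine ⟨c, hinj ?_⟩
    rw [hg', ← hc', coxSection_smul, ← hg, ← map_mul, smul_eq_C_mul]

/-- The Cox ring in a multidegree on the face spanned by `D` and `E`. -/
theorem component_eq_of_faceForm_eq_zero (hd : 2 ≤ d) {P : Matrix (Fin (d + 1)) (Fin k) K}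
    {D E : Cls ℤ k} (hD : IsExtremal k d D) (hE : IsExtremal k d E)
    (hDE : D = E ∨ mukaiForm d D E = 0) {gD gE : MvPolynomial (XY k) K}
    (hgD : IsSpanningSection P D gD) (hgE : IsSpanningSection P E gE) (hg : D = E → gD = gE)
    {f : MvPolynomial (XY k) K} (hf : f ∈ coxImage P) {W : Cls ℤ k}
    (hW : weightedHomogeneousComponent (varClass k) W f ≠ 0) :
    0 ≤ faceForm d (faceClass D E) W ∧ (faceForm d (faceClass D E) W = 0 →
      ∃ (a b : ℕ) (c : K), W = a • D + b • E ∧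
        weightedHomogeneousComponent (varClass k) W f = c • (gD ^ a * gE ^ b)) := by
  obtain ⟨hl1, hl2, hl3⟩ := faceForm_faceClass hd hD hE hDE
  have h := component_mem_span (faceForm d (faceClass D E)) (fun F hF => by
    by_cases h1 : F = D
    · rw [h1, hl1]
    by_cases h2 : F = E
    · rw [h2, hl2]
    exact (hl3 F hF h1 h2).le) hf hW
  refine ⟨h.1, fun hz => ?_⟩
  have hmon : ∀ m ∈ Submonoid.closure {g | ∃ F, IsDegreeOne k d F ∧
      faceForm d (faceClass D E) F = 0 ∧ IsCoxGenerator P F g},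
      ∃ (a b : ℕ) (c : K), m = c • (gD ^ a * gE ^ b) := by
    intro m hm
    induction hm using Submonoid.closure_induction with
    | mem g hg =>
      obtain ⟨F, h1, h2, h3⟩ := hg
      by_cases hFD : F = D
      · subst hFD
        obtain ⟨c, hc⟩ := hgD.2.2 g h3
        exact ⟨1, 0, c, by rw [hc, pow_one, pow_zero, mul_one]⟩
      by_cases hFE : F = E
      · subst hFE
        obtain ⟨c, hc⟩ := hgE.2.2 g h3
        exact ⟨0, 1, c, by rw [hc, pow_one, pow_zero, one_mul]⟩
      exact absurd h2 (hl3 F h1 hFD hFE).ne'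
    | one => exact ⟨0, 0, 1, by simp⟩
    | mul g h _ _ hg hh =>
      obtain ⟨a, b, c, rfl⟩ := hg
      obtain ⟨a', b', c', rfl⟩ := hh
      refine ⟨a + a', b + b', c * c', ?_⟩
      simp only [smul_eq_C_mul, pow_add, C_mul]
      ring
  have hclass : ∀ a b : ℕ, IsWeightedHomogeneous (varClass k) (gD ^ a * gE ^ b)
      (a • D + b • E) := fun a b =>
    (hgD.2.1.isWeightedHomogeneous.pow a).mul (hgE.2.1.isWeightedHomogeneous.pow b)
  have hne : ∀ a b : ℕ, gD ^ a * gE ^ b ≠ 0 := fun a b =>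
    mul_ne_zero (pow_ne_zero _ hgD.1) (pow_ne_zero _ hgE.1)
  have hWeq : ∀ m, IsWeightedHomogeneous (varClass k) m W → m ≠ 0 → ∀ (a b : ℕ) (c : K),
      m = c • (gD ^ a * gE ^ b) → W = a • D + b • E := by
    intro m hm hm0 a b c hmc
    refine hm.inj_right hm0 ?_
    rw [hmc, smul_eq_C_mul]
    exact (hclass a b).C_mul c
  -- Pairing with D and E recovers a and b from the class; if D = E, the degree recovers a + b, and
  -- only that matters. So all products of class W span one line.
  have huniq : ∀ a b a' b' : ℕ, a • D + b • E = a' • D + b' • E →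
      gD ^ a * gE ^ b = gD ^ a' * gE ^ b' := by
    intro a b a' b' hab
    by_cases h1 : D = E
    · rw [← hg h1, ← pow_add, ← pow_add]
      congr 1
      have h2 := congrArg (intDegree d) hab
      simp only [intDegree_add, intDegree_nsmul, hD.isDegreeOne.intDegree_eq hd,
        hE.isDegreeOne.intDegree_eq hd] at h2
      omega
    · have h2 := hDE.resolve_left h1
      have h2' : mukaiForm d E D = 0 := by rw [mukaiForm_comm, h2]
      have h3 := congrArg (mukaiForm d D) hab
      have h4 := congrArg (mukaiForm d E) hab
      simp only [mukaiForm_add_right, mukaiForm_nsmul, hD.mukaiForm_self, hE.mukaiForm_self, h2,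
        h2'] at h3 h4
      rw [show a = a' by omega, show b = b' by omega]
  obtain ⟨m, ⟨hm1, hm2⟩, hm0⟩ := exists_ne_zero_of_mem_span (h.2 hz) hW
  obtain ⟨a, b, c, hmc⟩ := hmon m hm2
  have hWab := hWeq m hm1 hm0 a b c hmc
  have hle : Submodule.span K {m | IsWeightedHomogeneous (varClass k) m W ∧ m ∈ Submonoid.closure
        {g | ∃ F, IsDegreeOne k d F ∧ faceForm d (faceClass D E) F = 0 ∧
          IsCoxGenerator P F g}} ≤ Submodule.span K {gD ^ a * gE ^ b} := by
    refine Submodule.span_le.2 fun m' hm' => ?_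
    obtain ⟨a', b', c', hmc'⟩ := hmon m' hm'.2
    rw [SetLike.mem_coe, Submodule.mem_span_singleton]
    by_cases hm0' : m' = 0
    · exact ⟨0, by rw [hm0', zero_smul]⟩
    · refine ⟨c', ?_⟩
      rw [hmc', huniq a b a' b' (hWab.symm.trans (hWeq m' hm'.1 hm0' a' b' c' hmc'))]
  obtain ⟨c', hc'⟩ := Submodule.mem_span_singleton.1 (hle (h.2 hz))
  exact ⟨a, b, c', hWab, hc'.symm⟩

end Grading

/-! ### Exponents of Khovanskii bases -/

section Exponents

variable {k d : ℕ} {P : Matrix (Fin (d + 1)) (Fin k) (RatFunc ℂ)}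
  {F : Set (MvPolynomial (XY k) (RatFunc ℂ))}

/-- The exponents of the initial monomials of `F`. -/
def initialExponents {σ : Type*} (F : Set (MvPolynomial σ (RatFunc ℂ))) : Set (σ →₀ ℕ) :=
  {e | ∃ f ∈ F, e ∈ (initialForm f).support}

theorem exponents_eq_image {σ : Type*} (F : Set (MvPolynomial σ (RatFunc ℂ))) :
    exponents F = (fun (e : σ →₀ ℕ) s => (e s : ℤ)) '' initialExponents F := by
  ext v
  constructor
  · rintro ⟨f, hf, e, he, rfl⟩
    exact ⟨e, ⟨f, hf, he⟩, rfl⟩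
  · rintro ⟨e, ⟨f, hf, he⟩, rfl⟩
    exact ⟨f, hf, e, he, rfl⟩

theorem finite_initialExponents {σ : Type*} {F : Set (MvPolynomial σ (RatFunc ℂ))}
    (hF : F.Finite) : (initialExponents F).Finite := by
  have : initialExponents F = ⋃ f ∈ F, ((initialForm f).support : Set (σ →₀ ℕ)) := by
    ext e; simp [initialExponents]
  rw [this]
  exact hF.biUnion fun f _ => Finset.finite_toSet _

/-- Every initial exponent comes from a multihomogeneous element of the Cox ring. -/
theorem exists_component_of_mem_initialExponents (hF : IsKhovanskiiBasis (coxImage P) F)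
    {e : XY k →₀ ℕ} (he : e ∈ initialExponents F) :
    ∃ f ∈ coxImage P, ∃ c : ℂ, c ≠ 0 ∧ weightedHomogeneousComponent (varClass k)
        (Finsupp.weight (varClass k) e) f ≠ 0 ∧
      initialForm (weightedHomogeneousComponent (varClass k)
        (Finsupp.weight (varClass k) e) f) = monomial e c := by
  classical
  obtain ⟨f, hf, he⟩ := he
  obtain ⟨e', c, hc, hin⟩ := hF.2.1 f hf
  have hee : e = e' := by
    rw [hin, support_monomial, if_neg hc, Finset.mem_singleton] at he
    exact he
  subst hee
  -- Passing to the component that contains the initial monomial does not change the initial form.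
  have h1 : initialForm (weightedHomogeneousComponent (varClass k)
      (Finsupp.weight (varClass k) e) f) = monomial e c := by
    refine initialForm_eq_of_coeff hc hin ?_ fun a => ?_
    · rw [coeff_weightedHomogeneousComponent, if_pos rfl]
    · rw [coeff_weightedHomogeneousComponent]
      split_ifs
      · exact Or.inl rfl
      · exact Or.inr rfl
  refine ⟨f, hF.1 ▸ Algebra.subset_adjoin hf, c, hc, fun h0 => ?_, h1⟩
  rw [h0] at h1
  have : initialForm (0 : MvPolynomial (XY k) (RatFunc ℂ)) = 0 := by simp [initialForm]
  rw [this] at h1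
  exact hc (monomial_eq_zero.1 h1.symm)

theorem intDegree_nonneg_of_mem_initialExponents (hd : 2 ≤ d)
    (hF : IsKhovanskiiBasis (coxImage P) F) {e : XY k →₀ ℕ} (he : e ∈ initialExponents F) :
    0 ≤ intDegree d (Finsupp.weight (varClass k) e) ∧
      (intDegree d (Finsupp.weight (varClass k) e) = 0 → e = 0) := by
  obtain ⟨f, hf, c, -, h1, -⟩ := exists_component_of_mem_initialExponents hF he
  have h := eq_zero_of_intDegree_eq_zero hd hf h1
  exact ⟨h.1, fun h0 => (weight_eq_zero_iff e).1 (h.2 h0)⟩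

theorem mem_closure_of_mem_support {h : MvPolynomial (XY k) ℂ}
    (hh : h ∈ Algebra.adjoin ℂ (initialForm '' F)) {e : XY k →₀ ℕ} (he : e ∈ h.support) :
    e ∈ AddSubmonoid.closure (initialExponents F) := by
  classical
  induction hh using Algebra.adjoin_induction generalizing e with
  | mem h hh =>
    obtain ⟨f, hf, rfl⟩ := hh
    exact AddSubmonoid.subset_closure ⟨f, hf, he⟩
  | algebraMap r =>
    rw [algebraMap_eq, mem_support_iff, coeff_C] at he
    have : e = 0 := by
      by_contra h0
      exact he (if_neg (Ne.symm h0))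
    rw [this]
    exact AddSubmonoid.zero_mem _
  | add f g _ _ hf hg =>
    rcases Finset.mem_union.1 (support_add he) with h | h
    · exact hf h
    · exact hg h
  | mul f g _ _ hf hg =>
    obtain ⟨a, ha, b, hb, rfl⟩ := Finset.mem_add.1 (support_mul f g he)
    exact AddSubmonoid.add_mem _ (hf ha) (hg hb)

/-- Degrees are nonnegative and vanish only at 0, so an element of degree one cannot be a sum of two
nonzero ones. -/
theorem mem_initialExponents_of_mem_closure (hd : 2 ≤ d)
    (hF : IsKhovanskiiBasis (coxImage P) F) {e : XY k →₀ ℕ}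
    (he : e ∈ AddSubmonoid.closure (initialExponents F)) :
    0 ≤ intDegree d (Finsupp.weight (varClass k) e) ∧
      (intDegree d (Finsupp.weight (varClass k) e) = 0 → e = 0) ∧
      (intDegree d (Finsupp.weight (varClass k) e) = 1 → e ∈ initialExponents F) := by
  induction he using AddSubmonoid.closure_induction with
  | mem e he =>
    have h := intDegree_nonneg_of_mem_initialExponents hd hF he
    exact ⟨h.1, h.2, fun _ => he⟩
  | zero =>
    rw [map_zero]
    simp [intDegree]
  | add a b _ _ ha hb =>
    obtain ⟨ha1, ha2, ha3⟩ := ha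
    obtain ⟨hb1, hb2, hb3⟩ := hb
    rw [map_add, intDegree_add]
    refine ⟨by omega, fun h => ?_, fun h => ?_⟩
    · rw [ha2 (by omega), hb2 (by omega), add_zero]
    · rcases ha1.eq_or_lt with h1 | h1
      · rw [ha2 h1.symm, zero_add]
        exact hb3 (by omega)
      · rw [hb2 (by omega), add_zero]
        exact ha3 (by omega)

theorem mem_coxImage_of_isCoxGenerator {D : Cls ℤ k} (hD : IsDegreeOne k d D)
    {g : MvPolynomial (XY k) (RatFunc ℂ)} (hg : IsCoxGenerator P D g) : g ∈ coxImage P :=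
  Algebra.subset_adjoin ⟨D, hD, hg⟩

/-- The initial form of the section of an extremal divisor is a monomial. -/
theorem IsSpanningSection.exists_initialForm_eq (hd : 2 ≤ d)
    (hF : IsKhovanskiiBasis (coxImage P) F) {D : Cls ℤ k} (hD : IsExtremal k d D)
    {g : MvPolynomial (XY k) (RatFunc ℂ)} (hg : IsSpanningSection P D g) :
    ∃ e ∈ initialExponents F, Finsupp.weight (varClass k) e = D ∧
      ∃ c : ℂ, initialForm g = monomial e c := by
  have hgR := mem_coxImage_of_isCoxGenerator hD.isDegreeOne hg.2.1
  have h1 : initialForm g ∈ Algebra.adjoin ℂ (initialForm '' F) := by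
    rw [hF.2.2]
    exact Algebra.subset_adjoin ⟨g, hgR, rfl⟩
  obtain ⟨e, he⟩ := support_nonempty.2 (initialForm_ne_zero hg.1)
  have hw : Finsupp.weight (varClass k) e = D := by
    refine hg.2.1.isWeightedHomogeneous fun h0 => ?_
    rw [mem_support_iff, coeff_initialForm, h0, laurentCoeff_zero] at he
    exact he rfl
  have hdeg := hD.isDegreeOne.intDegree_eq hd
  have heV := (mem_initialExponents_of_mem_closure hd hF (mem_closure_of_mem_support h1 he)).2.2
    (by rw [hw, hdeg])
  refine ⟨e, heV, hw, ?_⟩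
  -- The exponent e is the initial exponent of a component of class D, and such a component is a
  -- multiple of g.
  obtain ⟨f, hf, c, hc, hne, hin⟩ := exists_component_of_mem_initialExponents hF heV
  rw [hw] at hne hin
  obtain ⟨a, b, c', hab, hcomp⟩ := (component_eq_of_faceForm_eq_zero hd hD hD (Or.inl rfl) hg hg
    (fun _ => rfl) hf hne).2 (faceForm_faceClass hd hD hD (Or.inl rfl)).1
  have h2 := congrArg (intDegree d) hab
  rw [intDegree_add, intDegree_nsmul, intDegree_nsmul, hdeg] at h2
  rw [← pow_add, show a + b = 1 by omega, pow_one] at hcomp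
  have hc' : c' ≠ 0 := by
    rintro rfl
    rw [zero_smul] at hcomp
    exact hne hcomp
  obtain ⟨c'', hc'', h3⟩ := initialForm_smul hc' hg.1
  rw [hcomp, h3] at hin
  refine ⟨c''⁻¹ * c, ?_⟩
  rw [← smul_eq_mul, ← smul_monomial, ← hin, smul_smul, inv_mul_cancel₀ hc'', one_smul]

/-- The points of the polytope that correspond to extremal divisors, and the faces that they
span. -/
theorem exists_vertexExponent (hd : 2 ≤ d) (hP : GeneralPosition P)
    (hF : IsKhovanskiiBasis (coxImage P) F) :
    ∃ p : Cls ℤ k → (XY k →₀ ℕ),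
      (∀ D, IsExtremal k d D → p D ∈ initialExponents F ∧
        Finsupp.weight (varClass k) (p D) = D) ∧
      ∀ D E, IsExtremal k d D → IsExtremal k d E → (D = E ∨ mukaiForm d D E = 0) →
        ∀ e ∈ initialExponents F,
          0 ≤ faceForm d (faceClass D E) (Finsupp.weight (varClass k) e) ∧
          (faceForm d (faceClass D E) (Finsupp.weight (varClass k) e) = 0 →
            ∃ a b : ℕ, e = a • p D + b • p E) := by
  classical
  have h1 : ∀ D, ∃ g : MvPolynomial (XY k) (RatFunc ℂ),
      IsExtremal k d D → IsSpanningSection P D g := fun D => by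
    by_cases h : IsExtremal k d D
    · obtain ⟨g, hg⟩ := h.exists_isSpanningSection hP
      exact ⟨g, fun _ => hg⟩
    · exact ⟨0, fun h' => absurd h' h⟩
  choose g hg using h1
  have h2 : ∀ D, ∃ e : XY k →₀ ℕ, IsExtremal k d D → e ∈ initialExponents F ∧
      Finsupp.weight (varClass k) e = D ∧ ∃ c : ℂ, initialForm (g D) = monomial e c := fun D => by
    by_cases h : IsExtremal k d D
    · obtain ⟨e, he⟩ := (hg D h).exists_initialForm_eq hd hF h
      exact ⟨e, fun _ => he⟩
    · exact ⟨0, fun h' => absurd h' h⟩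
  choose p hp using h2
  refine ⟨p, fun D hD => ⟨(hp D hD).1, (hp D hD).2.1⟩, fun D E hD hE hDE e he => ?_⟩
  obtain ⟨f, hf, c, hc, hne, hin⟩ := exists_component_of_mem_initialExponents hF he
  obtain ⟨h3, h4⟩ := component_eq_of_faceForm_eq_zero hd hD hE hDE (hg D hD) (hg E hE)
    (fun h => by rw [h]) hf hne
  refine ⟨h3, fun h0 => ?_⟩
  obtain ⟨a, b, c', -, hcomp⟩ := h4 h0
  refine ⟨a, b, ?_⟩
  have hc' : c' ≠ 0 := by
    rintro rfl
    rw [zero_smul] at hcomp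
    exact hne hcomp
  have hgD := (hg D hD).1
  have hgE := (hg E hE).1
  obtain ⟨c1, -, h5⟩ := initialForm_smul hc' (mul_ne_zero (pow_ne_zero a hgD) (pow_ne_zero b hgE))
  obtain ⟨c2, -, h6⟩ := initialForm_pow hgD a
  obtain ⟨c3, -, h7⟩ := initialForm_pow hgE b
  obtain ⟨-, -, cD, hcD⟩ := hp D hD
  obtain ⟨-, -, cE, hcE⟩ := hp E hE
  -- By multiplicativity, g_D ^ a g_E ^ b has initial exponent a p_D + b p_E.
  rw [hcomp, h5, initialForm_mul (pow_ne_zero a hgD) (pow_ne_zero b hgE), h6, h7, hcD, hcE,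
    monomial_pow, monomial_pow, smul_monomial, smul_monomial, monomial_mul, smul_monomial] at hin
  rcases (monomial_eq_monomial_iff _ _ _ _).1 hin with h | h
  · exact h.1.symm
  · exact absurd h.2 hc

end Exponents

/-! ### Faces of polytopes -/

section Convex

theorem isExposed_of_linearMap {ι : Type*} [Finite ι] {Q B : Set (ι → ℝ)} (l : (ι → ℝ) →ₗ[ℝ] ℝ)
    {c : ℝ} (hle : ∀ x ∈ Q, l x ≤ c) (hB : ∀ x, x ∈ B ↔ x ∈ Q ∧ l x = c) : IsExposed ℝ Q B := by
  have := Fintype.ofFinite ι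
  rintro ⟨b, hb⟩
  have hb' := (hB b).1 hb
  refine ⟨LinearMap.toContinuousLinearMap l, ?_⟩
  ext x
  rw [hB]
  constructor
  · rintro ⟨h1, h2⟩
    refine ⟨h1, fun y hy => ?_⟩
    simp only [LinearMap.coe_toContinuousLinearMap']
    rw [h2]
    exact hle y hy
  · rintro ⟨h1, h2⟩
    refine ⟨h1, le_antisymm (hle x h1) ?_⟩
    have := h2 b hb'.1
    simp only [LinearMap.coe_toContinuousLinearMap'] at this
    rwa [hb'.2] at this

theorem mem_exposedPoints_of_linearMap {ι : Type*} [Finite ι] {Q : Set (ι → ℝ)} {v : ι → ℝ}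
    (l : (ι → ℝ) →ₗ[ℝ] ℝ) (hv : v ∈ Q) (hle : ∀ x ∈ Q, l x ≤ l v)
    (heq : ∀ x ∈ Q, l x = l v → x = v) : v ∈ Q.exposedPoints ℝ := by
  have := Fintype.ofFinite ι
  refine ⟨hv, LinearMap.toContinuousLinearMap l, fun y hy => ?_⟩
  simp only [LinearMap.coe_toContinuousLinearMap']
  exact ⟨hle y hy, fun h => heq y hy (le_antisymm (hle y hy) h)⟩

/-- A proper convex combination attains the bound only if both of its points do. -/
theorem le_and_mem_convexHull_of_eq {E : Type*} [AddCommGroup E] [Module ℝ E] {A : Set E}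
    (l : E →ₗ[ℝ] ℝ) {c : ℝ} (hA : ∀ a ∈ A, l a ≤ c) {x : E} (hx : x ∈ convexHull ℝ A) :
    l x ≤ c ∧ (l x = c → x ∈ convexHull ℝ {a ∈ A | l a = c}) := by
  have hconv : Convex ℝ {x : E | l x ≤ c ∧ (l x = c → x ∈ convexHull ℝ {a ∈ A | l a = c})} := by
    rintro x ⟨hx1, hx2⟩ y ⟨hy1, hy2⟩ a b ha hb hab
    have hl : l (a • x + b • y) = a * l x + b * l y := by simp
    have h1 := mul_le_mul_of_nonneg_left hx1 ha
    have h2 := mul_le_mul_of_nonneg_left hy1 hb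
    have h3 : a * c + b * c = c := by rw [← add_mul, hab, one_mul]
    refine ⟨?_, fun h => ?_⟩
    · rw [hl]
      linarith
    · rw [hl] at h
      rcases ha.eq_or_lt with ha0 | ha0
      · subst ha0
        rw [zero_add] at hab
        subst hab
        rw [zero_smul, zero_add, one_smul]
        exact hy2 (by linarith)
      rcases hb.eq_or_lt with hb0 | hb0
      · subst hb0
        rw [add_zero] at hab
        subst hab
        rw [zero_smul, add_zero, one_smul]
        exact hx2 (by linarith)
      refine convex_convexHull ℝ _ (hx2 ?_) (hy2 ?_) ha hb hab
      · exact mul_left_cancel₀ ha0.ne' (by linarith)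
      · exact mul_left_cancel₀ hb0.ne' (by linarith)
  refine convexHull_min ?_ hconv hx
  intro a ha
  exact ⟨hA a ha, fun h => subset_convexHull ℝ _ ⟨ha, h⟩⟩

/-- Every vertex of a polytope that is not a point lies on an edge. -/
theorem exists_exposed_segment {ι : Type*} [Fintype ι] {A : Set (ι → ℝ)} (hA : A.Finite)
    {v : ι → ℝ} (hv : v ∈ (convexHull ℝ A).exposedPoints ℝ)
    (hne : ∃ w ∈ convexHull ℝ A, w ≠ v) :
    ∃ w ∈ (convexHull ℝ A).exposedPoints ℝ, v ≠ w ∧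
      IsExposed ℝ (convexHull ℝ A) (segment ℝ v w) := by
  have hvA : v ∈ A := extremePoints_convexHull_subset (exposedPoints_subset_extremePoints hv)
  obtain ⟨-, l, hl⟩ := hv
  have hlt : ∀ a ∈ A, a ≠ v → 0 < l v - l a := fun a ha hav => by
    have h := hl a (subset_convexHull ℝ A ha)
    by_contra! h'
    exact hav (h.2 (by linarith))
  have hA' : (A \ {v}).Nonempty := by
    by_contra h
    rw [Set.not_nonempty_iff_eq_empty, Set.sdiff_eq_empty] at h
    obtain ⟨w, hw, hwv⟩ := hne
    have := convexHull_mono h hw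
    rw [convexHull_singleton] at this
    exact hwv this
  -- The vertex figure at v: each a is scaled along its ray from v to the hyperplane where l has
  -- dropped by one. The point u₀ of largest norm is a vertex of it, exposed by the scalar product
  -- with u₀.
  let u : (ι → ℝ) → (ι → ℝ) := fun a => (l v - l a)⁻¹ • (a - v)
  obtain ⟨a₀, ha₀, hmax⟩ := Set.exists_max_image (A \ {v}) (fun a => u a ⬝ᵥ u a)
    (hA.subset Set.sdiff_subset) hA'
  set u₀ := u a₀ with hu₀
  let g : (ι → ℝ) →ₗ[ℝ] ℝ := (dotProductBilin ℝ ℝ).flip u₀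
  have hg : ∀ x, g x = x ⬝ᵥ u₀ := fun x => rfl
  set N := u₀ ⬝ᵥ u₀ with hN
  have hu : ∀ a ∈ A, a ≠ v → a = v + (l v - l a) • u a := fun a ha hav => by
    simp only [u]
    rw [smul_smul, mul_inv_cancel₀ (hlt a ha hav).ne', one_smul, add_sub_cancel]
  have hgu : ∀ a ∈ A, a ≠ v → g (u a) ≤ N ∧ (g (u a) = N → u a = u₀) := by
    intro a ha hav
    have h1 := hmax a ⟨ha, hav⟩
    have h2 : (u a - u₀) ⬝ᵥ (u a - u₀) = u a ⬝ᵥ u a - 2 * g (u a) + N := by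
      rw [hg, sub_dotProduct, dotProduct_sub, dotProduct_sub, dotProduct_comm u₀ (u a)]
      ring
    have h3 : 0 ≤ (u a - u₀) ⬝ᵥ (u a - u₀) :=
      Finset.sum_nonneg fun i _ => mul_self_nonneg _
    have h1' : u a ⬝ᵥ u a ≤ N := h1
    refine ⟨by linarith, fun h => ?_⟩
    have h4 : (u a - u₀) ⬝ᵥ (u a - u₀) = 0 := by linarith
    exact sub_eq_zero.1 (dotProduct_self_eq_zero.1 h4)
  -- Several points of A may lie on the ray of u₀; the farthest is the other end of the edge.
  obtain ⟨w, ⟨⟨hwA, hwv⟩, hwu⟩, hwmax⟩ := Set.exists_max_image {a ∈ A \ {v} | u a = u₀}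
    (fun a => l v - l a) ((hA.subset Set.sdiff_subset).subset (Set.sep_subset _ _)) ⟨a₀, ha₀, rfl⟩
  have hwv' : w ≠ v := hwv
  have hw0 := hlt w hwA hwv'
  -- Adding N l makes g constant along the ray of u₀, and smaller on all other rays.
  let φ : (ι → ℝ) →ₗ[ℝ] ℝ := g + N • (l : (ι → ℝ) →ₗ[ℝ] ℝ)
  have hφ : ∀ a ∈ A, a ≠ v → φ a = φ v + (l v - l a) * (g (u a) - N) := by
    intro a ha hav
    have h1 : g a = g v + (l v - l a) * g (u a) := by
      conv_lhs => rw [hu a ha hav]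
      simp
    simp only [φ, LinearMap.add_apply, LinearMap.smul_apply, smul_eq_mul, h1,
      ContinuousLinearMap.coe_coe]
    ring
  have hφle : ∀ a ∈ A, φ a ≤ φ v := fun a ha => by
    by_cases hav : a = v
    · rw [hav]
    rw [hφ a ha hav]
    have := mul_nonneg (hlt a ha hav).le (sub_nonneg.2 (hgu a ha hav).1)
    linarith
  have hφw : φ w = φ v := by
    rw [hφ w hwA hwv', hwu, hg, ← hN, sub_self, mul_zero, add_zero]
  have hseg : ∀ a ∈ A, φ a = φ v → a ∈ segment ℝ v w := by
    intro a ha h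
    by_cases hav : a = v
    · rw [hav]; exact left_mem_segment ℝ v w
    have hpos := hlt a ha hav
    have h1 : u a = u₀ := by
      refine (hgu a ha hav).2 ?_
      rw [hφ a ha hav] at h
      have h2 : (l v - l a) * (g (u a) - N) = 0 := by linarith
      exact sub_eq_zero.1 ((mul_eq_zero.1 h2).resolve_left hpos.ne')
    have h2 : l v - l a ≤ l v - l w := hwmax a ⟨⟨ha, hav⟩, h1⟩
    rw [segment_eq_image']
    refine ⟨(l v - l a) / (l v - l w), ⟨div_nonneg hpos.le hw0.le, (div_le_one hw0).2 h2⟩, ?_⟩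
    have h3 : w - v = (l v - l w) • u₀ := by
      conv_lhs => rw [hu w hwA hwv', hwu]
      rw [add_sub_cancel_left]
    simp only
    rw [h3, smul_smul, div_mul_cancel₀ _ hw0.ne', ← h1]
    exact (hu a ha hav).symm
  refine ⟨w, ?_, hwv'.symm, ?_⟩
  -- Here ε is a gap between N and the values of g at the other points of the vertex figure; tilting
  -- φ by -ε l then singles out w.
  · obtain ⟨ε, hε, hεle⟩ : ∃ ε > 0, ∀ a ∈ A, a ≠ v → u a ≠ u₀ → ε ≤ N - g (u a) := by
      by_cases hemp : {a ∈ A \ {v} | u a ≠ u₀}.Nonempty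
      · obtain ⟨b, ⟨⟨hbA, hbv⟩, hbu⟩, hbmin⟩ := Set.exists_min_image {a ∈ A \ {v} | u a ≠ u₀}
          (fun a => N - g (u a)) ((hA.subset Set.sdiff_subset).subset (Set.sep_subset _ _)) hemp
        refine ⟨N - g (u b), ?_, fun a ha hav hau => hbmin a ⟨⟨ha, hav⟩, hau⟩⟩
        have h1 := hgu b hbA hbv
        exact sub_pos.2 (lt_of_le_of_ne h1.1 fun h => hbu (h1.2 h))
      · exact ⟨1, one_pos, fun a ha hav hau => absurd ⟨a, ⟨ha, hav⟩, hau⟩ hemp⟩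
    let ψ : (ι → ℝ) →ₗ[ℝ] ℝ := φ - ε • (l : (ι → ℝ) →ₗ[ℝ] ℝ)
    have hψ' : ∀ x, ψ x = φ x - ε * l x := fun x => rfl
    have hψ : ∀ a ∈ A, ψ a ≤ ψ w ∧ (ψ a = ψ w → a = w) := by
      intro a ha
      rw [hψ', hψ', hφw]
      by_cases hav : a = v
      · subst hav
        have := mul_pos hε hw0
        exact ⟨by linarith, fun h => absurd h (by linarith)⟩
      have hpos := hlt a ha hav
      by_cases hau : u a = u₀
      · have h1 : φ a = φ v := by
          rw [hφ a ha hav, hau, hg, ← hN, sub_self, mul_zero, add_zero]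
        have h2 : l v - l a ≤ l v - l w := hwmax a ⟨⟨ha, hav⟩, hau⟩
        rw [h1]
        refine ⟨by nlinarith, fun h => ?_⟩
        have h3 : l a = l w := mul_left_cancel₀ hε.ne' (by linarith)
        rw [hu a ha hav, hu w hwA hwv', hau, hwu, h3]
      · have h1 := hεle a ha hav hau
        have h2 := mul_le_mul_of_nonneg_left h1 hpos.le
        have h3 := mul_pos hε hw0
        rw [hφ a ha hav]
        exact ⟨by linarith, fun h => absurd h (by linarith)⟩
    refine mem_exposedPoints_of_linearMap ψ (subset_convexHull ℝ A hwA)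
      (fun x hx => (le_and_mem_convexHull_of_eq ψ (fun a ha => (hψ a ha).1) hx).1)
      fun x hx h => ?_
    have h1 := (le_and_mem_convexHull_of_eq ψ (fun a ha => (hψ a ha).1) hx).2 h
    have h2 : {a ∈ A | ψ a = ψ w} ⊆ {w} := fun a ha => (hψ a ha.1).2 ha.2
    have h3 := convexHull_mono h2 h1
    rwa [convexHull_singleton] at h3
  · refine isExposed_of_linearMap φ
      (fun x hx => (le_and_mem_convexHull_of_eq φ hφle hx).1) fun x => ⟨fun hx => ⟨?_, ?_⟩, ?_⟩
    · exact (convex_convexHull ℝ A).segment_subset (subset_convexHull ℝ A hvA)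
        (subset_convexHull ℝ A hwA) hx
    · obtain ⟨a, b, -, -, hab, rfl⟩ := hx
      rw [map_add, map_smul, map_smul, hφw, ← add_smul, hab, one_smul]
    · rintro ⟨hx, h⟩
      exact convexHull_min (fun a ha => hseg a ha.1 ha.2) (convex_segment v w)
        ((le_and_mem_convexHull_of_eq φ hφle hx).2 h)

/-- A slice of a polyhedral cone is a polytope. -/
theorem slice_hull_eq_convexHull {E : Type*} [AddCommGroup E] [Module ℝ E] {V : Set E}
    (l : E →ₗ[ℝ] ℝ) (hl : ∀ v ∈ V, v = 0 ∨ 0 < l v) :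
    {x | x ∈ PointedCone.hull ℝ V ∧ l x = 1} =
      convexHull ℝ ((fun v => (l v)⁻¹ • v) '' {v ∈ V | v ≠ 0}) := by
  set T := convexHull ℝ ((fun v => (l v)⁻¹ • v) '' {v ∈ V | v ≠ 0}) with hT
  apply Set.Subset.antisymm
  · have key : ∀ x ∈ PointedCone.hull ℝ V, x = 0 ∨ 0 < l x ∧ (l x)⁻¹ • x ∈ T := by
      intro x hx
      induction hx using Submodule.span_induction with
      | mem v hv =>
        by_cases h0 : v = 0
        · exact Or.inl h0
        · exact Or.inr ⟨(hl v hv).resolve_left h0, subset_convexHull ℝ _ ⟨v, ⟨hv, h0⟩, rfl⟩⟩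
      | zero => exact Or.inl rfl
      | add x y _ _ hx hy =>
        rcases hx with rfl | ⟨hx1, hx2⟩
        · rwa [zero_add]
        rcases hy with rfl | ⟨hy1, hy2⟩
        · rw [add_zero]; exact Or.inr ⟨hx1, hx2⟩
        refine Or.inr ⟨by rw [map_add]; positivity, ?_⟩
        have h1 : (l (x + y))⁻¹ • (x + y) = (l x / (l x + l y)) • ((l x)⁻¹ • x) +
            (l y / (l x + l y)) • ((l y)⁻¹ • y) := by
          rw [map_add, smul_smul, smul_smul, smul_add]
          congr 2 <;> field_simp
        rw [h1]
        exact convex_convexHull ℝ _ hx2 hy2 (by positivity) (by positivity) (by field_simp)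
      | smul r x _ hx =>
        rcases hx with rfl | ⟨hx1, hx2⟩
        · exact Or.inl (smul_zero r)
        rcases r.2.eq_or_lt with h0 | h0
        · left
          change (r : ℝ) • x = 0
          rw [← h0, zero_smul]
        · right
          have h0' : 0 < (r : ℝ) := h0
          have h1 : l (r • x) = r * l x := by
            change l ((r : ℝ) • x) = _
            rw [map_smul, smul_eq_mul]
          rw [h1]
          refine ⟨mul_pos h0' hx1, ?_⟩
          change ((r : ℝ) * l x)⁻¹ • (r : ℝ) • x ∈ T
          rw [smul_smul, mul_inv, mul_comm, mul_inv_cancel_left₀ h0'.ne']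
          exact hx2
    rintro x ⟨hx, hx1⟩
    rcases key x hx with rfl | ⟨-, h⟩
    · rw [map_zero] at hx1
      exact absurd hx1 zero_ne_one
    · rwa [hx1, inv_one, one_smul] at h
  · refine convexHull_min ?_ ?_
    · rintro _ ⟨v, ⟨hv, h0⟩, rfl⟩
      have hpos := (hl v hv).resolve_left h0
      refine ⟨?_, ?_⟩
      · have h1 := (PointedCone.hull ℝ V).smul_mem (inv_pos.2 hpos).le
          (Submodule.subset_span hv)
        exact h1
      · simp only
        rw [map_smul, smul_eq_mul, inv_mul_cancel₀ hpos.ne']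
    · rintro x ⟨hx, hx1⟩ y ⟨hy, hy1⟩ a b ha hb hab
      refine ⟨?_, ?_⟩
      · exact (PointedCone.hull ℝ V).add_mem
          ((PointedCone.hull ℝ V).smul_mem ha hx)
          ((PointedCone.hull ℝ V).smul_mem hb hy)
      · rw [map_add, map_smul, map_smul, hx1, hy1, smul_eq_mul, smul_eq_mul, mul_one, mul_one, hab]

/-- The face l = 0 of a cone with l ≥ 0 is spanned by the generators on it. -/
theorem nonneg_and_eq_of_mem_hull {E : Type*} [AddCommGroup E] [Module ℝ E] {V : Set E}
    (l : E →ₗ[ℝ] ℝ) {p q : E}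
    (h : ∀ v ∈ V, 0 ≤ l v ∧ (l v = 0 → ∃ a b : ℝ, 0 ≤ a ∧ 0 ≤ b ∧ v = a • p + b • q)) {x : E}
    (hx : x ∈ PointedCone.hull ℝ V) :
    0 ≤ l x ∧ (l x = 0 → ∃ a b : ℝ, 0 ≤ a ∧ 0 ≤ b ∧ x = a • p + b • q) := by
  induction hx using Submodule.span_induction with
  | mem v hv => exact h v hv
  | zero => exact ⟨(map_zero l).ge, fun _ => ⟨0, 0, le_rfl, le_rfl, by simp⟩⟩
  | add x y _ _ hx hy =>
    rw [map_add]
    refine ⟨add_nonneg hx.1 hy.1, fun h0 => ?_⟩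
    obtain ⟨a, b, ha, hb, h1⟩ := hx.2 (by linarith [hx.1, hy.1])
    obtain ⟨a', b', ha', hb', h1'⟩ := hy.2 (by linarith [hx.1, hy.1])
    exact ⟨a + a', b + b', add_nonneg ha ha', add_nonneg hb hb', by rw [h1, h1']; module⟩
  | smul r x _ hx =>
    have h1 : l (r • x) = r * l x := by
      change l ((r : ℝ) • x) = _
      rw [map_smul, smul_eq_mul]
    have hr : 0 ≤ (r : ℝ) := r.2
    rw [h1]
    refine ⟨mul_nonneg hr hx.1, fun h0 => ?_⟩
    rcases mul_eq_zero.1 h0 with h2 | h2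
    · refine ⟨0, 0, le_rfl, le_rfl, ?_⟩
      change (r : ℝ) • x = _
      rw [h2]; simp
    · obtain ⟨a, b, ha, hb, h3⟩ := hx.2 h2
      refine ⟨r * a, r * b, mul_nonneg hr ha, mul_nonneg hr hb, ?_⟩
      change (r : ℝ) • x = _
      rw [h3]; module

end Convex

/-! ### Faces of Khovanskii degeneration polytopes -/

section Polytope

variable {k d : ℕ}

theorem multidegree_add {A : Type*} [CommRing A] (v w : XY k → A) :
    multidegree (v + w) = multidegree v + multidegree w := by
  refine Prod.ext ?_ (funext fun i => ?_)
  · simp [multidegree, Finset.sum_add_distrib]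
  · simp only [multidegree, Pi.add_apply, Finset.sum_add_distrib, Prod.snd_add]
    ring

theorem multidegree_smul {A : Type*} [CommRing A] (c : A) (v : XY k → A) :
    multidegree (c • v) = c • multidegree v := by
  refine Prod.ext ?_ (funext fun i => ?_)
  · simp [multidegree, Finset.mul_sum]
  · simp only [multidegree, Pi.smul_apply, smul_eq_mul, ← Finset.mul_sum, Prod.smul_snd]
    ring

/-- The real version of `faceForm`, on exponent vectors. -/
def realFaceForm (d : ℕ) (C : Cls ℤ k) : (XY k → ℝ) →ₗ[ℝ] ℝ where
  toFun v := mukaiForm d (C.cast ℝ) (multidegree v) + anticanonicalDegree d (multidegree v)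
  map_add' v w := by
    rw [multidegree_add]
    simp only [anticanonicalDegree, mukaiForm, Prod.fst_add, Prod.snd_add, Pi.add_apply, mul_add,
      Finset.sum_add_distrib]
    ring
  map_smul' c v := by
    rw [multidegree_smul]
    simp only [anticanonicalDegree, mukaiForm, Prod.smul_fst, Prod.smul_snd, Pi.smul_apply,
      smul_eq_mul, mul_left_comm _ c, ← Finset.mul_sum, RingHom.id_apply]
    ring

theorem realFaceForm_apply (C : Cls ℤ k) (v : XY k → ℝ) : realFaceForm d C v =
    mukaiForm d (C.cast ℝ) (multidegree v) + anticanonicalDegree d (multidegree v) := rfl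

theorem realFaceForm_zero (v : XY k → ℝ) :
    realFaceForm d 0 v = anticanonicalDegree d (multidegree v) := by
  rw [realFaceForm_apply]
  simp [mukaiForm, Cls.cast]

theorem realFaceForm_of_multidegree_eq (hd : 2 ≤ d) (C : Cls ℤ k) {v : XY k → ℝ} {D : Cls ℤ k}
    (h : multidegree v = D.cast ℝ) : realFaceForm d C v = (faceForm d C D : ℝ) := by
  have hd' : (d : ℝ) - 1 ≠ 0 := by
    have : (2 : ℝ) ≤ d := by exact_mod_cast hd
    linarith
  rw [realFaceForm_apply, h, anticanonicalDegree_cast hd', faceForm_apply]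
  simp [mukaiForm, Cls.cast]

/-- An exponent vector as a point of the polytope. -/
def realExponent (e : XY k →₀ ℕ) : XY k → ℝ := fun s => (e s : ℝ)

theorem multidegree_realExponent (e : XY k →₀ ℕ) :
    multidegree (realExponent e) = (Finsupp.weight (varClass k) e).cast ℝ := by
  rw [weight_varClass]
  refine Prod.ext ?_ (funext fun i => ?_) <;> simp [multidegree, realExponent, Cls.cast]

theorem slicePolytope_exponents (F : Set (MvPolynomial (XY k) (RatFunc ℂ))) :
    slicePolytope d (exponents F) =
      {x | x ∈ PointedCone.hull ℝ (realExponent '' initialExponents F) ∧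
      realFaceForm d 0 x = 1} := by
  have h : (fun (w : XY k → ℤ) (s : XY k) => (w s : ℝ)) '' exponents F =
      realExponent '' initialExponents F := by
    rw [exponents_eq_image, Set.image_image]
    refine Set.image_congr fun e _ => ?_
    funext s
    simp [realExponent]
  rw [slicePolytope, h]
  simp only [realFaceForm_zero]

/-- The geometry of a Khovanskii degeneration polytope over the faces spanned by extremal
divisors. -/
theorem IsKDPolytope.exists_vertices (hd : 2 ≤ d) {Q : Set (XY k → ℝ)} (hQ : IsKDPolytope k d Q) :
    (∃ A : Set (XY k → ℝ), A.Finite ∧ Q = convexHull ℝ A) ∧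
    ∃ p : Cls ℤ k → XY k → ℝ,
      (∀ D, IsExtremal k d D → p D ∈ Q ∧ multidegree (p D) = D.cast ℝ) ∧
      ∀ D E, IsExtremal k d D → IsExtremal k d E → (D = E ∨ mukaiForm d D E = 0) → ∀ x ∈ Q,
        0 ≤ realFaceForm d (faceClass D E) x ∧
        (realFaceForm d (faceClass D E) x = 0 → x ∈ segment ℝ (p D) (p E)) := by
  obtain ⟨P, hP, F, hFfin, hF, -, rfl⟩ := hQ
  rw [slicePolytope_exponents]
  have hval : ∀ (C : Cls ℤ k) (e : XY k →₀ ℕ), realFaceForm d C (realExponent e) =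
      (faceForm d C (Finsupp.weight (varClass k) e) : ℝ) := fun C e =>
    realFaceForm_of_multidegree_eq hd C (multidegree_realExponent e)
  have hdeg : ∀ D : Cls ℤ k, faceForm d 0 D = intDegree d D := fun D => by
    rw [faceForm_apply]; simp [mukaiForm]
  refine ⟨⟨_, ?_, slice_hull_eq_convexHull _ ?_⟩, ?_⟩
  · exact (((finite_initialExponents hFfin).image _).subset (Set.sep_subset _ _)).image _
  · rintro _ ⟨e, he, rfl⟩
    obtain ⟨h1, h2⟩ := intDegree_nonneg_of_mem_initialExponents hd hF he
    rcases h1.eq_or_lt with h0 | h0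
    · left
      rw [h2 h0.symm]
      funext s
      simp [realExponent]
    · right
      rw [hval, hdeg]
      exact_mod_cast h0
  · obtain ⟨p, hp, hface⟩ := exists_vertexExponent hd hP hF
    have hp1 : ∀ D, IsExtremal k d D → realFaceForm d 0 (realExponent (p D)) = 1 :=
      fun D hD => by
        rw [hval, (hp D hD).2, hdeg, hD.isDegreeOne.intDegree_eq hd, Int.cast_one]
    refine ⟨fun D => realExponent (p D),
      fun D hD => ⟨⟨Submodule.subset_span ⟨p D, (hp D hD).1, rfl⟩,
      hp1 D hD⟩, by rw [multidegree_realExponent, (hp D hD).2]⟩, ?_⟩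
    rintro D E hD hE hDE x ⟨hx, hx1⟩
    have h := nonneg_and_eq_of_mem_hull (realFaceForm d (faceClass D E)) (p := realExponent (p D))
      (q := realExponent (p E)) (fun v hv => by
        obtain ⟨e, he, rfl⟩ := hv
        obtain ⟨h1, h2⟩ := hface D E hD hE hDE e he
        rw [hval]
        refine ⟨by exact_mod_cast h1, fun h0 => ?_⟩
        obtain ⟨a, b, rfl⟩ := h2 (by exact_mod_cast h0)
        refine ⟨a, b, by positivity, by positivity, ?_⟩
        funext s
        simp [realExponent]) hx
    refine ⟨h.1, fun h0 => ?_⟩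
    obtain ⟨a, b, ha, hb, rfl⟩ := h.2 h0
    -- Degree one of x says a + b = 1, which turns the cone over the two points into the segment.
    rw [map_add, map_smul, map_smul, hp1 D hD, hp1 E hE, smul_eq_mul, smul_eq_mul, mul_one,
      mul_one] at hx1
    exact ⟨a, b, ha, hb, hx1, rfl⟩

theorem cast_injective : Function.Injective (Cls.cast ℝ : Cls ℤ k → Cls ℝ k) := by
  intro D E h
  refine Prod.ext ?_ (funext fun i => ?_)
  · exact Int.cast_injective (α := ℝ) (congrArg Prod.fst h)
  · exact Int.cast_injective (α := ℝ) (congrFun (congrArg Prod.snd h) i)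

/-- The form of D alone exposes a point and that of an orthogonal pair a segment. A point of
multidegree D is a zero of the form of D, hence equal to P_D. -/
theorem IsKDPolytope.exists_hom (hd : 2 ≤ d) (hk : d + 2 ≤ k)
    (hfin : (k : ℤ) * ((d : ℤ) - 1) < ((d : ℤ) + 1) ^ 2) {Q : Set (XY k → ℝ)}
    (hQ : IsKDPolytope k d Q) :
    ∃ ι : mukaiEdgeGraph k d →g vertexEdgeGraph Q, Function.Injective ι ∧
      ∀ (D : mukaiVertices k d), ∀ v ∈ Q,
        multidegree v = (D : Cls ℤ k).cast ℝ ↔ v = (ι D : XY k → ℝ) := by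
  obtain ⟨-, p, hp, hface⟩ := hQ.exists_vertices hd
  have hM : ∀ D : mukaiVertices k d, IsExtremal k d D := fun D =>
    isExtremal_of_mem_mukaiVertices hd hk hfin D.2
  have hzero : ∀ D E : mukaiVertices k d, (D.1 = E.1 ∨ mukaiForm d D.1 E.1 = 0) →
      (∀ v, multidegree v = D.1.cast ℝ → realFaceForm d (faceClass D.1 E.1) v = 0) ∧
      ∀ v, multidegree v = E.1.cast ℝ → realFaceForm d (faceClass D.1 E.1) v = 0 := by
    intro D E hDE
    obtain ⟨h1, h2, -⟩ := faceForm_faceClass hd (hM D) (hM E) hDE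
    refine ⟨fun v hv => ?_, fun v hv => ?_⟩
    · rw [realFaceForm_of_multidegree_eq hd _ hv, h1, Int.cast_zero]
    · rw [realFaceForm_of_multidegree_eq hd _ hv, h2, Int.cast_zero]
  have hpt : ∀ D : mukaiVertices k d, ∀ x ∈ Q, realFaceForm d (faceClass D.1 D.1) x = 0 →
      x = p D.1 := fun D x hx h => by
    have := (hface D.1 D.1 (hM D) (hM D) (Or.inl rfl) x hx).2 h
    rwa [segment_same] at this
  have hexp : ∀ D : mukaiVertices k d, p D.1 ∈ Q.exposedPoints ℝ := by
    intro D
    have h0 := (hzero D D (Or.inl rfl)).1 _ (hp D.1 (hM D)).2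
    refine mem_exposedPoints_of_linearMap (-realFaceForm d (faceClass D.1 D.1)) (hp D.1 (hM D)).1
      (fun x hx => ?_) fun x hx h => ?_
    · rw [LinearMap.neg_apply, LinearMap.neg_apply, h0]
      exact neg_le_neg (hface D.1 D.1 (hM D) (hM D) (Or.inl rfl) x hx).1
    · rw [LinearMap.neg_apply, LinearMap.neg_apply, h0] at h
      exact hpt D x hx (neg_inj.1 h)
  have hinj : ∀ D E : mukaiVertices k d, p D.1 = p E.1 → D = E := fun D E h => by
    refine Subtype.ext (cast_injective ?_)
    rw [← (hp D.1 (hM D)).2, ← (hp E.1 (hM E)).2, h]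
  refine ⟨⟨fun D => ⟨p D.1, hexp D⟩, ?_⟩, fun D E h => hinj D E (congrArg Subtype.val h),
    fun D v hv => ⟨fun h => hpt D v hv ((hzero D D (Or.inl rfl)).1 v h), fun h => ?_⟩⟩
  · rintro D E ⟨hne, -, -, h0⟩
    have h0' : mukaiForm d D.1 E.1 = 0 := h0
    refine ⟨fun h => hne ?_, ?_⟩
    · exact congrArg Subtype.val (hinj D E (congrArg Subtype.val h))
    obtain ⟨hz1, hz2⟩ := hzero D E (Or.inr h0')
    have hQc : ∀ x ∈ Q, 0 ≤ realFaceForm d (faceClass D.1 E.1) x ∧ _ :=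
      hface D.1 E.1 (hM D) (hM E) (Or.inr h0')
    have hconv : Convex ℝ Q := by
      obtain ⟨⟨A, -, hA⟩, -⟩ := hQ.exists_vertices hd
      rw [hA]
      exact convex_convexHull ℝ A
    refine isExposed_of_linearMap (-realFaceForm d (faceClass D.1 E.1)) (c := 0)
      (fun x hx => ?_) fun x => ⟨fun hx => ⟨?_, ?_⟩, ?_⟩
    · rw [LinearMap.neg_apply]
      exact neg_nonpos.2 (hQc x hx).1
    · exact hconv.segment_subset (hp D.1 (hM D)).1 (hp E.1 (hM E)).1 hx
    · obtain ⟨a, b, -, -, -, rfl⟩ := hx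
      rw [LinearMap.neg_apply, map_add, map_smul, map_smul, hz1 _ (hp D.1 (hM D)).2,
        hz2 _ (hp E.1 (hM E)).2, smul_zero, smul_zero, add_zero, neg_zero]
    · rintro ⟨hx, h⟩
      rw [LinearMap.neg_apply, neg_eq_zero] at h
      exact (hQc x hx).2 h
  · subst h
    exact (hp D.1 (hM D)).2

/-! ### Edge counts and the case of equality. -/

/-- The Mukai edge graph has an edge. -/
theorem exists_ne_mukaiVertices (hd : 2 ≤ d) (hk : d + 2 ≤ k) :
    ∃ D E : mukaiVertices k d, D ≠ E := by
  have hk0 : 0 < k := by omega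
  have hk1 : 1 < k := by omega
  have hne : (exceptional ⟨0, hk0⟩ : Cls ℤ k) ≠ exceptional ⟨1, hk1⟩ := by
    intro h
    have := congrFun (congrArg Prod.snd h) ⟨0, hk0⟩
    simp [exceptional] at this
  have hadj : (degreeOneGraph k d).Adj (exceptional ⟨0, hk0⟩) (exceptional ⟨1, hk1⟩) := by
    refine ⟨hne, isDegreeOne_exceptional hd _, isDegreeOne_exceptional hd _, ?_⟩
    rw [mukaiForm_exceptional]
    simp [exceptional]
  refine ⟨⟨_, ⟨0, hk0⟩, rfl, SimpleGraph.Reachable.refl _⟩, ⟨_, ⟨0, hk0⟩, rfl, hadj.reachable⟩,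
    fun h => hne (congrArg Subtype.val h)⟩

theorem edgeSet_encard_le_of_hom {V W : Type*} {G : SimpleGraph V} {H : SimpleGraph W}
    (f : G →g H) (hf : Function.Injective f) : G.edgeSet.encard ≤ H.edgeSet.encard :=
  Function.Embedding.encard_le ⟨f.mapEdgeSet, SimpleGraph.Hom.mapEdgeSet.injective f hf⟩

/-- An injective homomorphism into a finite graph with the same number of edges and without
isolated vertices is an isomorphism. -/
theorem exists_iso_of_encard_eq {V W : Type*} [Finite W] {G : SimpleGraph V} {H : SimpleGraph W}
    (f : G →g H) (hf : Function.Injective f) (hH : ∀ w, ∃ w', H.Adj w w')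
    (h : H.edgeSet.encard = G.edgeSet.encard) : ∃ φ : G ≃g H, ∀ v, φ v = f v := by
  have hsub : Sym2.map f '' G.edgeSet ⊆ H.edgeSet := by
    rintro _ ⟨e, he, rfl⟩
    exact (f.mapEdgeSet ⟨e, he⟩).2
  have hinj : Function.Injective (Sym2.map f) := Sym2.map.injective hf
  have heq : Sym2.map f '' G.edgeSet = H.edgeSet := by
    refine ((Set.toFinite H.edgeSet).subset hsub).eq_of_subset_of_encard_le hsub ?_
    rw [hinj.encard_image, h]
  have hadj : ∀ v w, H.Adj (f v) (f w) → G.Adj v w := by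
    intro v w hvw
    rw [← SimpleGraph.mem_edgeSet, ← heq] at hvw
    obtain ⟨e, he, h1⟩ := hvw
    rw [← Sym2.map_mk] at h1
    rw [hinj h1] at he
    exact he
  have hsurj : Function.Surjective f := by
    intro w
    obtain ⟨w', hw⟩ := hH w
    have hw' : s(w, w') ∈ Sym2.map f '' G.edgeSet := by rw [heq]; exact hw
    obtain ⟨e, -, h1⟩ := hw'
    have h2 : w ∈ Sym2.map f e := by rw [h1]; exact Sym2.mem_mk_left w w'
    obtain ⟨v, -, hv⟩ := Sym2.mem_map.1 h2
    exact ⟨v, hv⟩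
  exact ⟨⟨Equiv.ofBijective f ⟨hf, hsurj⟩, fun {v w} => ⟨hadj v w, fun h => f.map_adj h⟩⟩,
    fun _ => rfl⟩

/-- Two vertices of the Mukai edge graph give two points of Q, so every vertex of Q lies on an edge,
and equal edge counts leave no room for further vertices. -/
theorem IsKDPolytope.exists_iso (hd : 2 ≤ d) (hk : d + 2 ≤ k)
    (hfin : (k : ℤ) * ((d : ℤ) - 1) < ((d : ℤ) + 1) ^ 2) {Q : Set (XY k → ℝ)}
    (hQ : IsKDPolytope k d Q)
    (h : (vertexEdgeGraph Q).edgeSet.encard = (mukaiEdgeGraph k d).edgeSet.encard) :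
    ∃ φ : mukaiEdgeGraph k d ≃g vertexEdgeGraph Q,
      ∀ D : mukaiVertices k d, multidegree (φ D : XY k → ℝ) = (D : Cls ℤ k).cast ℝ := by
  obtain ⟨ι, hι, hmd⟩ := hQ.exists_hom hd hk hfin
  obtain ⟨⟨A, hA, hQA⟩, -⟩ := hQ.exists_vertices hd
  have hfinite : Finite (Q.exposedPoints ℝ) := by
    refine (hA.subset ?_).to_subtype
    rw [hQA]
    exact exposedPoints_subset_extremePoints.trans extremePoints_convexHull_subset
  have hno : ∀ w, ∃ w', (vertexEdgeGraph Q).Adj w w' := by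
    intro w
    obtain ⟨D, E, hne⟩ := exists_ne_mukaiVertices (k := k) hd hk
    have h2 : ∃ x ∈ Q, x ≠ w.1 := by
      by_contra! hall
      exact hne (hι (Subtype.ext ((hall _ (ι D).2.1).trans (hall _ (ι E).2.1).symm)))
    have h3 : ∀ w, w ∈ Q.exposedPoints ℝ → (∃ x ∈ Q, x ≠ w) →
        ∃ x ∈ Q.exposedPoints ℝ, w ≠ x ∧ IsExposed ℝ Q (segment ℝ w x) := by
      rw [hQA]
      exact fun w hw h => exists_exposed_segment hA hw h
    obtain ⟨x, hx, hwx, hseg⟩ := h3 w.1 w.2 h2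
    exact ⟨⟨x, hx⟩, fun h => hwx (congrArg Subtype.val h), hseg⟩
  obtain ⟨φ, hφ⟩ := exists_iso_of_encard_eq ι hι hno h
  refine ⟨φ, fun D => ?_⟩
  rw [hφ]
  exact (hmd D _ (ι D).2.1).2 rfl

/-- The sum of the two fractions is k / ((d + 1)(k - d - 1)), with positive denominators. -/
theorem finite_type_inequality (hd : 2 ≤ d) (hk : d + 2 ≤ k)
    (hfin : (1 : ℚ) / 2 < 1 / ((d : ℚ) + 1) + 1 / ((k : ℚ) - (d : ℚ) - 1)) :
    (k : ℤ) * ((d : ℤ) - 1) < ((d : ℤ) + 1) ^ 2 := by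
  have h1 : (0 : ℚ) < (d : ℚ) + 1 := by positivity
  have h2 : (0 : ℚ) < (k : ℚ) - (d : ℚ) - 1 := by
    have : ((d + 2 : ℕ) : ℚ) ≤ k := by exact_mod_cast hk
    push_cast at this
    linarith
  rw [div_add_div _ _ h1.ne' h2.ne', div_lt_div_iff₀ two_pos (mul_pos h1 h2)] at hfin
  have h3 : (k : ℚ) * ((d : ℚ) - 1) < ((d : ℚ) + 1) ^ 2 := by nlinarith
  exact_mod_cast h3

end Polytope

end MukaiKD

end

theorem theorem6p3 (k d : ℕ) (hd : 2 ≤ d) (hk : d + 2 ≤ k)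
    (hfin : (1 : ℚ) / 2 < 1 / ((d : ℚ) + 1) + 1 / ((k : ℚ) - (d : ℚ) - 1)) :
    -- the Mukai edge graph is a subgraph of the graph of every KD polytope, where the divisor `D`
    -- corresponds to the unique point of multidegree `D`
    (∀ Q : Set (XY k → ℝ), IsKDPolytope k d Q →
      ∃ ι : mukaiEdgeGraph k d →g vertexEdgeGraph Q, Function.Injective ι ∧
        ∀ (D : mukaiVertices k d), ∀ v ∈ Q,
          multidegree v = (D : Cls ℤ k).cast ℝ ↔ v = (ι D : XY k → ℝ)) ∧
    -- the number of edges is at least that of the Mukai edge graph, and in case of equality the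
    -- graph of the polytope is the Mukai edge graph
    (∀ Q : Set (XY k → ℝ), IsKDPolytope k d Q →
      (mukaiEdgeGraph k d).edgeSet.encard ≤ (vertexEdgeGraph Q).edgeSet.encard ∧
      ((vertexEdgeGraph Q).edgeSet.encard = (mukaiEdgeGraph k d).edgeSet.encard →
        ∃ φ : mukaiEdgeGraph k d ≃g vertexEdgeGraph Q,
          ∀ D : mukaiVertices k d, multidegree (φ D : XY k → ℝ) = (D : Cls ℤ k).cast ℝ)) ∧
    -- a KD polytope whose graph is the Mukai edge graph has the minimal number of edges
    (∀ Q : Set (XY k → ℝ), IsKDPolytope k d Q →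
      Nonempty (mukaiEdgeGraph k d ≃g vertexEdgeGraph Q) →
      ∀ Q' : Set (XY k → ℝ), IsKDPolytope k d Q' →
        (vertexEdgeGraph Q).edgeSet.encard ≤ (vertexEdgeGraph Q').edgeSet.encard) ∧
    -- if the lower bound is attained at all, then every KD polytope with the minimal number of
    -- edges has the Mukai edge graph as its graph
    ((∃ Q₀ : Set (XY k → ℝ), IsKDPolytope k d Q₀ ∧
        (vertexEdgeGraph Q₀).edgeSet.encard = (mukaiEdgeGraph k d).edgeSet.encard) →
      ∀ Q : Set (XY k → ℝ), IsKDPolytope k d Q →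
        (∀ Q' : Set (XY k → ℝ), IsKDPolytope k d Q' →
          (vertexEdgeGraph Q).edgeSet.encard ≤ (vertexEdgeGraph Q').edgeSet.encard) →
        ∃ φ : mukaiEdgeGraph k d ≃g vertexEdgeGraph Q,
          ∀ D : mukaiVertices k d, multidegree (φ D : XY k → ℝ) = (D : Cls ℤ k).cast ℝ) := by
  have hfin' := finite_type_inequality hd hk hfin
  have hle : ∀ Q : Set (XY k → ℝ), IsKDPolytope k d Q →
      (mukaiEdgeGraph k d).edgeSet.encard ≤ (vertexEdgeGraph Q).edgeSet.encard := fun Q hQ => by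
    obtain ⟨ι, hι, -⟩ := hQ.exists_hom hd hk hfin'
    exact edgeSet_encard_le_of_hom ι hι
  refine ⟨fun Q hQ => hQ.exists_hom hd hk hfin',
    fun Q hQ => ⟨hle Q hQ, fun h => hQ.exists_iso hd hk hfin' h⟩, ?_, ?_⟩
  · rintro Q - ⟨φ⟩ Q' hQ'
    exact (edgeSet_encard_le_of_hom φ.symm.toHom φ.symm.injective).trans (hle Q' hQ')
  · rintro ⟨Q₀, hQ₀, h₀⟩ Q hQ hmin
    -- Comparison with Q₀ squeezes the minimal number of edges onto the lower bound.
    exact hQ.exists_iso hd hk hfin' (le_antisymm ((hmin Q₀ hQ₀).trans h₀.le) (hle Q hQ))
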